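/- Let $d\ge 2$, let $E\subset(0,\infty)$ be an arbitrary set, and let $1\le p<\frac{d}{d-1}$. For a function $f$ on $\mathbb R^d$ let $A_tf(x)=\int_{S^{d-1}}f(x-ty')\,d\sigma(y')$, where $\sigma$ is the rotationally invariant probability measure on the unit sphere $S^{d-1}$, and let $\mathcal M_Ef(x)=\sup_{t\in E}|A_tf(x)|$ (with $|A_tf(x)|=\infty$ where the integral does not converge absolutely). For $k\in\mathbb Z$ let $E^k=E\cap[2^k,2^{k+1}]$, and for $a>0$ let $N(E^k,a)$ be the minimal number of intervals of length $a$ needed to cover $E^k$. Then the following are equivalent: (i) there is a constant $C$ such that for all radial functions $f\in L^p(\mathbb R^d)$, $f(x)=f_0(|x|)$, and all $\alpha>0$, $$\bigl|\{x\in\mathbb R^d:\mathcal M_Ef(x)>\alpha\}\bigr|\le C\,\frac{\|f\|_{L^p(\mathbb R^d)}^p}{\alpha^p};$$ (ii) there is a constant $C'$ such that for all $\delta\in(0,1/2)$, $$\sup_{k\in\mathbb Z}N(E^k,2^k\delta)\le C'\,\delta^{-(d-1)(p-1)}.$$ -/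

import Mathlib

open MeasureTheory Metric Set
open scoped NNReal ENNReal

namespace SphericalMaximal

/-- The rotationally invariant measure on the unit sphere `S^{d-1}`, normalized to total mass `1`. -/
noncomputable def sphereMeasure (d : ℕ) :
    Measure (sphere (0 : EuclideanSpace ℝ (Fin d)) 1) :=
  ((volume : Measure (EuclideanSpace ℝ (Fin d))).toSphere univ)⁻¹ •
    (volume : Measure (EuclideanSpace ℝ (Fin d))).toSphere

/-- The spherical mean `A_t f(x) = ∫_{S^{d-1}} f(x - t y') dσ(y')`. -/
noncomputable def sphericalMean {𝕜 : Type*} [RCLike 𝕜] {d : ℕ} (t : ℝ)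
    (f : EuclideanSpace ℝ (Fin d) → 𝕜) (x : EuclideanSpace ℝ (Fin d)) : 𝕜 :=
  ∫ y : sphere (0 : EuclideanSpace ℝ (Fin d)) 1,
    f (x - t • (y : EuclideanSpace ℝ (Fin d))) ∂(sphereMeasure d)

open Classical in
/-- The size `|A_t f(x)|` in `[0, ∞]`. If the integral defining `A_t f(x)` does not converge
absolutely, the value is `∞` (not the default value `0` of the Bochner integral). -/
noncomputable def sphericalMeanAbs {𝕜 : Type*} [RCLike 𝕜] {d : ℕ} (t : ℝ)
    (f : EuclideanSpace ℝ (Fin d) → 𝕜) (x : EuclideanSpace ℝ (Fin d)) : ℝ≥0∞ :=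
  if Integrable (fun y : sphere (0 : EuclideanSpace ℝ (Fin d)) 1 =>
      f (x - t • (y : EuclideanSpace ℝ (Fin d)))) (sphereMeasure d)
  then ‖sphericalMean t f x‖ₑ else ∞

/-- The maximal function `M_E f(x) = sup_{t ∈ E} |A_t f(x)|`. -/
noncomputable def maximalFunction {𝕜 : Type*} [RCLike 𝕜] {d : ℕ} (E : Set ℝ)
    (f : EuclideanSpace ℝ (Fin d) → 𝕜) (x : EuclideanSpace ℝ (Fin d)) : ℝ≥0∞ :=
  ⨆ t ∈ E, sphericalMeanAbs t f x

/-- `f(x) = f₀(|x|)` for some function `f₀`. -/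
def IsRadial {𝕜 : Type*} {d : ℕ} (f : EuclideanSpace ℝ (Fin d) → 𝕜) : Prop :=
  ∃ f₀ : ℝ → 𝕜, ∀ x, f x = f₀ ‖x‖

/-- The dyadic piece `E^k = E ∩ [2^k, 2^{k+1}]`. -/
def dyadicPiece (E : Set ℝ) (k : ℤ) : Set ℝ :=
  Icc ((2 : ℝ) ^ k) ((2 : ℝ) ^ (k + 1)) ∩ E

/-- The entropy number `N(A, a)`: the minimal number of intervals of length `a` needed to
cover `A` (`⊤` if no finite number suffices). -/
noncomputable def entropyNumber (A : Set ℝ) (a : ℝ) : ℕ∞ :=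
  ⨅ (s : Finset ℝ) (_ : A ⊆ ⋃ u ∈ s, Icc u (u + a)), (s.card : ℕ∞)

end SphericalMaximal

/-! Write `d = n + 2`, `D = d - 1`, `β = D(p - 1)` and `κ = D + β = Dp`. The condition `p < d/(d -
1)` says exactly that `β < 1`. For radial `f` with profile `g`, and `r = |x|`, the mean `A_t f(x)`
is a constant times `∫_0^π g(s) sin^n θ dθ`, where `s` is the third side of a triangle with sides
`r`, `t` enclosing the angle `θ`. Moreover `r t sin θ dθ = s ds`, so everything takes place on the
half line with the measure `s^D ds`.

Necessity (`entropyNumber_le_of_weak_type`): test on the indicator of a ball of radius `2·2^k δ`. If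
`|x|` is within `2^k δ` of some `t ∈ E^k`, a cap of measure about `δ^D` of the sphere around `x`
lies in the ball. Such `x` fill a set of measure at least about `N (2^k)^d δ`, against `‖f‖_p^p ≈
(2^k δ)^d` and `α^p ≈ δ^{Dp}`; this is the bound on `N`.

Sufficiency (`weak_type_of_hasCover`): cut the angles into arcs where `θ` or `π - θ` is about
`2^{-m}`. By pigeonhole and Hölder (`exists_large_piece`), a large mean forces one arc to carry a
large integral of `s h(s) ds`, with `h = |g|^p`. Each such arc is mapped by `θ ↦ s` into a set on
which `t` can be replaced by one of boundedly many centres covering `E^k`, and three regimes arise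
(`largePieceSet_subset`).

When `t` is at most `r` (all far arcs, and near arcs if `2t ≤ r`), `s` lies within about `t 4^{-m}`
of `r ± t`. All scales of `t` below `r` compete, and a Vitali argument with shifts costs a factor `m
+ 1` (`radialMeasure_outer_le`). When `r` is at most `t`, each centre is handled by Chebyshev, and
the density `r^D` outweighs the number of centres because `β < 1` (`radialMeasure_inner_le`).

When `r` and `t` are comparable and `|r - t| ≈ 2^{k-l}`, near arcs behave differently below and
above the angle `2^{-l}`, and no loss in `l` or `m` is affordable. The pigeonhole weights are
therefore centred at `l`, and decay only in `|m - l|`. With the scale of `s` fixed, the number of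
centres times `r^D` grows exactly like the threshold `2^{κl}`, and a sum over thresholds that at
least double costs only a factor 2 (`tsum_lacunary_le`). This gives the endpoint. The remaining case
`r = t` is negligible because `E` is null when `β < 1`. -/

namespace SphericalMaximal

/-! ### Polar coordinates. -/

section Polar

theorem norm_smul_sphere {V : Type*} [NormedAddCommGroup V] [NormedSpace ℝ V] {s : ℝ} (hs : 0 < s)
    (y : sphere (0 : V) 1) : ‖s • (y : V)‖ = s := by
  rw [norm_smul, Real.norm_of_nonneg hs.le]; simp

variable {V : Type*} [NormedAddCommGroup V] [NormedSpace ℝ V] [MeasurableSpace V] [BorelSpace V]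
  [FiniteDimensional ℝ V] [Nontrivial V] (μ : Measure V) [μ.IsAddHaarMeasure]

/-- Integration in polar coordinates. -/
theorem lintegral_polar {φ : V → ℝ≥0∞} (hφ : Measurable φ) :
    ∫⁻ z, φ z ∂μ = ∫⁻ y : sphere (0 : V) 1, (∫⁻ s : ℝ in Ioi 0,
      ENNReal.ofReal (s ^ (Module.finrank ℝ V - 1)) * φ (s • (y : V))) ∂μ.toSphere := by
  have hm : Measurable fun q : sphere (0 : V) 1 × Ioi (0 : ℝ) ↦ φ ((q.2 : ℝ) • (q.1 : V)) := by
    fun_prop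
  calc ∫⁻ z, φ z ∂μ = ∫⁻ z : ({(0 : V)}ᶜ : Set V), φ z ∂(μ.comap (↑)) := by
        rw [lintegral_subtype_comap (measurableSet_singleton _).compl, restrict_compl_singleton]
    _ = ∫⁻ q, φ ((q.2 : ℝ) • (q.1 : V))
          ∂(μ.toSphere.prod (.volumeIoiPow (Module.finrank ℝ V - 1))) := by
        rw [← μ.measurePreserving_homeomorphUnitSphereProd.lintegral_comp_emb
          (Homeomorph.measurableEmbedding _)]
        refine lintegral_congr fun z ↦ ?_
        have hz : ‖(z : V)‖ ≠ 0 := norm_ne_zero_iff.2 z.2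
        congr 1
        simp [smul_smul, hz]
    _ = ∫⁻ y : sphere (0 : V) 1, ∫⁻ s, φ ((s : ℝ) • (y : V))
          ∂(.volumeIoiPow (Module.finrank ℝ V - 1)) ∂μ.toSphere :=
        lintegral_prod _ hm.aemeasurable
    _ = _ := by
        refine lintegral_congr fun y ↦ ?_
        rw [Measure.volumeIoiPow, lintegral_withDensity_eq_lintegral_mul _ (by fun_prop)
          (by fun_prop)]
        exact lintegral_subtype_comap measurableSet_Ioi
          (fun s : ℝ ↦ ENNReal.ofReal (s ^ (Module.finrank ℝ V - 1)) * φ (s • (y : V)))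

theorem lintegral_norm_polar {φ : ℝ → ℝ≥0∞} (hφ : Measurable φ) :
    ∫⁻ z, φ ‖z‖ ∂μ = μ.toSphere univ * ∫⁻ s : ℝ in Ioi 0,
      ENNReal.ofReal (s ^ (Module.finrank ℝ V - 1)) * φ s := by
  rw [lintegral_polar μ (by fun_prop), mul_comm, ← lintegral_const]
  refine lintegral_congr fun y ↦ ?_
  refine setLIntegral_congr_fun measurableSet_Ioi fun s hs ↦ ?_
  simp only [norm_smul_sphere hs]

/-- Integrate the indicator of a measurable null superset in polar coordinates; the density `s ^
(dim - 1)` is positive, so it does not hide exceptional `s`. -/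
theorem ae_polar {P : V → Prop} (h : ∀ᵐ z ∂μ, P z) :
    ∀ᵐ y : sphere (0 : V) 1 ∂μ.toSphere, ∀ᵐ s : ℝ, 0 < s → P (s • (y : V)) := by
  obtain ⟨N, hN, hNm, hN0⟩ := exists_measurable_superset_of_null (ae_iff.1 h)
  have h0 : ∫⁻ z, N.indicator 1 z ∂μ = 0 := by rw [lintegral_indicator_one hNm, hN0]
  have hm : Measurable (N.indicator (1 : V → ℝ≥0∞)) := measurable_one.indicator hNm
  have hm' : Measurable (fun y : sphere (0 : V) 1 ↦ ∫⁻ s : ℝ in Ioi 0,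
      ENNReal.ofReal (s ^ (Module.finrank ℝ V - 1)) * N.indicator 1 (s • (y : V))) := by
    refine Measurable.lintegral_prod_right' (f := fun q : sphere (0 : V) 1 × ℝ ↦
      ENNReal.ofReal (q.2 ^ (Module.finrank ℝ V - 1)) * N.indicator 1 (q.2 • (q.1 : V))) ?_
    fun_prop
  rw [lintegral_polar μ hm, lintegral_eq_zero_iff hm'] at h0
  filter_upwards [h0] with y hy
  simp only [Pi.zero_apply] at hy
  rw [lintegral_eq_zero_iff (by fun_prop)] at hy
  have hy2 := (ae_restrict_iff' measurableSet_Ioi).1 hy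
  filter_upwards [hy2] with s hs hs0
  by_contra hP
  have h1 := hs hs0
  have h2 : s • (y : V) ∈ N := hN hP
  have h3 : 0 < s ^ (Module.finrank ℝ V - 1) := by positivity
  simp [h2] at h1
  exact absurd h1 (not_le.2 h3)

end Polar

/-! ### The zonal integration formula on the sphere. -/

section SphereFormula

open scoped RealInnerProductSpace

theorem exists_isometry_map_eq {V : Type*} [NormedAddCommGroup V] [InnerProductSpace ℝ V]
    {v w : V} (h : ‖v‖ = ‖w‖) : ∃ L : V ≃ₗᵢ[ℝ] V, L v = w :=
  ⟨_, Submodule.reflection_sub h⟩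

/-- Splitting off the first coordinate. -/
theorem lintegral_euclidean_succ (n : ℕ) {φ : ℝ → ℝ → ℝ≥0∞}
    (hφ : Measurable (Function.uncurry φ)) :
    ∫⁻ z : EuclideanSpace ℝ (Fin (n + 1)), φ (z 0) ‖z‖ =
      ∫⁻ a : ℝ, ∫⁻ w : EuclideanSpace ℝ (Fin n), φ a √(a ^ 2 + ‖w‖ ^ 2) := by
  have h1 := (EuclideanSpace.volume_preserving_symm_measurableEquiv_toLp (Fin (n + 1)))
  have h2 := volume_preserving_piFinSuccAbove (fun _ : Fin (n + 1) ↦ ℝ) 0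
  have h3 := (EuclideanSpace.volume_preserving_symm_measurableEquiv_toLp (Fin n))
  have hψ : Measurable fun q : ℝ × (Fin n → ℝ) ↦ φ q.1 √(q.1 ^ 2 + ∑ i, q.2 i ^ 2) := by
    have : Measurable fun q : ℝ × (Fin n → ℝ) ↦ (q.1, √(q.1 ^ 2 + ∑ i, q.2 i ^ 2)) := by
      fun_prop
    exact hφ.comp this
  calc ∫⁻ z : EuclideanSpace ℝ (Fin (n + 1)), φ (z 0) ‖z‖
      = ∫⁻ q : ℝ × (Fin n → ℝ), φ q.1 √(q.1 ^ 2 + ∑ i, q.2 i ^ 2) := by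
        rw [← (h2.comp h1).lintegral_comp hψ]
        refine lintegral_congr fun z ↦ ?_
        rw [EuclideanSpace.norm_eq, Fin.sum_univ_succ]
        simp [MeasurableEquiv.piFinSuccAbove, Fin.tail]
    _ = ∫⁻ a : ℝ, ∫⁻ w : Fin n → ℝ, φ a √(a ^ 2 + ∑ i, w i ^ 2) :=
        lintegral_prod _ hψ.aemeasurable
    _ = _ := by
        refine lintegral_congr fun a ↦ ?_
        rw [← h3.lintegral_comp (f := fun w : Fin n → ℝ ↦ φ a √(a ^ 2 + ∑ i, w i ^ 2))
          (hψ.comp (measurable_prodMk_left (x := a)))]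
        refine lintegral_congr fun w ↦ ?_
        rw [EuclideanSpace.norm_eq, Real.sq_sqrt (by positivity)]
        simp

/-- Polar coordinates in the upper half plane. -/
theorem lintegral_half_plane {φ : ℝ → ℝ → ℝ≥0∞} (hφ : Measurable (Function.uncurry φ)) :
    ∫⁻ a : ℝ, ∫⁻ b : ℝ in Ioi 0, φ a b =
      ∫⁻ ρ : ℝ in Ioi 0, ∫⁻ θ : ℝ in Ioo 0 Real.pi,
        ENNReal.ofReal ρ * φ (ρ * Real.cos θ) (ρ * Real.sin θ) := by
  have hψ : Measurable fun q : ℝ × ℝ ↦ (Ioi (0 : ℝ)).indicator (φ q.1) q.2 := by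
    have : (fun q : ℝ × ℝ ↦ (Ioi (0 : ℝ)).indicator (φ q.1) q.2) =
      (Prod.snd ⁻¹' Ioi (0 : ℝ)).indicator (Function.uncurry φ) := by
        ext q; simp [indicator, Function.uncurry]
    rw [this]
    exact hφ.indicator (measurable_snd measurableSet_Ioi)
  calc ∫⁻ a : ℝ, ∫⁻ b : ℝ in Ioi 0, φ a b
      = ∫⁻ a : ℝ, ∫⁻ b : ℝ, (Ioi (0 : ℝ)).indicator (φ a) b := by
        refine lintegral_congr fun a ↦ ?_
        rw [lintegral_indicator measurableSet_Ioi]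
    _ = ∫⁻ q : ℝ × ℝ, (Ioi (0 : ℝ)).indicator (φ q.1) q.2 :=
        (lintegral_prod _ hψ.aemeasurable).symm
    _ = ∫⁻ q : ℝ × ℝ in Ioi 0 ×ˢ Ioo (-Real.pi) Real.pi, ENNReal.ofReal q.1 *
          (Ioi (0 : ℝ)).indicator (φ (q.1 * Real.cos q.2)) (q.1 * Real.sin q.2) := by
        rw [← lintegral_comp_polarCoord_symm]; rfl
    _ = ∫⁻ ρ : ℝ in Ioi 0, ∫⁻ θ : ℝ in Ioo (-Real.pi) Real.pi, ENNReal.ofReal ρ *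
          (Ioi (0 : ℝ)).indicator (φ (ρ * Real.cos θ)) (ρ * Real.sin θ) := by
        rw [Measure.volume_eq_prod, ← Measure.prod_restrict, lintegral_prod]
        have : Measurable fun q : ℝ × ℝ ↦ (q.1 * Real.cos q.2, q.1 * Real.sin q.2) := by
          fun_prop
        exact ((measurable_fst.ennreal_ofReal).mul (hψ.comp this)).aemeasurable
    _ = _ := by
        refine setLIntegral_congr_fun measurableSet_Ioi fun ρ hρ ↦ ?_
        have hρ : 0 < ρ := hρ
        rw [← lintegral_indicator measurableSet_Ioo, ← lintegral_indicator measurableSet_Ioo]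
        refine lintegral_congr fun θ ↦ ?_
        by_cases h1 : θ ∈ Ioo 0 Real.pi
        · have h2 : θ ∈ Ioo (-Real.pi) Real.pi := ⟨by linarith [h1.1, Real.pi_pos], h1.2⟩
          have h3 : 0 < Real.sin θ := Real.sin_pos_of_mem_Ioo h1
          rw [indicator_of_mem h1, indicator_of_mem h2, indicator_of_mem]
          exact mul_pos hρ h3
        · rw [indicator_of_notMem h1]
          by_cases h2 : θ ∈ Ioo (-Real.pi) Real.pi
          · have h4 : θ ≤ 0 := by
              by_contra h; exact h1 ⟨not_le.1 h, h2.2⟩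
            have h3 : Real.sin θ ≤ 0 := Real.sin_nonpos_of_nonpos_of_neg_pi_le h4 h2.1.le
            rw [indicator_of_mem h2, indicator_of_notMem, mul_zero]
            simp only [mem_Ioi, not_lt]
            exact mul_nonpos_of_nonneg_of_nonpos hρ.le h3
          · rw [indicator_of_notMem h2]

/-- The normalizing constant in the zonal integration formula. -/
noncomputable def zonalConst (n : ℕ) : ℝ≥0∞ :=
  ((volume : Measure (EuclideanSpace ℝ (Fin (n + 2)))).toSphere univ)⁻¹ *
    (volume : Measure (EuclideanSpace ℝ (Fin (n + 1)))).toSphere univ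

theorem zonalConst_ne_zero (n : ℕ) : zonalConst n ≠ 0 := by
  refine mul_ne_zero (ENNReal.inv_ne_zero.2 (measure_ne_top _ _)) ?_
  rw [Ne, Measure.measure_univ_eq_zero]
  exact Measure.toSphere_ne_zero _

theorem zonalConst_ne_top (n : ℕ) : zonalConst n ≠ ∞ := by
  refine ENNReal.mul_ne_top (ENNReal.inv_ne_top.2 ?_) (measure_ne_top _ _)
  rw [Ne, Measure.measure_univ_eq_zero]
  exact Measure.toSphere_ne_zero _

/-- One integral over the unit ball is computed in two ways. Polar coordinates in the whole space
give the sphere integral times a radial factor `K`. After rotating `e` to the first axis, splitting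
off that coordinate and using polar coordinates twice (in the complement, then in the half plane)
gives the angular integral times the same `K`. The cutoff `W` makes `K` finite, so it cancels. -/
theorem toSphere_lintegral_inner (n : ℕ) {e : EuclideanSpace ℝ (Fin (n + 2))} (he : ‖e‖ = 1)
    {F : ℝ → ℝ≥0∞} (hF : Measurable F) :
    ∫⁻ y : sphere (0 : EuclideanSpace ℝ (Fin (n + 2))) 1, F ⟪e, (y : EuclideanSpace ℝ (Fin (n + 2)))⟫
        ∂(volume : Measure (EuclideanSpace ℝ (Fin (n + 2)))).toSphere =
      (volume : Measure (EuclideanSpace ℝ (Fin (n + 1)))).toSphere univ *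
        ∫⁻ θ : ℝ in Ioo 0 Real.pi, ENNReal.ofReal (Real.sin θ ^ n) * F (Real.cos θ) := by
  set W : ℝ → ℝ≥0∞ := (Iio (1 : ℝ)).indicator 1 with hW
  have hWm : Measurable W := measurable_one.indicator measurableSet_Iio
  set K : ℝ≥0∞ := ∫⁻ s : ℝ in Ioi 0, ENNReal.ofReal (s ^ (n + 1)) * W s with hK
  have hK' : K = ∫⁻ s : ℝ in Ioo 0 1, ENNReal.ofReal (s ^ (n + 1)) := by
    rw [hK, ← lintegral_indicator measurableSet_Ioi, ← lintegral_indicator measurableSet_Ioo]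
    refine lintegral_congr fun s ↦ ?_
    simp only [indicator, W, mem_Ioi, mem_Iio, mem_Ioo, Pi.one_apply]
    split_ifs <;> simp_all
  have hK0 : K ≠ 0 := by
    rw [hK', Ne, lintegral_eq_zero_iff (by fun_prop), Filter.EventuallyEq,
      ae_restrict_iff' measurableSet_Ioo]
    intro h
    have h2 : ∀ᵐ s : ℝ, s ∉ Ioo (0 : ℝ) 1 := by
      filter_upwards [h] with s hs hs1
      have h3 := hs hs1
      have : 0 < s ^ (n + 1) := pow_pos hs1.1 _
      simp only [Pi.zero_apply, ENNReal.ofReal_eq_zero] at h3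
      linarith
    have h4 : volume (Ioo (0 : ℝ) 1) = 0 := by
      rw [ae_iff] at h2
      simpa only [not_not, ofPred_mem_eq] using h2
    simp at h4
  have hKt : K ≠ ∞ := by
    rw [hK']
    refine ((setLIntegral_mono (g := fun _ ↦ 1) measurable_const fun s hs ↦ ?_).trans_lt
      (?_ : _ < ∞)).ne
    · rw [← ENNReal.ofReal_one]
      exact ENNReal.ofReal_le_ofReal (pow_le_one₀ hs.1.le hs.2.le)
    · simp
  have hA : ∫⁻ z : EuclideanSpace ℝ (Fin (n + 2)), W ‖z‖ * F (⟪e, z⟫ / ‖z‖) =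
      K * ∫⁻ y : sphere (0 : EuclideanSpace ℝ (Fin (n + 2))) 1, F ⟪e, (y : EuclideanSpace ℝ (Fin (n + 2)))⟫
        ∂(volume : Measure (EuclideanSpace ℝ (Fin (n + 2)))).toSphere := by
    rw [lintegral_polar _ (by fun_prop), ← lintegral_const_mul _ (by fun_prop)]
    refine lintegral_congr fun y ↦ ?_
    rw [hK, ← lintegral_mul_const _ (by fun_prop)]
    refine setLIntegral_congr_fun measurableSet_Ioi fun s hs ↦ ?_
    have hs : 0 < s := hs
    simp only [norm_smul_sphere hs, inner_smul_right, finrank_euclideanSpace_fin]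
    rw [mul_div_cancel_left₀ _ hs.ne', mul_assoc]
    rfl
  obtain ⟨L, hL⟩ := exists_isometry_map_eq (v := EuclideanSpace.single (0 : Fin (n + 2)) (1 : ℝ))
    (w := e) (by simp [he])
  have hB : ∫⁻ z : EuclideanSpace ℝ (Fin (n + 2)), W ‖z‖ * F (⟪e, z⟫ / ‖z‖) =
      ∫⁻ z : EuclideanSpace ℝ (Fin (n + 2)), W ‖z‖ * F (z 0 / ‖z‖) := by
    rw [← L.measurePreserving.lintegral_comp (by fun_prop)]
    refine lintegral_congr fun z ↦ ?_
    rw [← hL, L.inner_map_map, L.norm_map]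
    simp [EuclideanSpace.inner_single_left]
  have hC : ∫⁻ z : EuclideanSpace ℝ (Fin (n + 2)), W ‖z‖ * F (z 0 / ‖z‖) =
      (volume : Measure (EuclideanSpace ℝ (Fin (n + 1)))).toSphere univ *
      (K * ∫⁻ θ : ℝ in Ioo 0 Real.pi, ENNReal.ofReal (Real.sin θ ^ n) * F (Real.cos θ)) := by
    rw [lintegral_euclidean_succ (n + 1) (φ := fun a b ↦ W b * F (a / b)) (by
      unfold Function.uncurry; fun_prop)]
    have h1 : ∀ a : ℝ, ∫⁻ w : EuclideanSpace ℝ (Fin (n + 1)), W √(a ^ 2 + ‖w‖ ^ 2) *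
        F (a / √(a ^ 2 + ‖w‖ ^ 2)) =
        (volume : Measure (EuclideanSpace ℝ (Fin (n + 1)))).toSphere univ *
        ∫⁻ b : ℝ in Ioi 0, ENNReal.ofReal (b ^ n) * (W √(a ^ 2 + b ^ 2) *
        F (a / √(a ^ 2 + b ^ 2))) := fun a ↦ by
      rw [lintegral_norm_polar (volume : Measure (EuclideanSpace ℝ (Fin (n + 1))))
        (φ := fun b ↦ W √(a ^ 2 + b ^ 2) * F (a / √(a ^ 2 + b ^ 2))) (by fun_prop)]
      simp
    simp_rw [h1]
    have hm2 : Measurable fun q : ℝ × ℝ ↦ ENNReal.ofReal (q.2 ^ n) * (W √(q.1 ^ 2 + q.2 ^ 2) *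
        F (q.1 / √(q.1 ^ 2 + q.2 ^ 2))) := by fun_prop
    rw [lintegral_const_mul _ hm2.lintegral_prod_right',
      lintegral_half_plane (φ := fun a b ↦ ENNReal.ofReal (b ^ n) * (W √(a ^ 2 + b ^ 2) *
        F (a / √(a ^ 2 + b ^ 2)))) hm2]
    congr 1
    rw [hK, ← lintegral_mul_const _ (by fun_prop)]
    refine setLIntegral_congr_fun measurableSet_Ioi fun ρ hρ ↦ ?_
    have hρ : 0 < ρ := hρ
    rw [← lintegral_const_mul _ (by fun_prop)]
    refine setLIntegral_congr_fun measurableSet_Ioo fun θ hθ ↦ ?_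
    have h3 : (ρ * Real.cos θ) ^ 2 + (ρ * Real.sin θ) ^ 2 = ρ ^ 2 := by
      linear_combination ρ ^ 2 * Real.sin_sq_add_cos_sq θ
    simp only [h3, Real.sqrt_sq hρ.le, mul_div_cancel_left₀ _ hρ.ne']
    rw [mul_pow, ENNReal.ofReal_mul (by positivity), pow_succ, ENNReal.ofReal_mul (by positivity)]
    ring
  have hD := hA.symm.trans (hB.trans hC)
  rw [mul_left_comm] at hD
  exact (ENNReal.mul_right_inj hK0 hKt).1 hD

/-- Zonal integration: the mean of a radial function over the sphere of radius `t` about `x`. -/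
theorem lintegral_sphere_radial (n : ℕ) {x : EuclideanSpace ℝ (Fin (n + 2))} (hx : x ≠ 0) (t : ℝ)
    {φ : ℝ → ℝ≥0∞} (hφ : Measurable φ) :
    ∫⁻ y : sphere (0 : EuclideanSpace ℝ (Fin (n + 2))) 1,
        φ ‖x - t • (y : EuclideanSpace ℝ (Fin (n + 2)))‖ ∂(sphereMeasure (n + 2)) =
      zonalConst n * ∫⁻ θ : ℝ in Ioo 0 Real.pi, ENNReal.ofReal (Real.sin θ ^ n) *
        φ √(‖x‖ ^ 2 + t ^ 2 - 2 * ‖x‖ * t * Real.cos θ) := by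
  have hx0 : ‖x‖ ≠ 0 := norm_ne_zero_iff.2 hx
  have he : ‖(‖x‖⁻¹ • x)‖ = 1 := by simp [norm_smul, hx0]
  rw [sphereMeasure, lintegral_smul_measure, zonalConst, mul_assoc,
    ← toSphere_lintegral_inner n he
      (F := fun u ↦ φ √(‖x‖ ^ 2 + t ^ 2 - 2 * ‖x‖ * t * u)) (by fun_prop), smul_eq_mul]
  congr 1
  refine lintegral_congr fun y ↦ ?_
  congr 1
  have hy : ‖(y : EuclideanSpace ℝ (Fin (n + 2)))‖ = 1 := by simp
  have h1 : ‖x - t • (y : EuclideanSpace ℝ (Fin (n + 2)))‖ ^ 2 = ‖x‖ ^ 2 + t ^ 2 - 2 * ‖x‖ * t *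
      ⟪‖x‖⁻¹ • x, (y : EuclideanSpace ℝ (Fin (n + 2)))⟫ := by
    rw [norm_sub_sq_real, norm_smul, hy, inner_smul_right, inner_smul_left]
    simp only [Real.norm_eq_abs, mul_one, sq_abs, map_inv₀, conj_trivial]
    field_simp
    ring
  rw [← h1, Real.sqrt_sq (norm_nonneg _)]

end SphereFormula

/-! ### The law of cosines as a change of variables. -/

section ThirdSide

/-- The third side of a triangle with sides `r`, `t` enclosing the angle `θ`. -/
noncomputable def thirdSide (r t θ : ℝ) : ℝ := √(r ^ 2 + t ^ 2 - 2 * r * t * Real.cos θ)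

variable {r t : ℝ}

theorem thirdSide_nonneg (r t θ : ℝ) : 0 ≤ thirdSide r t θ := Real.sqrt_nonneg _

theorem thirdSide_sq (hr : 0 < r) (ht : 0 < t) (θ : ℝ) :
    thirdSide r t θ ^ 2 = (r - t) ^ 2 + 2 * r * t * (1 - Real.cos θ) := by
  rw [thirdSide, Real.sq_sqrt]
  · ring
  · nlinarith [sq_nonneg (r - t), mul_pos hr ht, Real.cos_le_one θ]

theorem thirdSide_comm (r t θ : ℝ) : thirdSide r t θ = thirdSide t r θ := by
  unfold thirdSide; ring_nf

theorem cos_lt_one_of_mem {θ : ℝ} (hθ : θ ∈ Ioo 0 Real.pi) : Real.cos θ < 1 := by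
  rw [← Real.cos_zero]
  exact Real.cos_lt_cos_of_nonneg_of_le_pi le_rfl hθ.2.le hθ.1

theorem thirdSide_pos (hr : 0 < r) (ht : 0 < t) {θ : ℝ} (hθ : θ ∈ Ioo 0 Real.pi) :
    0 < thirdSide r t θ := by
  have h := thirdSide_sq hr ht θ
  have h1 := cos_lt_one_of_mem hθ
  have h2 : 0 < thirdSide r t θ ^ 2 := by
    rw [h]
    have := mul_pos (mul_pos hr ht) (sub_pos.2 h1)
    nlinarith [sq_nonneg (r - t)]
  exact lt_of_pow_lt_pow_left₀ 2 (thirdSide_nonneg r t θ) (by simpa using h2)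

theorem measurable_thirdSide (r t : ℝ) : Measurable (thirdSide r t) := by
  unfold thirdSide; fun_prop

theorem hasDerivAt_thirdSide (hr : 0 < r) (ht : 0 < t) {θ : ℝ} (hθ : θ ∈ Ioo 0 Real.pi) :
    HasDerivAt (thirdSide r t) (r * t * Real.sin θ / thirdSide r t θ) θ := by
  have h1 : HasDerivAt (fun θ ↦ r ^ 2 + t ^ 2 - 2 * r * t * Real.cos θ)
      (2 * r * t * Real.sin θ) θ := by
    have := ((Real.hasDerivAt_cos θ).const_mul (2 * r * t)).const_sub (r ^ 2 + t ^ 2)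
    exact this.congr_deriv (by ring)
  have h2 := thirdSide_pos hr ht hθ
  have h3 : r ^ 2 + t ^ 2 - 2 * r * t * Real.cos θ ≠ 0 := by
    intro h
    simp [thirdSide, h] at h2
  refine (h1.sqrt h3).congr_deriv ?_
  rw [thirdSide] at h2 ⊢
  field_simp

theorem injOn_thirdSide (hr : 0 < r) (ht : 0 < t) : InjOn (thirdSide r t) (Ioo 0 Real.pi) := by
  intro a ha b hb hab
  have h := thirdSide_sq hr ht a
  rw [hab, thirdSide_sq hr ht b] at h
  have hrt : 2 * r * t ≠ 0 := by positivity
  have h1 : Real.cos a = Real.cos b := by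
    have : 2 * r * t * (Real.cos a - Real.cos b) = 0 := by linarith
    rcases mul_eq_zero.1 this with h | h
    · exact absurd h hrt
    · linarith
  exact Real.injOn_cos ⟨ha.1.le, ha.2.le⟩ ⟨hb.1.le, hb.2.le⟩ h1

/-- Change of variables from the angle to the third side. -/
theorem lintegral_thirdSide (hr : 0 < r) (ht : 0 < t) {Θ : Set ℝ} (hΘ : MeasurableSet Θ)
    (hΘ' : Θ ⊆ Ioo 0 Real.pi) {h : ℝ → ℝ≥0∞} (hh : Measurable h) :
    ENNReal.ofReal (r * t) * ∫⁻ θ in Θ, ENNReal.ofReal (Real.sin θ) * h (thirdSide r t θ) =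
      ∫⁻ s in thirdSide r t '' Θ, ENNReal.ofReal s * h s := by
  have hm := measurable_thirdSide r t
  rw [lintegral_image_eq_lintegral_abs_deriv_mul hΘ
    (fun θ hθ ↦ (hasDerivAt_thirdSide hr ht (hΘ' hθ)).hasDerivWithinAt)
    ((injOn_thirdSide hr ht).mono hΘ'), ← lintegral_const_mul _ (by fun_prop)]
  refine setLIntegral_congr_fun hΘ fun θ hθ ↦ ?_
  have h1 := thirdSide_pos hr ht (hΘ' hθ)
  have h2 := Real.sin_pos_of_mem_Ioo (hΘ' hθ)
  rw [← mul_assoc, ← mul_assoc, ← ENNReal.ofReal_mul (by positivity),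
    ← ENNReal.ofReal_mul (by positivity), abs_of_nonneg (by positivity)]
  congr 2
  field_simp

end ThirdSide

/-! ### Spherical means of radial functions through a measurable profile. -/

section Radial

variable {𝕜 : Type*} [RCLike 𝕜]

/-- A measurable radial function has an almost everywhere measurable profile. -/
theorem exists_stronglyMeasurable_profile {n : ℕ} {f : EuclideanSpace ℝ (Fin (n + 1)) → 𝕜}
    {f₀ : ℝ → 𝕜} (hf₀ : ∀ x, f x = f₀ ‖x‖) (hf : AEStronglyMeasurable f volume) :
    ∃ g : ℝ → 𝕜, StronglyMeasurable g ∧ ∀ᵐ s : ℝ, 0 < s → f₀ s = g s := by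
  -- On almost every ray `f` agrees almost everywhere with its measurable representative; the values
  -- of the representative along one such ray serve as profile.
  have h1 := ae_polar volume hf.ae_eq_mk
  have : Filter.NeBot (ae (volume : Measure (EuclideanSpace ℝ (Fin (n + 1)))).toSphere) :=
    ae_neBot.2 (Measure.toSphere_ne_zero _)
  obtain ⟨y, hy⟩ := h1.exists
  refine ⟨fun s ↦ hf.mk f (s • (y : EuclideanSpace ℝ (Fin (n + 1)))),
    hf.stronglyMeasurable_mk.comp_measurable (by fun_prop), ?_⟩
  filter_upwards [hy] with s hs hs0
  rw [← hs hs0, hf₀, norm_smul_sphere hs0]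

/-- A null set of radii is invisible to every sphere not centred at the origin, since `r t sin θ dθ
= s ds` makes the law of `‖x - t y‖` absolutely continuous. This holds for every `x ≠ 0` and every
`t > 0`, as a supremum over an uncountable `E` requires. -/
theorem ae_sphere_profile {n : ℕ} {f₀ g : ℝ → 𝕜} (hg : ∀ᵐ s : ℝ, 0 < s → f₀ s = g s)
    {x : EuclideanSpace ℝ (Fin (n + 2))} (hx : x ≠ 0) {t : ℝ} (ht : 0 < t) :
    ∀ᵐ y : sphere (0 : EuclideanSpace ℝ (Fin (n + 2))) 1 ∂(sphereMeasure (n + 2)),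
      f₀ ‖x - t • (y : EuclideanSpace ℝ (Fin (n + 2)))‖ =
      g ‖x - t • (y : EuclideanSpace ℝ (Fin (n + 2)))‖ := by
  have hx0 : 0 < ‖x‖ := norm_pos_iff.2 hx
  -- The point `0` is added because the profiles are compared only at positive radii.
  have hg' : volume ({s : ℝ | ¬(0 < s → f₀ s = g s)} ∪ {0}) = 0 :=
    measure_union_null (ae_iff.1 hg) (measure_singleton _)
  obtain ⟨N, hN, hNm, hN0⟩ := exists_measurable_superset_of_null hg'
  have hm : Measurable (N.indicator (1 : ℝ → ℝ≥0∞)) := measurable_one.indicator hNm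
  have hmt := measurable_thirdSide ‖x‖ t
  have hN1 : ∀ᵐ s : ℝ, N.indicator (1 : ℝ → ℝ≥0∞) s = 0 := by
    filter_upwards [compl_mem_ae_iff.2 hN0] with s hs
    exact indicator_of_notMem hs _
  have h1 : ∫⁻ θ in Ioo 0 Real.pi, ENNReal.ofReal (Real.sin θ) *
      N.indicator 1 (thirdSide ‖x‖ t θ) = 0 := by
    have h2 := lintegral_thirdSide hx0 ht measurableSet_Ioo (subset_refl (Ioo 0 Real.pi)) hm
    have h3 : ∫⁻ s in thirdSide ‖x‖ t '' Ioo 0 Real.pi, ENNReal.ofReal s *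
        N.indicator 1 s = 0 := by
      rw [lintegral_eq_zero_iff (by fun_prop)]
      filter_upwards [ae_restrict_of_ae hN1] with s hs
      simp [hs]
    rw [h3] at h2
    refine (mul_eq_zero.1 h2).resolve_left ?_
    simp [hx, ht]
  have h4 : ∫⁻ θ in Ioo 0 Real.pi, ENNReal.ofReal (Real.sin θ ^ n) *
      N.indicator 1 (thirdSide ‖x‖ t θ) = 0 := by
    rw [lintegral_eq_zero_iff (by fun_prop)] at h1 ⊢
    filter_upwards [h1, ae_restrict_mem measurableSet_Ioo] with θ hθ hθ'
    have h5 := Real.sin_pos_of_mem_Ioo hθ'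
    rcases mul_eq_zero.1 hθ with h | h
    · exact absurd (ENNReal.ofReal_eq_zero.1 h) (not_le.2 h5)
    · simp [h]
  have h5 := lintegral_sphere_radial n hx t hm
  unfold thirdSide at h4
  rw [h4, mul_zero, lintegral_eq_zero_iff (by fun_prop)] at h5
  filter_upwards [h5] with y hy
  have hy1 : ‖x - t • (y : EuclideanSpace ℝ (Fin (n + 2)))‖ ∉ N := by
    intro hmem
    simp [hmem] at hy
  by_contra hne
  refine hy1 (hN ?_)
  rcases (norm_nonneg (x - t • (y : EuclideanSpace ℝ (Fin (n + 2))))).eq_or_lt with h | h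
  · exact Or.inr h.symm
  · exact Or.inl fun h' ↦ hne (h' h)

theorem sphericalMeanAbs_le {n : ℕ} {f : EuclideanSpace ℝ (Fin (n + 2)) → 𝕜} {f₀ g : ℝ → 𝕜}
    (hf₀ : ∀ x, f x = f₀ ‖x‖) (hgm : StronglyMeasurable g) (hg : ∀ᵐ s : ℝ, 0 < s → f₀ s = g s)
    {x : EuclideanSpace ℝ (Fin (n + 2))} (hx : x ≠ 0) {t : ℝ} (ht : 0 < t) :
    sphericalMeanAbs t f x ≤ zonalConst n * ∫⁻ θ in Ioo 0 Real.pi,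
      ENNReal.ofReal (Real.sin θ ^ n) * ‖g (thirdSide ‖x‖ t θ)‖ₑ := by
  have h1 := ae_sphere_profile hg hx ht
  have h2 : ∫⁻ y : sphere (0 : EuclideanSpace ℝ (Fin (n + 2))) 1,
      ‖f (x - t • (y : EuclideanSpace ℝ (Fin (n + 2))))‖ₑ ∂(sphereMeasure (n + 2)) =
      zonalConst n * ∫⁻ θ in Ioo 0 Real.pi,
      ENNReal.ofReal (Real.sin θ ^ n) * ‖g (thirdSide ‖x‖ t θ)‖ₑ := by
    unfold thirdSide
    rw [← lintegral_sphere_radial n hx t hgm.enorm]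
    refine lintegral_congr_ae ?_
    filter_upwards [h1] with y hy
    rw [hf₀, hy]
  rw [← h2, sphericalMeanAbs]
  split_ifs with hi
  · exact enorm_integral_le_lintegral_enorm _
  -- The integrand is almost everywhere measurable, so integrability can fail only through an
  -- infinite absolute integral; then the right side is `∞` too.
  · have hm : AEStronglyMeasurable (fun y : sphere (0 : EuclideanSpace ℝ (Fin (n + 2))) 1 ↦
        f (x - t • (y : EuclideanSpace ℝ (Fin (n + 2))))) (sphereMeasure (n + 2)) := by
      refine ⟨fun y ↦ g ‖x - t • (y : EuclideanSpace ℝ (Fin (n + 2)))‖,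
        hgm.comp_measurable (by fun_prop), ?_⟩
      filter_upwards [h1] with y hy
      rw [hf₀, hy]
    rw [top_le_iff]
    by_contra h
    exact hi ⟨hm, lt_top_iff_ne_top.2 h⟩

end Radial

/-! ### Geometric weights. -/

section Weights

/-- The geometric series `∑ 2^{-εm}`. -/
noncomputable def geomSum (ε : ℝ) : ℝ≥0∞ := ∑' m : ℕ, ENNReal.ofReal (2 ^ (-(ε * m)))

theorem geomSum_ne_top {ε : ℝ} (hε : 0 < ε) : geomSum ε ≠ ∞ := by
  have h1 : ∀ m : ℕ, (2 : ℝ) ^ (-(ε * m)) = ((2 : ℝ) ^ (-ε)) ^ m := fun m ↦ by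
    rw [← Real.rpow_natCast, ← Real.rpow_mul two_pos.le]; ring_nf
  have h2 : (2 : ℝ) ^ (-ε) < 1 := Real.rpow_lt_one_of_one_lt_of_neg one_lt_two (by linarith)
  have h3 : Summable fun m : ℕ ↦ (2 : ℝ) ^ (-(ε * m)) := by
    simp_rw [h1]
    exact summable_geometric_of_lt_one (by positivity) h2
  rw [geomSum, ← ENNReal.ofReal_tsum_of_nonneg (fun m ↦ by positivity) h3]
  exact ENNReal.ofReal_ne_top

theorem one_le_geomSum (ε : ℝ) : 1 ≤ geomSum ε := by
  refine le_trans ?_ (ENNReal.le_tsum 0)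
  simp

theorem tsum_int_natAbs_le (g : ℕ → ℝ≥0∞) : ∑' z : ℤ, g z.natAbs ≤ 2 * ∑' m, g m := by
  rw [tsum_of_nat_of_neg_add_one ENNReal.summable ENNReal.summable, two_mul]
  refine add_le_add (by simp) ?_
  have h : ∀ m : ℕ, (-((m : ℤ) + 1)).natAbs = m + 1 := fun m ↦ by omega
  simp_rw [h]
  exact ENNReal.tsum_comp_le_tsum_of_injective (f := fun m ↦ m + 1) (add_left_injective 1) g

/-- Uniformity in `l` is the point: the pigeonhole weights may be centred at any dyadic angle at the
cost of a factor 2. -/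
theorem tsum_natAbs_sub_le (g : ℕ → ℝ≥0∞) (l : ℕ) :
    ∑' m : ℕ, g ((m : ℤ) - l).natAbs ≤ 2 * ∑' m, g m := by
  refine le_trans ?_ (tsum_int_natAbs_le g)
  exact ENNReal.tsum_comp_le_tsum_of_injective (f := fun m : ℕ ↦ (m : ℤ) - l)
    (fun a b h ↦ by simpa using h) (fun z ↦ g z.natAbs)

end Weights

/-! ### Dyadic decomposition of the angles and the pigeonhole argument. -/

section AnglePieces

/-- The angles of size about `2^{-m}`. -/
def nearPiece (m : ℕ) : Set ℝ :=
  Ioc (Real.pi / 2 * (1 / 2) ^ (m + 1)) (Real.pi / 2 * (1 / 2) ^ m)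

/-- The angles at distance about `2^{-m}` from `π`. -/
def farPiece (m : ℕ) : Set ℝ := (fun θ ↦ Real.pi - θ) ⁻¹' nearPiece m

theorem measurableSet_nearPiece (m : ℕ) : MeasurableSet (nearPiece m) := measurableSet_Ioc

theorem measurableSet_farPiece (m : ℕ) : MeasurableSet (farPiece m) :=
  (measurable_const.sub measurable_id) measurableSet_Ioc

theorem nearPiece_mem {m : ℕ} {θ : ℝ} (hθ : θ ∈ nearPiece m) : 0 < θ ∧ θ ≤ Real.pi / 2 := by
  refine ⟨lt_trans (by positivity) hθ.1, hθ.2.trans ?_⟩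
  have : ((1 : ℝ) / 2) ^ m ≤ 1 := pow_le_one₀ (by norm_num) (by norm_num)
  nlinarith [Real.pi_pos]

theorem nearPiece_subset (m : ℕ) : nearPiece m ⊆ Ioo 0 Real.pi := fun θ hθ ↦
  ⟨(nearPiece_mem hθ).1, by linarith [(nearPiece_mem hθ).2, Real.pi_pos]⟩

theorem farPiece_subset (m : ℕ) : farPiece m ⊆ Ioo 0 Real.pi := fun θ hθ ↦ by
  have := nearPiece_subset m hθ
  simp only [mem_Ioo] at this ⊢
  constructor <;> linarith [this.1, this.2]

theorem volume_nearPiece_le (m : ℕ) : volume (nearPiece m) ≤ ENNReal.ofReal ((1 / 2) ^ m) := by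
  rw [nearPiece, Real.volume_Ioc]
  refine ENNReal.ofReal_le_ofReal ?_
  have h : (0 : ℝ) < (1 / 2) ^ m := by positivity
  rw [pow_succ]
  nlinarith [Real.pi_lt_four]

theorem volume_farPiece_le (m : ℕ) : volume (farPiece m) ≤ ENNReal.ofReal ((1 / 2) ^ m) := by
  refine le_trans (le_of_eq ?_) (volume_nearPiece_le m)
  exact (Measure.measurePreserving_sub_left volume Real.pi).measure_preimage
    (measurableSet_nearPiece m).nullMeasurableSet

theorem le_sin_nearPiece {m : ℕ} {θ : ℝ} (hθ : θ ∈ nearPiece m) :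
    (1 / 2) ^ (m + 1) ≤ Real.sin θ := by
  refine le_trans ?_ (Real.mul_le_sin (nearPiece_mem hθ).1.le (nearPiece_mem hθ).2)
  have := hθ.1
  have hpi := Real.pi_pos
  calc (1 / 2 : ℝ) ^ (m + 1) = 2 / Real.pi * (Real.pi / 2 * (1 / 2) ^ (m + 1)) := by
        field_simp
    _ ≤ _ := by gcongr

theorem sin_le_nearPiece {m : ℕ} {θ : ℝ} (hθ : θ ∈ nearPiece m) :
    Real.sin θ ≤ Real.pi / 2 * (1 / 2) ^ m :=
  (Real.sin_le (nearPiece_mem hθ).1.le).trans hθ.2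

theorem le_sin_farPiece {m : ℕ} {θ : ℝ} (hθ : θ ∈ farPiece m) :
    (1 / 2) ^ (m + 1) ≤ Real.sin θ := by
  rw [← Real.sin_pi_sub]; exact le_sin_nearPiece hθ

theorem sin_le_farPiece {m : ℕ} {θ : ℝ} (hθ : θ ∈ farPiece m) :
    Real.sin θ ≤ Real.pi / 2 * (1 / 2) ^ m := by
  rw [← Real.sin_pi_sub]; exact sin_le_nearPiece hθ

theorem exists_mem_nearPiece {θ : ℝ} (h0 : 0 < θ) (h1 : θ ≤ Real.pi / 2) :
    ∃ m, θ ∈ nearPiece m := by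
  have hpi := Real.pi_pos
  obtain ⟨m, hm1, hm2⟩ := exists_nat_pow_near_of_lt_one (x := 2 / Real.pi * θ) (y := (1 / 2 : ℝ))
    (by positivity) (by rw [div_mul_eq_mul_div, div_le_one hpi]; linarith) (by norm_num)
    (by norm_num)
  refine ⟨m, ?_, ?_⟩
  · calc _ < Real.pi / 2 * (2 / Real.pi * θ) := by gcongr
      _ = θ := by field_simp
  · calc θ = Real.pi / 2 * (2 / Real.pi * θ) := by field_simp
      _ ≤ _ := by gcongr

theorem Ioo_subset_pieces : Ioo 0 Real.pi ⊆ (⋃ m, nearPiece m) ∪ ⋃ m, farPiece m := by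
  intro θ hθ
  rcases le_total θ (Real.pi / 2) with h | h
  · exact Or.inl (mem_iUnion.2 (exists_mem_nearPiece hθ.1 h))
  · refine Or.inr (mem_iUnion.2 ?_)
    exact exists_mem_nearPiece (θ := Real.pi - θ) (by linarith [hθ.2]) (by linarith)

theorem lintegral_sin_pow_mul_le (n : ℕ) (Ψ : ℝ → ℝ≥0∞) (a b : ℕ → ℝ≥0∞)
    (ha : ∀ m, ∫⁻ θ in nearPiece m, Ψ θ ≤ ENNReal.ofReal (2 ^ (m * n)) * a m)
    (hb : ∀ m, ∫⁻ θ in farPiece m, Ψ θ ≤ ENNReal.ofReal (2 ^ (m * n)) * b m) :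
    ∫⁻ θ in Ioo 0 Real.pi, ENNReal.ofReal (Real.sin θ ^ n) * Ψ θ ≤
      ENNReal.ofReal ((Real.pi / 2) ^ n) * (∑' m, a m + ∑' m, b m) := by
  have key : ∀ (m : ℕ) (P : Set ℝ) (c : ℝ≥0∞), MeasurableSet P →
      (∀ θ ∈ P, 0 ≤ Real.sin θ ∧ Real.sin θ ≤ Real.pi / 2 * (1 / 2) ^ m) →
      ∫⁻ θ in P, Ψ θ ≤ ENNReal.ofReal (2 ^ (m * n)) * c →
      ∫⁻ θ in P, ENNReal.ofReal (Real.sin θ ^ n) * Ψ θ ≤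
        ENNReal.ofReal ((Real.pi / 2) ^ n) * c := by
    intro m P c hP hs hc
    calc ∫⁻ θ in P, ENNReal.ofReal (Real.sin θ ^ n) * Ψ θ
        ≤ ∫⁻ θ in P, ENNReal.ofReal ((Real.pi / 2 * (1 / 2) ^ m) ^ n) * Ψ θ := by
          refine setLIntegral_mono' hP fun θ hθ ↦ ?_
          gcongr
          · exact (hs θ hθ).1
          · exact (hs θ hθ).2
      _ = ENNReal.ofReal ((Real.pi / 2 * (1 / 2) ^ m) ^ n) * ∫⁻ θ in P, Ψ θ :=
          lintegral_const_mul' _ _ ENNReal.ofReal_ne_top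
      _ ≤ ENNReal.ofReal ((Real.pi / 2 * (1 / 2) ^ m) ^ n) *
          (ENNReal.ofReal (2 ^ (m * n)) * c) := by gcongr
      _ = _ := by
          rw [← mul_assoc, ← ENNReal.ofReal_mul (by positivity), pow_mul, ← mul_pow, mul_assoc, ← mul_pow]
          norm_num
  calc ∫⁻ θ in Ioo 0 Real.pi, ENNReal.ofReal (Real.sin θ ^ n) * Ψ θ
      ≤ ∫⁻ θ in (⋃ m, nearPiece m) ∪ ⋃ m, farPiece m, ENNReal.ofReal (Real.sin θ ^ n) * Ψ θ :=
        lintegral_mono_set Ioo_subset_pieces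
    _ ≤ (∑' m, ∫⁻ θ in nearPiece m, ENNReal.ofReal (Real.sin θ ^ n) * Ψ θ) +
        ∑' m, ∫⁻ θ in farPiece m, ENNReal.ofReal (Real.sin θ ^ n) * Ψ θ :=
        (lintegral_union_le _ _ _).trans
          (add_le_add (lintegral_iUnion_le _ _) (lintegral_iUnion_le _ _))
    _ ≤ (∑' m, ENNReal.ofReal ((Real.pi / 2) ^ n) * a m) +
        ∑' m, ENNReal.ofReal ((Real.pi / 2) ^ n) * b m := by
        gcongr with m m
        · exact key m _ _ (measurableSet_nearPiece m) (fun θ hθ ↦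
            ⟨le_trans (by positivity) (le_sin_nearPiece hθ), sin_le_nearPiece hθ⟩) (ha m)
        · exact key m _ _ (measurableSet_farPiece m) (fun θ hθ ↦
            ⟨le_trans (by positivity) (le_sin_farPiece hθ), sin_le_farPiece hθ⟩) (hb m)
    _ = _ := by rw [ENNReal.tsum_mul_left, ENNReal.tsum_mul_left, mul_add]

theorem lintegral_rpow_le_of_measure_le {α : Type*} [MeasurableSpace α] (μ : Measure α)
    {p : ℝ} (hp : 1 ≤ p) {f : α → ℝ≥0∞} (hf : AEMeasurable f μ) :
    (∫⁻ a, f a ∂μ) ^ p ≤ μ univ ^ (p - 1) * ∫⁻ a, f a ^ p ∂μ := by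
  have hp0 : 0 < p := by linarith
  have h := eLpNorm'_le_eLpNorm'_mul_rpow_measure_univ (p := 1) (q := p) (μ := μ) (f := f)
    one_pos hp hf.aestronglyMeasurable
  simp only [eLpNorm'_eq_lintegral_enorm, enorm_eq_self, ENNReal.rpow_one, div_one] at h
  calc (∫⁻ a, f a ∂μ) ^ p ≤ ((∫⁻ a, f a ^ p ∂μ) ^ (1 / p) * μ univ ^ (1 - 1 / p)) ^ p := by
        gcongr
    _ = _ := by
        rw [ENNReal.mul_rpow_of_nonneg _ _ hp0.le, ← ENNReal.rpow_mul, ← ENNReal.rpow_mul,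
          one_div_mul_cancel hp0.ne', ENNReal.rpow_one, mul_comm, sub_mul, one_mul,
          one_div_mul_cancel hp0.ne']

/-- Hölder on a set of measure at most `2^{-m}` gains `2^{m(p-1)}`. The lower bound `sin θ ≥
2^{-(m+1)}` then pays for passing from `dθ` to `s ds`. -/
theorem lt_lintegral_thirdSide_image {r t p X : ℝ} (hr : 0 < r) (ht : 0 < t) (hp : 1 ≤ p)
    (hX : 0 < X) (m : ℕ) {φ : ℝ → ℝ≥0∞} (hφ : Measurable φ) {P : Set ℝ} (hP : MeasurableSet P)
    (hP' : P ⊆ Ioo 0 Real.pi) (hv : volume P ≤ ENNReal.ofReal ((1 / 2) ^ m))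
    (hs : ∀ θ ∈ P, (1 / 2) ^ (m + 1) ≤ Real.sin θ)
    (h : ENNReal.ofReal X < ∫⁻ θ in P, φ (thirdSide r t θ)) :
    ENNReal.ofReal (r * t * ((1 / 2) ^ (m + 1) * ((2 ^ (m : ℝ)) ^ (p - 1) * X ^ p))) <
      ∫⁻ s in thirdSide r t '' P, ENNReal.ofReal s * φ s ^ p := by
  have hm := measurable_thirdSide r t
  have hp0 : 0 < p := by linarith
  rw [← lintegral_thirdSide hr ht hP hP' (hφ.pow_const p), ENNReal.ofReal_mul (by positivity)]
  refine ENNReal.mul_lt_mul_right (by simp; positivity) ENNReal.ofReal_ne_top ?_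
  have h1 : ENNReal.ofReal (X ^ p) < ENNReal.ofReal ((1 / 2) ^ m) ^ (p - 1) *
      ∫⁻ θ in P, φ (thirdSide r t θ) ^ p := by
    calc ENNReal.ofReal (X ^ p) = ENNReal.ofReal X ^ p :=
          (ENNReal.ofReal_rpow_of_pos hX).symm
      _ < (∫⁻ θ in P, φ (thirdSide r t θ)) ^ p := ENNReal.rpow_lt_rpow h hp0
      _ ≤ _ := lintegral_rpow_le_of_measure_le _ hp (by fun_prop)
      _ ≤ _ := by
          gcongr
          simpa using hv
  have h2 : ENNReal.ofReal ((2 ^ (m : ℝ)) ^ (p - 1) * X ^ p) <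
      ∫⁻ θ in P, φ (thirdSide r t θ) ^ p := by
    have h3 : ENNReal.ofReal ((2 ^ (m : ℝ)) ^ (p - 1)) * ENNReal.ofReal ((1 / 2) ^ m) ^ (p - 1)
        = 1 := by
      rw [ENNReal.ofReal_rpow_of_pos (by positivity), ← ENNReal.ofReal_mul (by positivity),
        ← Real.mul_rpow (by positivity) (by positivity), Real.rpow_natCast, ← mul_pow]
      norm_num
    rw [ENNReal.ofReal_mul (by positivity)]
    calc _ < ENNReal.ofReal ((2 ^ (m : ℝ)) ^ (p - 1)) * (ENNReal.ofReal ((1 / 2) ^ m) ^ (p - 1) *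
          ∫⁻ θ in P, φ (thirdSide r t θ) ^ p) :=
          ENNReal.mul_lt_mul_right (by simp; positivity) ENNReal.ofReal_ne_top h1
      _ = _ := by rw [← mul_assoc, h3, one_mul]
  rw [ENNReal.ofReal_mul (by positivity)]
  calc _ < ENNReal.ofReal ((1 / 2) ^ (m + 1)) * ∫⁻ θ in P, φ (thirdSide r t θ) ^ p :=
        ENNReal.mul_lt_mul_right (by simp) ENNReal.ofReal_ne_top h2
    _ = ∫⁻ θ in P, ENNReal.ofReal ((1 / 2) ^ (m + 1)) * φ (thirdSide r t θ) ^ p :=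
        (lintegral_const_mul' _ _ ENNReal.ofReal_ne_top).symm
    _ ≤ _ := by
        refine setLIntegral_mono' hP fun θ hθ ↦ ?_
        gcongr
        exact hs θ hθ

/-- If a weighted integral over all angles is large, then one of the dyadic pieces is large.
The weights may be centred at an arbitrary dyadic angle `2^{-l}`. -/
theorem exists_large_piece (n : ℕ) {p ε : ℝ} (hp : 1 ≤ p) (hε : 0 < ε) :
    ∃ c : ℝ, 0 < c ∧ ∀ {φ : ℝ → ℝ≥0∞}, Measurable φ → ∀ {r t A : ℝ}, 0 < r → 0 < t → 0 < A →
      ∀ l : ℕ, ENNReal.ofReal A < ∫⁻ θ in Ioo 0 Real.pi, ENNReal.ofReal (Real.sin θ ^ n) *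
        φ (thirdSide r t θ) →
      (∃ m : ℕ, ENNReal.ofReal (c * A ^ p * (r * t * 2 ^ (m * ((n + 1) * p - 2) - ε * m))) <
        ∫⁻ s in thirdSide r t '' farPiece m, ENNReal.ofReal s * φ s ^ p) ∨
      (∃ m : ℕ, ENNReal.ofReal (c * A ^ p * (r * t *
          2 ^ (m * ((n + 1) * p - 2) - ε * ((m : ℤ) - l).natAbs))) <
        ∫⁻ s in thirdSide r t '' nearPiece m, ENNReal.ofReal s * φ s ^ p) := by
  have hp0 : 0 < p := by linarith
  set S := (geomSum (ε / p)).toReal with hS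
  have hSt : geomSum (ε / p) ≠ ∞ := geomSum_ne_top (by positivity)
  have hS1 : 1 ≤ S := by
    have := ENNReal.toReal_mono hSt (one_le_geomSum (ε / p))
    simpa using this
  have hSe : geomSum (ε / p) = ENNReal.ofReal S := (ENNReal.ofReal_toReal hSt).symm
  have hpi := Real.pi_pos
  -- The near weights are summed on both sides of `l` and cost `2S`, the far weights cost `S`;
  -- `(π/2)^n` comes from `sin^n θ`.
  set c₁ : ℝ := ((Real.pi / 2) ^ n * (3 * S))⁻¹ with hc₁
  have hc₁0 : 0 < c₁ := by positivity
  refine ⟨c₁ ^ p / 2, by positivity, ?_⟩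
  intro φ hφ r t A hr ht hA l hlt
  -- Exponents of 2: `-m` from the sine, `m(p - 1)` from Hölder and `mnp` from the weight `sin^n θ`
  -- add up to `m((n + 1)p - 2)`. The `p`-th power turns `ε/p` into `ε`.
  have conv : ∀ (m k : ℕ), r * t * ((1 / 2) ^ (m + 1) * ((2 ^ (m : ℝ)) ^ (p - 1) *
      (c₁ * A * (2 ^ (m * n) * 2 ^ (-(ε / p * k)))) ^ p)) =
      c₁ ^ p / 2 * A ^ p * (r * t * 2 ^ (m * ((n + 1) * p - 2) - ε * k)) := by
    intro m k
    have e1 : ((1 : ℝ) / 2) ^ (m + 1) = 2 ^ (-(m : ℝ)) / 2 := by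
      rw [Real.rpow_neg two_pos.le, Real.rpow_natCast, pow_succ, one_div, inv_pow]
      ring
    have e2 : ((2 : ℝ) ^ (m * n) * 2 ^ (-(ε / p * k))) ^ p = 2 ^ (m * n * p - ε * k) := by
      rw [← Real.rpow_natCast, ← Real.rpow_add two_pos, ← Real.rpow_mul two_pos.le]
      congr 1
      push_cast
      field_simp
      ring
    have e3 : ((2 : ℝ) ^ (m : ℝ)) ^ (p - 1) = 2 ^ (m * (p - 1)) := by
      rw [← Real.rpow_mul two_pos.le]
    rw [Real.mul_rpow (by positivity) (by positivity), Real.mul_rpow (by positivity) hA.le, e1,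
      e2, e3]
    have e4 : (2 : ℝ) ^ (m * ((n + 1) * p - 2) - ε * k) =
        2 ^ (-(m : ℝ)) * (2 ^ (m * (p - 1)) * 2 ^ (m * n * p - ε * k)) := by
      rw [← Real.rpow_add two_pos, ← Real.rpow_add two_pos]
      ring_nf
    rw [e4]
    ring
  by_contra hcon
  push Not at hcon
  obtain ⟨hfar, hnear⟩ := hcon
  refine absurd hlt (not_lt.2 ?_)
  refine (lintegral_sin_pow_mul_le n (fun θ ↦ φ (thirdSide r t θ))
    (fun m ↦ ENNReal.ofReal (c₁ * A) *
      ENNReal.ofReal (2 ^ (-(ε / p * ((m : ℤ) - l).natAbs))))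
    (fun m ↦ ENNReal.ofReal (c₁ * A) * ENNReal.ofReal (2 ^ (-(ε / p * m)))) ?_ ?_).trans ?_
  · intro m
    by_contra h
    refine absurd (hnear m) (not_le.2 ?_)
    rw [← conv]
    refine lt_lintegral_thirdSide_image hr ht hp (by positivity) m hφ (measurableSet_nearPiece m)
      (nearPiece_subset m) (volume_nearPiece_le m) (fun θ ↦ le_sin_nearPiece) ?_
    refine lt_of_eq_of_lt ?_ (not_le.1 h)
    rw [← ENNReal.ofReal_mul (by positivity), ← ENNReal.ofReal_mul (by positivity)]
    congr 1
    ring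
  · intro m
    by_contra h
    refine absurd (hfar m) (not_le.2 ?_)
    rw [← conv]
    refine lt_lintegral_thirdSide_image hr ht hp (by positivity) m hφ (measurableSet_farPiece m)
      (farPiece_subset m) (volume_farPiece_le m) (fun θ ↦ le_sin_farPiece) ?_
    refine lt_of_eq_of_lt ?_ (not_le.1 h)
    rw [← ENNReal.ofReal_mul (by positivity), ← ENNReal.ofReal_mul (by positivity)]
    congr 1
    ring
  · rw [ENNReal.tsum_mul_left, ENNReal.tsum_mul_left, ← mul_add]
    have h1 := tsum_natAbs_sub_le (fun m ↦ ENNReal.ofReal (2 ^ (-(ε / p * m)))) l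
    calc _ ≤ ENNReal.ofReal ((Real.pi / 2) ^ n) * (ENNReal.ofReal (c₁ * A) *
          (2 * geomSum (ε / p) + geomSum (ε / p))) := by
          refine mul_le_mul_right (mul_le_mul_right (add_le_add h1 ?_) _) _
          exact le_rfl
      _ = ENNReal.ofReal ((Real.pi / 2) ^ n * (c₁ * A * (3 * S))) := by
          have h3 : ENNReal.ofReal (3 * S) = 2 * ENNReal.ofReal S + ENNReal.ofReal S := by
            rw [← add_one_mul, ENNReal.ofReal_mul (by norm_num)]
            norm_num
          rw [hSe, ENNReal.ofReal_mul (p := (Real.pi / 2) ^ n) (by positivity),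
            ENNReal.ofReal_mul (p := c₁ * A) (by positivity), h3]
      _ = ENNReal.ofReal A := by
          congr 1
          rw [hc₁]
          field_simp
      _ ≤ _ := le_rfl

end AnglePieces

/-! ### Chebyshev bounds for the mass of intervals of a fixed length. -/

section LocalMass

variable {h : ℝ → ℝ≥0∞}

theorem measurable_lintegral_closedBall (hh : Measurable h) (a : ℝ) :
    Measurable fun y ↦ ∫⁻ s in closedBall y a, h s := by
  have h1 : MeasurableSet {q : ℝ × ℝ | dist q.2 q.1 ≤ a} :=
    (isClosed_le (by fun_prop) (by fun_prop)).measurableSet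
  have h2 : Measurable fun q : ℝ × ℝ ↦ {q : ℝ × ℝ | dist q.2 q.1 ≤ a}.indicator
      (fun q ↦ h q.2) q := (hh.comp measurable_snd).indicator h1
  convert h2.lintegral_prod_right' (ν := volume) using 2 with y
  rw [← lintegral_indicator measurableSet_closedBall]
  rfl

theorem lintegral_lintegral_closedBall (hh : Measurable h) (a : ℝ) :
    ∫⁻ y, ∫⁻ s in closedBall y a, h s = ENNReal.ofReal (2 * a) * ∫⁻ s, h s := by
  have h1 : MeasurableSet {q : ℝ × ℝ | dist q.2 q.1 ≤ a} :=
    (isClosed_le (by fun_prop) (by fun_prop)).measurableSet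
  have h2 : Measurable fun q : ℝ × ℝ ↦ {q : ℝ × ℝ | dist q.2 q.1 ≤ a}.indicator
      (fun q ↦ h q.2) q := (hh.comp measurable_snd).indicator h1
  calc ∫⁻ y, ∫⁻ s in closedBall y a, h s
      = ∫⁻ y, ∫⁻ s, {q : ℝ × ℝ | dist q.2 q.1 ≤ a}.indicator (fun q ↦ h q.2) (y, s) := by
        refine lintegral_congr fun y ↦ ?_
        rw [← lintegral_indicator measurableSet_closedBall]
        rfl
    _ = ∫⁻ s, ∫⁻ y, {q : ℝ × ℝ | dist q.2 q.1 ≤ a}.indicator (fun q ↦ h q.2) (y, s) :=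
        lintegral_lintegral_swap h2.aemeasurable
    _ = ∫⁻ s, ENNReal.ofReal (2 * a) * h s := by
        refine lintegral_congr fun s ↦ ?_
        have : ∀ y, {q : ℝ × ℝ | dist q.2 q.1 ≤ a}.indicator (fun q ↦ h q.2) (y, s) =
            (closedBall s a).indicator (fun _ ↦ h s) y := fun y ↦ by
          simp only [indicator, mem_closedBall, mem_ofPred_eq, dist_comm]
        simp_rw [this]
        rw [lintegral_indicator measurableSet_closedBall, setLIntegral_const,
          Real.volume_closedBall, mul_comm]
    _ = _ := lintegral_const_mul _ hh

theorem volume_large_mass_le (hh : Measurable h) (a : ℝ) {c : ℝ} (hc : 0 < c) :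
    volume {y | ENNReal.ofReal c < ∫⁻ s in closedBall y a, h s} ≤
      ENNReal.ofReal (2 * a / c) * ∫⁻ s, h s := by
  have h1 := mul_meas_ge_le_lintegral (μ := volume) (measurable_lintegral_closedBall hh a)
    (ENNReal.ofReal c)
  rw [lintegral_lintegral_closedBall hh] at h1
  have hc0 : ENNReal.ofReal c ≠ 0 := by simpa using hc
  have h2 : volume {y | ENNReal.ofReal c < ∫⁻ s in closedBall y a, h s} ≤
      volume {y | ENNReal.ofReal c ≤ ∫⁻ s in closedBall y a, h s} :=
    measure_mono fun y hy ↦ by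
      simp only [mem_ofPred_eq] at hy ⊢
      exact hy.le
  refine h2.trans ?_
  rw [mul_comm, ← ENNReal.le_div_iff_mul_le (Or.inl hc0) (Or.inl ENNReal.ofReal_ne_top)] at h1
  refine h1.trans (le_of_eq ?_)
  rw [ENNReal.ofReal_div_of_pos hc, ENNReal.mul_div_right_comm]

end LocalMass

/-! ### The radial measure and its dyadic windows. -/

section RadialMeasure

/-- The measure `s^D ds` on `(0, ∞)`. -/
noncomputable def radialMeasure (D : ℕ) : Measure ℝ :=
  (volume.restrict (Ioi 0)).withDensity fun s ↦ ENNReal.ofReal (s ^ D)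

theorem lintegral_radialMeasure (D : ℕ) {h : ℝ → ℝ≥0∞} (hh : Measurable h) :
    ∫⁻ s, h s ∂(radialMeasure D) = ∫⁻ s in Ioi 0, ENNReal.ofReal (s ^ D) * h s := by
  rw [radialMeasure, lintegral_withDensity_eq_lintegral_mul _ (by fun_prop) hh]
  rfl

/-- Comparing the two measures, rather than integrating over `S`, gives the bound for sets that need
not be measurable, such as those defined below through a supremum over an arbitrary `E`. -/
theorem radialMeasure_le (D : ℕ) {S : Set ℝ} {b : ℝ} (hS : S ⊆ Iic b) :
    radialMeasure D S ≤ ENNReal.ofReal (b ^ D) * volume S := by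
  have h1 : (radialMeasure D).restrict (Iic b) ≤ ENNReal.ofReal (b ^ D) • volume := by
    refine Measure.le_iff.2 fun T hT ↦ ?_
    rw [Measure.restrict_apply hT, radialMeasure, withDensity_apply _ (hT.inter measurableSet_Iic),
      Measure.restrict_restrict (hT.inter measurableSet_Iic), Measure.smul_apply, smul_eq_mul]
    calc _ ≤ ∫⁻ _ in T ∩ Iic b ∩ Ioi 0, ENNReal.ofReal (b ^ D) := by
          refine setLIntegral_mono' ((hT.inter measurableSet_Iic).inter measurableSet_Ioi)
            fun s hs ↦ ?_
          gcongr
          · exact le_of_lt hs.2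
          · exact hs.1.2
      _ = ENNReal.ofReal (b ^ D) * volume (T ∩ Iic b ∩ Ioi 0) := setLIntegral_const _ _
      _ ≤ _ := by
          gcongr
          exact inter_subset_left.trans inter_subset_left
  calc radialMeasure D S = (radialMeasure D).restrict (Iic b) S := by
        rw [Measure.restrict_apply' measurableSet_Iic, inter_eq_left.2 hS]
    _ ≤ (ENNReal.ofReal (b ^ D) • volume) S := h1 S
    _ = _ := by simp

theorem le_radialMeasure (D : ℕ) {S : Set ℝ} (hS : MeasurableSet S) {b : ℝ} (hb : 0 < b)
    (hSb : S ⊆ Ici b) : ENNReal.ofReal (b ^ D) * volume S ≤ radialMeasure D S := by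
  have h0 : S ⊆ Ioi 0 := fun s hs ↦ lt_of_lt_of_le hb (hSb hs)
  rw [radialMeasure, withDensity_apply _ hS, Measure.restrict_restrict hS, inter_eq_left.2 h0,
    ← setLIntegral_const]
  refine setLIntegral_mono' hS fun s hs ↦ ?_
  gcongr
  exact hSb hs

/-- A dyadic window around `2^j`. -/
def window (j : ℤ) : Set ℝ := Ico ((2 : ℝ) ^ (j - 2)) ((2 : ℝ) ^ (j + 3))

theorem measurableSet_window (j : ℤ) : MeasurableSet (window j) := measurableSet_Ico

theorem iUnion_Ico_two_zpow : ⋃ j : ℤ, Ico ((2 : ℝ) ^ j) ((2 : ℝ) ^ (j + 1)) = Ioi 0 := by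
  ext s
  simp only [mem_iUnion, mem_Ioi]
  constructor
  · rintro ⟨j, hj⟩
    exact lt_of_lt_of_le (by positivity) hj.1
  · exact fun hs ↦ exists_mem_Ico_zpow hs one_lt_two

theorem pairwise_disjoint_Ico_two_zpow :
    Pairwise (Function.onFun Disjoint fun j : ℤ ↦ Ico ((2 : ℝ) ^ j) ((2 : ℝ) ^ (j + 1))) := by
  have h := (zpow_right_strictMono₀ (one_lt_two (α := ℝ))).monotone.pairwise_disjoint_on_Ico_succ
  simpa [Function.onFun, Int.succ] using h

/-- Each `s` lies in five windows, and `2^j ≤ 4s` on the window of index `j`. This reassembles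
bounds proved one dyadic scale at a time. -/
theorem tsum_window_le (D : ℕ) {h : ℝ → ℝ≥0∞} (hh : Measurable h) :
    ∑' j : ℤ, ENNReal.ofReal (((2 : ℝ) ^ j) ^ D) * ∫⁻ s in window j, h s ≤
      ENNReal.ofReal (5 * 4 ^ D) * ∫⁻ s, h s ∂(radialMeasure D) := by
  set g : ℝ → ℝ≥0∞ := fun s ↦ ENNReal.ofReal (s ^ D) * h s with hg
  have hgm : Measurable g := by fun_prop
  have h1 : ∀ j : ℤ, ENNReal.ofReal (((2 : ℝ) ^ j) ^ D) * ∫⁻ s in window j, h s ≤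
      ENNReal.ofReal (4 ^ D) * ∫⁻ s in window j, g s := fun j ↦ by
    rw [← lintegral_const_mul _ hh, ← lintegral_const_mul _ hgm]
    refine setLIntegral_mono' (measurableSet_window j) fun s hs ↦ ?_
    rw [hg, ← mul_assoc, ← ENNReal.ofReal_mul (by positivity), ← mul_pow]
    gcongr
    have := hs.1
    rw [zpow_sub₀ two_ne_zero] at this
    have h4 : (2 : ℝ) ^ (2 : ℤ) = 4 := by norm_num
    rw [h4] at this
    linarith
  have h2 : ∀ j : ℤ, ∫⁻ s in window j, g s ≤ ∑ q ∈ Finset.range 5,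
      ∫⁻ s in Ico ((2 : ℝ) ^ (j + (q - 2 : ℤ))) ((2 : ℝ) ^ (j + (q - 2 : ℤ) + 1)), g s := fun j ↦ by
    have hsub : window j ⊆ ⋃ q ∈ Finset.range 5,
        Ico ((2 : ℝ) ^ (j + (q - 2 : ℤ))) ((2 : ℝ) ^ (j + (q - 2 : ℤ) + 1)) := by
      intro s hs
      have hs0 : 0 < s := lt_of_lt_of_le (by positivity) hs.1
      obtain ⟨i, hi⟩ := exists_mem_Ico_zpow hs0 (one_lt_two (α := ℝ))
      have a1 : j - 2 < i + 1 :=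
        (zpow_lt_zpow_iff_right₀ (one_lt_two (α := ℝ))).1 (hs.1.trans_lt hi.2)
      have a2 : i < j + 3 :=
        (zpow_lt_zpow_iff_right₀ (one_lt_two (α := ℝ))).1 (hi.1.trans_lt hs.2)
      simp only [mem_iUnion, Finset.mem_range]
      refine ⟨(i - j + 2).toNat, by omega, ?_⟩
      have : j + (((i - j + 2).toNat : ℤ) - 2) = i := by omega
      rw [this]
      exact hi
    refine (lintegral_mono_set hsub).trans ?_
    simp only [← Finset.mem_coe]
    rw [← Finset.tsum_subtype', biUnion_eq_iUnion]
    exact lintegral_iUnion_le _ _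
  have h3 : ∀ q : ℤ, ∑' j : ℤ, ∫⁻ s in Ico ((2 : ℝ) ^ (j + q)) ((2 : ℝ) ^ (j + q + 1)), g s =
      ∫⁻ s, h s ∂(radialMeasure D) := fun q ↦ by
    rw [lintegral_radialMeasure D hh, ← iUnion_Ico_two_zpow,
      lintegral_iUnion (fun _ ↦ measurableSet_Ico) pairwise_disjoint_Ico_two_zpow]
    exact (Equiv.addRight q).tsum_eq
      (fun j : ℤ ↦ ∫⁻ s in Ico ((2 : ℝ) ^ j) ((2 : ℝ) ^ (j + 1)), g s)
  calc _ ≤ ∑' j : ℤ, ENNReal.ofReal (4 ^ D) * ∑ q ∈ Finset.range 5,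
      ∫⁻ s in Ico ((2 : ℝ) ^ (j + (q - 2 : ℤ))) ((2 : ℝ) ^ (j + (q - 2 : ℤ) + 1)), g s :=
        ENNReal.tsum_le_tsum fun j ↦ (h1 j).trans (by gcongr; exact h2 j)
    _ = ENNReal.ofReal (4 ^ D) * ∑ q ∈ Finset.range 5, ∫⁻ s, h s ∂(radialMeasure D) := by
        rw [ENNReal.tsum_mul_left, Summable.tsum_finsetSum fun _ _ ↦ ENNReal.summable]
        simp_rw [h3]
    _ = _ := by
        rw [Finset.sum_const, Finset.card_range, nsmul_eq_mul, ← mul_assoc,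
          ENNReal.ofReal_mul (by norm_num), mul_comm (ENNReal.ofReal 5)]
        norm_num

end RadialMeasure

/-! ### A maximal function with shifted intervals. -/

section ShiftedMaximal

/-- Weak type bound for a maximal function over intervals of length about `2^{k-n}` that are
shifted by finitely many numbers of size at most `3·2^k`. -/
theorem volume_shifted_maximal_le {h : ℝ → ℝ≥0∞} (G : ℤ → Finset ℝ) {M : ℝ}
    (hM : ∀ k, ((G k).card : ℝ) ≤ M) (hG : ∀ k, ∀ τ ∈ G k, |τ| ≤ 3 * (2 : ℝ) ^ k)
    (n : ℕ) (j : ℤ) {c : ℝ} (hc : 0 < c) :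
    volume {y | ∃ k ≤ j, ∃ τ ∈ G k, ENNReal.ofReal (c * (2 : ℝ) ^ (k - n)) <
        ∫⁻ s in closedBall (y - τ) (8 * (2 : ℝ) ^ (k - n)), h s} ≤
      ENNReal.ofReal ((86 + 80 * (n + 2) * M) / c) * ∫⁻ s, h s := by
  have hM0 : 0 ≤ M := le_trans (by positivity) (hM 0)
  set R : ℝ × ℤ → ℝ := fun a ↦ 8 * (2 : ℝ) ^ (a.2 - n) with hR
  set T : Set (ℝ × ℤ) := {a | a.2 ≤ j ∧ ENNReal.ofReal (c * (2 : ℝ) ^ (a.2 - n)) <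
    ∫⁻ s in closedBall a.1 (R a), h s} with hT
  have hRpos : ∀ a, 0 < R a := fun a ↦ by rw [hR]; positivity
  obtain ⟨u, huT, hud, hu⟩ := Vitali.exists_disjoint_subfamily_covering_enlargement_closedBall T
    (fun a ↦ a.1) R (8 * (2 : ℝ) ^ (j - n)) (fun a ha ↦ by
      have := ha.1
      simp only [hR]
      gcongr
      exact one_le_two) 5 (by norm_num)
  have huc : u.Countable := hud.countable_of_nonempty_interior fun a _ ↦ by
    rw [interior_closedBall _ (hRpos a).ne']
    exact nonempty_ball.2 (hRpos a)
  -- `Q b` holds every `y` whose shifted interval is absorbed by the fivefold enlargement of the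
  -- selected interval `b`, of radius `40·2^(b.2-n)`. This forces `k ≤ b.2 + 2`. If `k ≤ b.2 - n`,
  -- the shift is at most `3·2^(b.2-n)` and is swallowed by the radius `43 = 40 + 3`. Only the
  -- remaining `n + 2` values of `k` need one interval per shift, hence a loss linear in `n`.
  set Q : ℝ × ℤ → Set ℝ := fun b ↦ closedBall b.1 (43 * (2 : ℝ) ^ (b.2 - n)) ∪
    ⋃ i ∈ Finset.range (n + 2), ⋃ τ ∈ G (b.2 + 2 - i),
      closedBall (b.1 + τ) (40 * (2 : ℝ) ^ (b.2 - n)) with hQ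
  have hcover : {y | ∃ k ≤ j, ∃ τ ∈ G k, ENNReal.ofReal (c * (2 : ℝ) ^ (k - n)) <
        ∫⁻ s in closedBall (y - τ) (8 * (2 : ℝ) ^ (k - n)), h s} ⊆ ⋃ b ∈ u, Q b := by
    rintro y ⟨k, hkj, τ, hτ, hlt⟩
    obtain ⟨b, hbu, hb⟩ := hu (y - τ, k) ⟨hkj, hlt⟩
    simp only [mem_iUnion]
    refine ⟨b, hbu, ?_⟩
    simp only [hR, Real.closedBall_eq_Icc] at hb
    have hk0 : (0 : ℝ) < 2 ^ (k - n) := by positivity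
    have hb0 : (0 : ℝ) < 2 ^ (b.2 - n) := by positivity
    obtain ⟨e1, e2⟩ := (Icc_subset_Icc_iff (by linarith)).1 hb
    have e3 : |y - τ - b.1| ≤ 40 * (2 : ℝ) ^ (b.2 - n) := by
      rw [abs_le]; constructor <;> linarith
    have e4 : (2 : ℝ) ^ (k - n) < 2 ^ (b.2 - n + 3) := by
      rw [zpow_add₀ two_ne_zero]
      norm_num
      linarith
    have e5 : k < b.2 + 3 := by
      have := (zpow_lt_zpow_iff_right₀ (one_lt_two (α := ℝ))).1 e4
      omega
    rcases le_or_gt k (b.2 - n) with hk | hk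
    · left
      have e6 : |τ| ≤ 3 * (2 : ℝ) ^ (b.2 - n) := by
        refine (hG k τ hτ).trans ?_
        gcongr
        exact one_le_two
      rw [mem_closedBall, Real.dist_eq]
      calc |y - b.1| = |(y - τ - b.1) + τ| := by ring_nf
        _ ≤ |y - τ - b.1| + |τ| := abs_add_le _ _
        _ ≤ _ := by linarith
    · right
      simp only [mem_iUnion]
      refine ⟨(b.2 + 2 - k).toNat, Finset.mem_range.2 (by omega), τ, ?_, ?_⟩
      · have : b.2 + 2 - ((b.2 + 2 - k).toNat : ℤ) = k := by omega
        rw [this]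
        exact hτ
      · rw [mem_closedBall, Real.dist_eq]
        have : y - (b.1 + τ) = y - τ - b.1 := by ring
        rw [this]
        exact e3
  have hvolQ : ∀ b, volume (Q b) ≤
      ENNReal.ofReal ((86 + 80 * (n + 2) * M) * (2 : ℝ) ^ (b.2 - n)) := fun b ↦ by
    have hb0 : (0 : ℝ) < 2 ^ (b.2 - n) := by positivity
    calc volume (Q b) ≤ ENNReal.ofReal (2 * (43 * (2 : ℝ) ^ (b.2 - n))) +
        ∑ i ∈ Finset.range (n + 2), ∑ τ ∈ G (b.2 + 2 - i),
          ENNReal.ofReal (2 * (40 * (2 : ℝ) ^ (b.2 - n))) := by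
          refine (measure_union_le _ _).trans (add_le_add (by rw [Real.volume_closedBall]) ?_)
          refine (measure_biUnion_finset_le _ _).trans (Finset.sum_le_sum fun i _ ↦ ?_)
          refine (measure_biUnion_finset_le _ _).trans (Finset.sum_le_sum fun τ _ ↦ ?_)
          rw [Real.volume_closedBall]
      _ ≤ ENNReal.ofReal (2 * (43 * (2 : ℝ) ^ (b.2 - n))) +
        ∑ i ∈ Finset.range (n + 2), ENNReal.ofReal (M * (2 * (40 * (2 : ℝ) ^ (b.2 - n)))) := by
          gcongr with i _
          rw [Finset.sum_const, nsmul_eq_mul, ← ENNReal.ofReal_natCast,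
            ← ENNReal.ofReal_mul (by positivity)]
          gcongr
          exact hM _
      _ = _ := by
          rw [Finset.sum_const, Finset.card_range, nsmul_eq_mul, ← ENNReal.ofReal_natCast,
            ← ENNReal.ofReal_mul (by positivity), ← ENNReal.ofReal_add (by positivity)
            (by positivity)]
          congr 1
          push_cast
          ring
  calc _ ≤ volume (⋃ b ∈ u, Q b) := measure_mono hcover
    _ ≤ ∑' b : u, volume (Q b) := measure_biUnion_le _ huc _
    _ ≤ ∑' b : u, ENNReal.ofReal ((86 + 80 * (n + 2) * M) / c) *
        ∫⁻ s in closedBall (b : ℝ × ℤ).1 (R b), h s := by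
        refine ENNReal.tsum_le_tsum fun b ↦ (hvolQ b).trans ?_
        have : (86 + 80 * (n + 2) * M) * (2 : ℝ) ^ ((b : ℝ × ℤ).2 - n) =
            (86 + 80 * (n + 2) * M) / c * (c * (2 : ℝ) ^ ((b : ℝ × ℤ).2 - n)) := by
          field_simp
        rw [this, ENNReal.ofReal_mul (by positivity)]
        gcongr
        exact (huT b.2).2.le
    _ = ENNReal.ofReal ((86 + 80 * (n + 2) * M) / c) *
        ∫⁻ s in ⋃ b ∈ u, closedBall b.1 (R b), h s := by
        rw [ENNReal.tsum_mul_left, lintegral_biUnion huc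
          (fun b _ ↦ measurableSet_closedBall) hud]
    _ ≤ _ := by
        gcongr
        exact Measure.restrict_le_self

end ShiftedMaximal

/-- Each dyadic piece of `E` can be covered by `M 2^{βn}` intervals of relative length `2^{-n}`. -/
def HasCover (E : Set ℝ) (M β : ℝ) : Prop :=
  ∀ (k : ℤ) (n : ℕ), ∃ F : Finset ℝ, (F.card : ℝ) ≤ M * 2 ^ (β * n) ∧
    (∀ τ ∈ F, |τ| ≤ 3 * (2 : ℝ) ^ k) ∧
    ∀ t ∈ E, t ∈ Icc ((2 : ℝ) ^ k) ((2 : ℝ) ^ (k + 1)) → ∃ τ ∈ F, |t - τ| ≤ (2 : ℝ) ^ (k - n)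

/-- Truncating `h` to one window keeps the estimates at different dyadic scales summable. -/
theorem lintegral_inter_le_window {h : ℝ → ℝ≥0∞} {j : ℤ} {A B B' : Set ℝ}
    (hB' : MeasurableSet B') (hA : A ⊆ window j) (hB : B ⊆ B') :
    ∫⁻ s in A ∩ B, h s ≤ ∫⁻ s in B', (window j).indicator h s := by
  rw [← lintegral_indicator hB', indicator_indicator,
    lintegral_indicator (hB'.inter (measurableSet_window j))]
  exact lintegral_mono_set fun s hs ↦ ⟨hB hs.2, hA hs.1⟩

theorem lintegral_window_indicator (h : ℝ → ℝ≥0∞) (j : ℤ) :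
    ∫⁻ s, (window j).indicator h s = ∫⁻ s in window j, h s :=
  lintegral_indicator (measurableSet_window j) _

theorem Icc_half_two_subset_window {r : ℝ} {j : ℤ}
    (hr : r ∈ Ico ((2 : ℝ) ^ j) ((2 : ℝ) ^ (j + 1))) : Icc (r / 2) (2 * r) ⊆ window j := by
  intro s hs
  have h1 := hr.1
  have h2 := hr.2
  rw [zpow_add_one₀ two_ne_zero] at h2
  have h3 : (2 : ℝ) ^ (j - 2) = 2 ^ j / 4 := by rw [zpow_sub₀ two_ne_zero]; norm_num
  have h4 : (2 : ℝ) ^ (j + 3) = 2 ^ j * 8 := by rw [zpow_add₀ two_ne_zero]; norm_num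
  have h5 : (0 : ℝ) < 2 ^ j := by positivity
  rw [window, h3, h4]
  constructor <;> linarith [hs.1, hs.2]

theorem volume_large_mass_add_le {h : ℝ → ℝ≥0∞} (hh : Measurable h) (a τ : ℝ) {c : ℝ}
    (hc : 0 < c) : volume {y | ENNReal.ofReal c < ∫⁻ s in closedBall (τ + y) a, h s} ≤
      ENNReal.ofReal (2 * a / c) * ∫⁻ s, h s := by
  refine le_trans (le_of_eq ?_) (volume_large_mass_le hh a hc)
  exact (measurePreserving_add_left volume τ).measure_preimage
    (measurableSet_lt measurable_const
      (measurable_lintegral_closedBall hh a)).nullMeasurableSet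

theorem volume_large_mass_sub_le {h : ℝ → ℝ≥0∞} (hh : Measurable h) (a τ : ℝ) {c : ℝ}
    (hc : 0 < c) : volume {y | ENNReal.ofReal c < ∫⁻ s in closedBall (τ - y) a, h s} ≤
      ENNReal.ofReal (2 * a / c) * ∫⁻ s, h s := by
  refine le_trans (le_of_eq ?_) (volume_large_mass_le hh a hc)
  exact (Measure.measurePreserving_sub_left volume τ).measure_preimage
    (measurableSet_lt measurable_const
      (measurable_lintegral_closedBall hh a)).nullMeasurableSet

/-! ### Arcs on which the larger of `r` and `t` controls the third side. -/

section SeparatedRadii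

variable {E : Set ℝ} {M β : ℝ}

/-- Radii `r ≥ t` with a large mass near `r ± t`. -/
def outerSet (E : Set ℝ) (h : ℝ → ℝ≥0∞) (m : ℕ) (Λ : ℝ) : Set ℝ :=
  {r | ∃ t ∈ E, 0 < t ∧ t ≤ r ∧ ∃ z, (z = r + t ∨ z = r - t) ∧
        ENNReal.ofReal (Λ * (t * (2 : ℝ) ^ (-(2 * m : ℤ)))) <
          ∫⁻ s in Icc (r / 2) (2 * r) ∩ closedBall z (3 * (t * (2 : ℝ) ^ (-(2 * m : ℤ)))), h s}

/-- The contribution of radii `r` that dominate the dilation parameter `t`. -/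
theorem radialMeasure_outer_le (hE : HasCover E M β) (hM : 1 ≤ M) (hβ : 0 ≤ β) (D : ℕ)
    {h : ℝ → ℝ≥0∞} (hh : Measurable h) (m : ℕ) {Λ : ℝ} (hΛ : 0 < Λ) :
    radialMeasure D (outerSet E h m Λ) ≤
      ENNReal.ofReal (20000 * 8 ^ D * M * ((m + 1) * 2 ^ (β * (2 * m : ℕ)) / Λ)) *
        ∫⁻ s, h s ∂(radialMeasure D) := by
  choose F hFc hFb hF using fun k ↦ hE k (2 * m)
  set X : ℝ := M * 2 ^ (β * (2 * m : ℕ)) with hX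
  have hX1 : 1 ≤ X := by
    have : (1 : ℝ) ≤ 2 ^ (β * (2 * m : ℕ)) := Real.one_le_rpow one_le_two (by positivity)
    nlinarith
  classical
  -- Both signs occur because the centre is `r + t` or `r - t`.
  set G : ℤ → Finset ℝ := fun k ↦ F k ∪ (F k).image (fun τ ↦ -τ) with hG
  have hGc : ∀ k, ((G k).card : ℝ) ≤ 2 * X := fun k ↦ by
    have h1 : (G k).card ≤ (F k).card + (F k).card :=
      (Finset.card_union_le _ _).trans (Nat.add_le_add_left Finset.card_image_le _)
    have h2 : ((G k).card : ℝ) ≤ (F k).card + (F k).card := by exact_mod_cast h1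
    linarith [hFc k]
  have hGb : ∀ k, ∀ τ ∈ G k, |τ| ≤ 3 * (2 : ℝ) ^ k := fun k τ hτ ↦ by
    rcases Finset.mem_union.1 hτ with h1 | h1
    · exact hFb k τ h1
    · obtain ⟨τ', h2, rfl⟩ := Finset.mem_image.1 h1
      rw [abs_neg]
      exact hFb k τ' h2
  set S : ℤ → Set ℝ := fun j ↦ Iic ((2 : ℝ) ^ (j + 1)) ∩ {y | ∃ k ≤ j, ∃ τ ∈ G k,
    ENNReal.ofReal (Λ * (2 : ℝ) ^ (k - (2 * m : ℕ))) <
      ∫⁻ s in closedBall (y - τ) (8 * (2 : ℝ) ^ (k - (2 * m : ℕ))), (window j).indicator h s} with hS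
  have hcover : outerSet E h m Λ ⊆
      ⋃ j, S j := by
    rintro r ⟨t, htE, ht0, htr, z, hz, hlt⟩
    obtain ⟨j, hj⟩ := exists_mem_Ico_zpow (ht0.trans_le htr) (one_lt_two (α := ℝ))
    obtain ⟨k, hk⟩ := exists_mem_Ico_zpow ht0 (one_lt_two (α := ℝ))
    have hkj : k < j + 1 :=
      (zpow_lt_zpow_iff_right₀ (one_lt_two (α := ℝ))).1 (hk.1.trans_lt (htr.trans_lt hj.2))
    obtain ⟨τ, hτF, hτ⟩ := hF k t htE ⟨hk.1, hk.2.le⟩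
    have e0 : (2 : ℝ) ^ (k - (2 * m : ℕ)) = 2 ^ k * 2 ^ (-(2 * m : ℤ)) := by
      rw [← zpow_add₀ two_ne_zero]; push_cast; ring_nf
    have hp : (0 : ℝ) < 2 ^ (-(2 * m : ℤ)) := by positivity
    have e1 : (2 : ℝ) ^ (k - (2 * m : ℕ)) ≤ t * 2 ^ (-(2 * m : ℤ)) := by
      rw [e0]; gcongr; exact hk.1
    have e2 : t * 2 ^ (-(2 * m : ℤ)) ≤ 2 * (2 : ℝ) ^ (k - (2 * m : ℕ)) := by
      have := hk.2
      rw [zpow_add_one₀ two_ne_zero] at this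
      rw [e0]
      nlinarith
    rw [abs_le] at hτ
    refine mem_iUnion.2 ⟨j, hj.2.le, k, by omega, ?_⟩
    -- Since `t < 2^(k+1)`, the radius is at most `6` units of `2^(k-2m)`; moving the centre costs
    -- one more, which is below `8`.
    have aux : ∀ τ', |z - (r - τ')| ≤ (2 : ℝ) ^ (k - (2 * m : ℕ)) →
        ENNReal.ofReal (Λ * (2 : ℝ) ^ (k - (2 * m : ℕ))) <
          ∫⁻ s in closedBall (r - τ') (8 * (2 : ℝ) ^ (k - (2 * m : ℕ))),
            (window j).indicator h s := by
      intro τ' hτ'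
      refine lt_of_le_of_lt ?_ (hlt.trans_le (lintegral_inter_le_window measurableSet_closedBall
        (Icc_half_two_subset_window hj) (closedBall_subset_closedBall' ?_)))
      · gcongr
      · rw [Real.dist_eq]
        linarith
    rcases hz with rfl | rfl
    · refine ⟨-τ, Finset.mem_union_right _ (Finset.mem_image_of_mem _ hτF), aux _ ?_⟩
      rw [abs_le]
      constructor <;> linarith
    · refine ⟨τ, Finset.mem_union_left _ hτF, aux _ ?_⟩
      rw [abs_le]
      constructor <;> linarith
  set Y : ℝ := (86 + 80 * ((2 * m : ℕ) + 2) * (2 * X)) / Λ with hY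
  have hY0 : 0 ≤ Y := by positivity
  have hSm : ∀ j, radialMeasure D (S j) ≤ ENNReal.ofReal (2 ^ D * Y) *
      (ENNReal.ofReal (((2 : ℝ) ^ j) ^ D) * ∫⁻ s in window j, h s) := fun j ↦ by
    refine (radialMeasure_le D inter_subset_left).trans ?_
    refine (mul_le_mul_right ((measure_mono inter_subset_right).trans
      (volume_shifted_maximal_le G hGc hGb (2 * m) j hΛ)) _).trans (le_of_eq ?_)
    rw [← hY, lintegral_window_indicator, ← mul_assoc, ← mul_assoc, ← ENNReal.ofReal_mul (by positivity),
      ← ENNReal.ofReal_mul (by positivity), zpow_add_one₀ two_ne_zero, mul_pow]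
    congr 2
    ring
  calc _ ≤ radialMeasure D (⋃ j, S j) := measure_mono hcover
    _ ≤ ∑' j, radialMeasure D (S j) := measure_iUnion_le _
    _ ≤ _ := ENNReal.tsum_le_tsum hSm
    _ ≤ ENNReal.ofReal (2 ^ D * Y) *
        (ENNReal.ofReal (5 * 4 ^ D) * ∫⁻ s, h s ∂(radialMeasure D)) := by
        rw [ENNReal.tsum_mul_left]
        exact mul_le_mul_right (tsum_window_le D hh) _
    _ ≤ _ := by
        rw [← mul_assoc, ← ENNReal.ofReal_mul (by positivity)]
        refine mul_le_mul_left (ENNReal.ofReal_le_ofReal ?_) _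
        have h8 : (8 : ℝ) ^ D = 2 ^ D * 4 ^ D := by rw [← mul_pow]; norm_num
        rw [h8]
        have : (86 + 80 * (((2 * m : ℕ) : ℝ) + 2) * (2 * X)) ≤ 4000 * ((m + 1) * X) := by
          push_cast
          have hm0 : (0 : ℝ) ≤ m := by positivity
          nlinarith [mul_nonneg hm0 (by linarith : 0 ≤ X)]
        calc 2 ^ D * Y * (5 * 4 ^ D)
            ≤ 2 ^ D * ((4000 * ((m + 1) * X)) / Λ) * (5 * 4 ^ D) := by rw [hY]; gcongr
          _ = _ := by rw [hX]; ring

/-- Radii `r ≤ t` with a large mass near `t ± r`. -/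
def innerSet (E : Set ℝ) (h : ℝ → ℝ≥0∞) (m : ℕ) (Λ : ℝ) : Set ℝ :=
  {r | 0 < r ∧ ∃ t ∈ E, r ≤ t ∧ ∃ z, (z = t + r ∨ z = t - r) ∧
        ENNReal.ofReal (Λ * (r * (2 : ℝ) ^ (-(2 * m : ℤ)))) <
          ∫⁻ s in Icc (t / 2) (2 * t) ∩ closedBall z (3 * (r * (2 : ℝ) ^ (-(2 * m : ℤ)))), h s}

/-- The contribution of radii `r` that are dominated by the dilation parameter `t`. -/
theorem radialMeasure_inner_le (hE : HasCover E M β) (hM : 1 ≤ M) {D : ℕ} (hD : 1 ≤ D)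
    {h : ℝ → ℝ≥0∞} (hh : Measurable h) (m : ℕ) {Λ : ℝ} (hΛ : 0 < Λ) :
    radialMeasure D (innerSet E h m Λ) ≤
      ENNReal.ofReal (160 * 8 ^ D * M * (2 ^ (β * (2 * m : ℕ)) / Λ)) * geomSum (1 - β) *
        ∫⁻ s, h s ∂(radialMeasure D) := by
  choose F hFc hFb hF using hE
  -- Here `t ≈ 2^k` and `r ≈ 2^(k-l)`, so `E^k` is covered at the finer scale `2^(k-l-2m)` of the
  -- intervals. For fixed `k`, `l`, `τ` there is a single length and Chebyshev suffices.
  set S : ℤ → ℕ → ℝ → Set ℝ := fun k l τ ↦ Iic ((2 : ℝ) ^ (k - l + 1)) ∩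
    ({y | ENNReal.ofReal (Λ * (2 : ℝ) ^ (k - (l + 2 * m : ℕ))) <
      ∫⁻ s in closedBall (τ + y) (8 * (2 : ℝ) ^ (k - (l + 2 * m : ℕ))), (window k).indicator h s} ∪
    {y | ENNReal.ofReal (Λ * (2 : ℝ) ^ (k - (l + 2 * m : ℕ))) <
      ∫⁻ s in closedBall (τ - y) (8 * (2 : ℝ) ^ (k - (l + 2 * m : ℕ))), (window k).indicator h s})
    with hS
  have hcover : innerSet E h m Λ ⊆
      ⋃ k, ⋃ l, ⋃ τ ∈ F k (l + 2 * m), S k l τ := by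
    rintro r ⟨hr0, t, htE, hrt, z, hz, hlt⟩
    obtain ⟨i, hi⟩ := exists_mem_Ico_zpow hr0 (one_lt_two (α := ℝ))
    obtain ⟨k, hk⟩ := exists_mem_Ico_zpow (hr0.trans_le hrt) (one_lt_two (α := ℝ))
    have hik : i < k + 1 :=
      (zpow_lt_zpow_iff_right₀ (one_lt_two (α := ℝ))).1 (hi.1.trans_lt (hrt.trans_lt hk.2))
    obtain ⟨l, rfl⟩ : ∃ l : ℕ, i = k - l := ⟨(k - i).toNat, by omega⟩
    obtain ⟨τ, hτF, hτ⟩ := hF k (l + 2 * m) t htE ⟨hk.1, hk.2.le⟩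
    have e0 : (2 : ℝ) ^ (k - (l + 2 * m : ℕ)) = 2 ^ (k - l) * 2 ^ (-(2 * m : ℤ)) := by
      rw [← zpow_add₀ two_ne_zero]; push_cast; ring_nf
    have hp : (0 : ℝ) < 2 ^ (-(2 * m : ℤ)) := by positivity
    have e1 : (2 : ℝ) ^ (k - (l + 2 * m : ℕ)) ≤ r * 2 ^ (-(2 * m : ℤ)) := by
      rw [e0]; gcongr; exact hi.1
    have e2 : r * 2 ^ (-(2 * m : ℤ)) ≤ 2 * (2 : ℝ) ^ (k - (l + 2 * m : ℕ)) := by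
      have := hi.2
      rw [zpow_add_one₀ two_ne_zero] at this
      rw [e0]
      nlinarith
    rw [abs_le] at hτ
    simp only [mem_iUnion]
    refine ⟨k, l, τ, hτF, hi.2.le, ?_⟩
    have aux : ∀ z', |z - z'| ≤ (2 : ℝ) ^ (k - (l + 2 * m : ℕ)) →
        ENNReal.ofReal (Λ * (2 : ℝ) ^ (k - (l + 2 * m : ℕ))) <
          ∫⁻ s in closedBall z' (8 * (2 : ℝ) ^ (k - (l + 2 * m : ℕ))),
            (window k).indicator h s := by
      intro z' hz'
      refine lt_of_le_of_lt ?_ (hlt.trans_le (lintegral_inter_le_window measurableSet_closedBall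
        (Icc_half_two_subset_window hk) (closedBall_subset_closedBall' ?_)))
      · gcongr
      · rw [Real.dist_eq]
        linarith
    rcases hz with rfl | rfl
    · refine Or.inl (aux _ ?_)
      rw [abs_le]
      constructor <;> linarith
    · refine Or.inr (aux _ ?_)
      rw [abs_le]
      constructor <;> linarith
  have hSm : ∀ k l τ, radialMeasure D (S k l τ) ≤
      ENNReal.ofReal (32 / Λ * (((2 : ℝ) ^ (k - l + 1)) ^ D)) * ∫⁻ s in window k, h s := by
    intro k l τ
    refine (radialMeasure_le D inter_subset_left).trans ?_
    have hp : (0 : ℝ) < 2 ^ (k - (l + 2 * m : ℕ)) := by positivity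
    have hw : Measurable ((window k).indicator h) := hh.indicator (measurableSet_window k)
    have h1 := volume_large_mass_add_le hw (8 * (2 : ℝ) ^ (k - (l + 2 * m : ℕ))) τ
      (c := Λ * (2 : ℝ) ^ (k - (l + 2 * m : ℕ))) (by positivity)
    have h2 := volume_large_mass_sub_le hw (8 * (2 : ℝ) ^ (k - (l + 2 * m : ℕ))) τ
      (c := Λ * (2 : ℝ) ^ (k - (l + 2 * m : ℕ))) (by positivity)
    have h3 : 2 * (8 * (2 : ℝ) ^ (k - (l + 2 * m : ℕ))) / (Λ * (2 : ℝ) ^ (k - (l + 2 * m : ℕ))) =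
        16 / Λ := by field_simp; norm_num
    rw [h3, lintegral_window_indicator] at h1 h2
    refine (mul_le_mul_right ((measure_mono inter_subset_right).trans ((measure_union_le _ _).trans
      (add_le_add h1 h2))) _).trans (le_of_eq ?_)
    rw [← add_mul, ← mul_assoc, ← ENNReal.ofReal_add (by positivity) (by positivity),
      ← ENNReal.ofReal_mul (by positivity)]
    congr 2
    ring
  have hkl : ∀ k (l : ℕ), radialMeasure D (⋃ τ ∈ F k (l + 2 * m), S k l τ) ≤
      ENNReal.ofReal (32 * 2 ^ D * M * (2 ^ (β * (2 * m : ℕ)) / Λ)) *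
      (ENNReal.ofReal (((2 : ℝ) ^ k) ^ D) * ∫⁻ s in window k, h s) *
        ENNReal.ofReal (2 ^ (-((1 - β) * l))) := by
    intro k l
    calc _ ≤ ∑ τ ∈ F k (l + 2 * m), radialMeasure D (S k l τ) := measure_biUnion_finset_le _ _
      _ ≤ ∑ τ ∈ F k (l + 2 * m), ENNReal.ofReal (32 / Λ * (((2 : ℝ) ^ (k - l + 1)) ^ D)) *
          ∫⁻ s in window k, h s := Finset.sum_le_sum fun τ _ ↦ hSm k l τ
      _ = ENNReal.ofReal ((F k (l + 2 * m)).card * (32 / Λ * (((2 : ℝ) ^ (k - l + 1)) ^ D))) *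
          ∫⁻ s in window k, h s := by
          rw [Finset.sum_const, nsmul_eq_mul, ← ENNReal.ofReal_natCast, ← mul_assoc,
            ← ENNReal.ofReal_mul (by positivity)]
      _ ≤ ENNReal.ofReal (32 * 2 ^ D * M * (2 ^ (β * (2 * m : ℕ)) / Λ) * ((2 : ℝ) ^ k) ^ D *
          2 ^ (-((1 - β) * l))) * ∫⁻ s in window k, h s := by
          refine mul_le_mul_left (ENNReal.ofReal_le_ofReal ?_) _
          -- Smallness of `r` relative to `t` gives `2^{-lD} ≤ 2^{-l}`, which beats the `2^{βl}`
          -- additional centres and leaves `2^{-(1-β)l}`.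
          have h1 : ((2 : ℝ) ^ (k - l + 1)) ^ D ≤ 2 ^ D * ((2 : ℝ) ^ k) ^ D * 2 ^ (-(l : ℝ)) := by
            have : (2 : ℝ) ^ (k - l + 1) = 2 * 2 ^ k * 2 ^ (-(l : ℤ)) := by
              rw [zpow_add_one₀ two_ne_zero, sub_eq_add_neg, zpow_add₀ two_ne_zero]; ring
            rw [this, mul_pow, mul_pow]
            gcongr
            rw [Real.rpow_neg two_pos.le, Real.rpow_natCast, zpow_neg, zpow_natCast]
            exact pow_le_of_le_one (by positivity)
              (inv_le_one_of_one_le₀ (one_le_pow₀ one_le_two)) (by omega)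
          have h2 : (2 : ℝ) ^ (β * (l + 2 * m : ℕ)) * 2 ^ (-(l : ℝ)) =
              2 ^ (β * (2 * m : ℕ)) * 2 ^ (-((1 - β) * l)) := by
            rw [← Real.rpow_add two_pos, ← Real.rpow_add two_pos]
            congr 1
            push_cast
            ring
          calc ((F k (l + 2 * m)).card : ℝ) * (32 / Λ * (((2 : ℝ) ^ (k - l + 1)) ^ D))
              ≤ (M * 2 ^ (β * (l + 2 * m : ℕ))) * (32 / Λ *
                (2 ^ D * ((2 : ℝ) ^ k) ^ D * 2 ^ (-(l : ℝ)))) := by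
                gcongr
                exact hFc k _
            _ = 32 * 2 ^ D * M / Λ * ((2 : ℝ) ^ k) ^ D *
                (2 ^ (β * (l + 2 * m : ℕ)) * 2 ^ (-(l : ℝ))) := by ring
            _ = _ := by rw [h2]; ring
      _ = _ := by
          rw [ENNReal.ofReal_mul (by positivity), ENNReal.ofReal_mul (by positivity)]
          ring
  calc _ ≤ radialMeasure D (⋃ k, ⋃ l, ⋃ τ ∈ F k (l + 2 * m), S k l τ) := measure_mono hcover
    _ ≤ ∑' k, ∑' l, radialMeasure D (⋃ τ ∈ F k (l + 2 * m), S k l τ) :=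
        (measure_iUnion_le _).trans (ENNReal.tsum_le_tsum fun k ↦ measure_iUnion_le _)
    _ ≤ _ := ENNReal.tsum_le_tsum fun k ↦ ENNReal.tsum_le_tsum fun l ↦ hkl k l
    _ = ENNReal.ofReal (32 * 2 ^ D * M * (2 ^ (β * (2 * m : ℕ)) / Λ)) *
        (∑' k, ENNReal.ofReal (((2 : ℝ) ^ k) ^ D) * ∫⁻ s in window k, h s) * geomSum (1 - β) := by
        simp_rw [ENNReal.tsum_mul_left]
        rw [ENNReal.tsum_mul_right, ENNReal.tsum_mul_left]
        rfl
    _ ≤ ENNReal.ofReal (32 * 2 ^ D * M * (2 ^ (β * (2 * m : ℕ)) / Λ)) *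
        (ENNReal.ofReal (5 * 4 ^ D) * ∫⁻ s, h s ∂(radialMeasure D)) * geomSum (1 - β) := by
        gcongr
        exact tsum_window_le D hh
    _ = _ := by
        have h8 : (8 : ℝ) ^ D = 2 ^ D * 4 ^ D := by rw [← mul_pow]; norm_num
        have : 160 * 8 ^ D * M * (2 ^ (β * (2 * m : ℕ)) / Λ) =
          32 * 2 ^ D * M * (2 ^ (β * (2 * m : ℕ)) / Λ) * (5 * 4 ^ D) := by rw [h8]; ring
        rw [this, ENNReal.ofReal_mul (p := 32 * 2 ^ D * M * (2 ^ (β * (2 * m : ℕ)) / Λ))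
          (by positivity)]
        ring

end SeparatedRadii

/-! ### Sums over lacunary thresholds. -/

section Lacunary

/-- When the `b l` at least double, the terms below `X` add up to at most twice the last of them.
The induction carries the bound of the partial sum by the next threshold. -/
theorem tsum_lacunary_le {b : ℕ → ℝ≥0∞} (hb : ∀ l, 2 * b l ≤ b (l + 1)) (X : ℝ≥0∞) :
    ∑' l, (if b l < X then b l else 0) ≤ 2 * X := by
  have key : ∀ n, ∑ l ∈ Finset.range n, (if b l < X then b l else 0) ≤ b n ∧
      ∑ l ∈ Finset.range n, (if b l < X then b l else 0) ≤ 2 * X := by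
    intro n
    induction n with
    | zero => simp
    | succ n ih =>
      rw [Finset.sum_range_succ]
      split_ifs with h
      · have h1 : ∑ l ∈ Finset.range n, (if b l < X then b l else 0) + b n ≤ 2 * b n := by
          rw [two_mul]
          exact add_le_add ih.1 le_rfl
        exact ⟨h1.trans (hb n), h1.trans (mul_le_mul_right h.le 2)⟩
      · rw [add_zero]
        refine ⟨ih.1.trans (le_trans ?_ (hb n)), ih.2⟩
        rw [two_mul]
        exact le_add_self
  exact ENNReal.tsum_le_of_sum_range_le fun n ↦ (key n).2

/-- Chebyshev for all thresholds at once: the sum over `l` costs no more than a single threshold, up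
to a factor 2. -/
theorem tsum_lacunary_measure_le {α : Type*} [MeasurableSpace α] (μ : Measure α) {b : ℕ → ℝ≥0∞}
    (hb : ∀ l, 2 * b l ≤ b (l + 1)) {X : α → ℝ≥0∞} (hX : Measurable X) :
    ∑' l, b l * μ {y | b l < X y} ≤ 2 * ∫⁻ y, X y ∂μ := by
  have h1 : ∀ l, b l * μ {y | b l < X y} = ∫⁻ y, (if b l < X y then b l else 0) ∂μ := fun l ↦ by
    have hm : MeasurableSet {y | b l < X y} := measurableSet_lt measurable_const hX
    rw [← setLIntegral_const, ← lintegral_indicator hm]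
    refine lintegral_congr fun y ↦ ?_
    by_cases hy : b l < X y <;> simp [hy]
  simp_rw [h1]
  rw [← lintegral_tsum fun l ↦ (Measurable.ite (measurableSet_lt measurable_const hX)
    measurable_const measurable_const).aemeasurable, ← lintegral_const_mul _ hX]
  exact lintegral_mono fun y ↦ tsum_lacunary_le hb (X y)

theorem two_mul_ofReal_le {c κ : ℝ} (hc : 0 ≤ c) (hκ : 1 ≤ κ) (l : ℕ) :
    2 * ENNReal.ofReal (c * 2 ^ (κ * l)) ≤ ENNReal.ofReal (c * 2 ^ (κ * (l + 1 : ℕ))) := by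
  have h2 : (2 : ℝ≥0∞) = ENNReal.ofReal 2 := by norm_num
  rw [h2, ← ENNReal.ofReal_mul two_pos.le]
  refine ENNReal.ofReal_le_ofReal ?_
  have h3 : (2 : ℝ) ≤ 2 ^ κ := by
    calc (2 : ℝ) = 2 ^ (1 : ℝ) := (Real.rpow_one 2).symm
      _ ≤ 2 ^ κ := Real.rpow_le_rpow_of_exponent_le one_le_two hκ
  have h4 : (2 : ℝ) ^ (κ * (l + 1 : ℕ)) = 2 ^ (κ * l) * 2 ^ κ := by
    rw [← Real.rpow_add two_pos]
    congr 1
    push_cast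
    ring
  rw [h4]
  have h5 : 0 ≤ c * (2 : ℝ) ^ (κ * l) := by positivity
  nlinarith

end Lacunary

/-! ### Comparable `r` and `t`, and the diagonal `r = t`. -/

section ComparableRadii

variable {E : Set ℝ} {M β : ℝ}

theorem zpow_add_natCast_eq (i : ℤ) (l : ℕ) : (2 : ℝ) ^ (i + l) = 2 ^ i * 2 ^ (l : ℝ) := by
  rw [zpow_add₀ two_ne_zero, zpow_natCast, Real.rpow_natCast]

theorem Icc_five_subset_window (i : ℤ) : Icc ((2 : ℝ) ^ (i - 2)) (5 * (2 : ℝ) ^ i) ⊆ window i := by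
  intro s hs
  have h4 : (2 : ℝ) ^ (i + 3) = 2 ^ i * 8 := by rw [zpow_add₀ two_ne_zero]; norm_num
  have h5 : (0 : ℝ) < 2 ^ i := by positivity
  refine ⟨hs.1, ?_⟩
  rw [h4]
  linarith [hs.2]

/-- Radii `r` comparable to `t` with a large mass near `|r - t|`. -/
def smallAngleSet (E : Set ℝ) (h : ℝ → ℝ≥0∞) (κ : ℝ) (j : ℕ) (Λ : ℝ) : Set ℝ :=
  {r | ∃ t ∈ E, ∃ (k : ℤ) (l : ℕ), t ∈ Ico ((2 : ℝ) ^ k) ((2 : ℝ) ^ (k + 1)) ∧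
        r ≤ (2 : ℝ) ^ (k + 2) ∧ ∃ z, (z = r - t ∨ z = t - r) ∧
        ENNReal.ofReal (Λ * 2 ^ (κ * l) * (2 : ℝ) ^ (k - l - (2 * j : ℕ))) <
          ∫⁻ s in Icc ((2 : ℝ) ^ (k - l)) (5 * (2 : ℝ) ^ (k - l)) ∩
            closedBall z (10 * (2 : ℝ) ^ (k - l - (2 * j : ℕ))), h s}

/-- The contribution, for comparable `r` and `t`, of angles below `|r - t| / t`. -/
theorem radialMeasure_small_angle_le (hE : HasCover E M β) (hM : 1 ≤ M) (hβ : 0 ≤ β) {D : ℕ}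
    (hD : 1 ≤ D) {h : ℝ → ℝ≥0∞} (hh : Measurable h) (j : ℕ) {Λ : ℝ} (hΛ : 0 < Λ) :
    radialMeasure D (smallAngleSet E h (D + β) j Λ) ≤
      ENNReal.ofReal (440 * 16 ^ D * M * (2 ^ (β * (2 * j : ℕ)) / Λ)) *
        ∫⁻ s, h s ∂(radialMeasure D) := by
  choose F hFc hFb hF using hE
  -- The sum is organised by `i = k - l`, the scale of the third side. For fixed `i` and `j` the
  -- mass function `X i` does not depend on `l`; only the threshold `b i l` does.
  set a : ℤ → ℝ := fun i ↦ (2 : ℝ) ^ (i - (2 * j : ℕ)) with ha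
  have ha0 : ∀ i, 0 < a i := fun i ↦ by simp only [ha]; positivity
  set b : ℤ → ℕ → ℝ≥0∞ := fun i l ↦ ENNReal.ofReal (Λ * a i * 2 ^ ((D + β) * l)) with hb
  set X : ℤ → ℝ → ℝ≥0∞ := fun i y ↦ ∫⁻ s in closedBall y (11 * a i), (window i).indicator h s
    with hX
  have hwm : ∀ i, Measurable ((window i).indicator h) := fun i ↦
    hh.indicator (measurableSet_window i)
  have hXm : ∀ i, Measurable (X i) := fun i ↦ measurable_lintegral_closedBall (hwm i) _
  set S : ℤ → ℕ → ℝ → Set ℝ := fun i l τ ↦ Iic ((2 : ℝ) ^ (i + l + 2)) ∩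
    ({y | b i l < X i (-τ + y)} ∪ {y | b i l < X i (τ - y)}) with hS
  have hcover : smallAngleSet E h (D + β) j Λ ⊆
      ⋃ i, ⋃ l : ℕ, ⋃ τ ∈ F (i + l) (l + 2 * j), S i l τ := by
    rintro r ⟨t, htE, k, l, hk, hrk, z, hz, hlt⟩
    obtain ⟨τ, hτF, hτ⟩ := hF k (l + 2 * j) t htE ⟨hk.1, hk.2.le⟩
    simp only [mem_iUnion]
    have hkl : k - l + l = k := by ring
    refine ⟨k - l, l, τ, by rwa [hkl], by rw [mem_Iic, hkl]; exact hrk, ?_⟩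
    have e0 : (2 : ℝ) ^ (k - (l + 2 * j : ℕ)) = a (k - l) := by
      simp only [ha]; push_cast; ring_nf
    rw [e0, abs_le] at hτ
    have aux : ∀ z', |z - z'| ≤ a (k - l) → b (k - l) l < X (k - l) z' := by
      intro z' hz'
      refine lt_of_eq_of_lt ?_ (hlt.trans_le (lintegral_inter_le_window (j := k - l)
        (B' := closedBall z' (11 * a (k - l))) measurableSet_closedBall ?_
        (closedBall_subset_closedBall' ?_)))
      · simp only [hb]
        congr 1
        ring
      · refine subset_trans (Icc_subset_Icc_left ?_) (Icc_five_subset_window _)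
        exact zpow_le_zpow_right₀ one_le_two (by omega)
      · rw [Real.dist_eq]
        simp only [ha] at hz' ⊢
        linarith
    rcases hz with rfl | rfl
    · refine Or.inl (aux _ ?_)
      rw [abs_le]
      constructor <;> linarith
    · refine Or.inr (aux _ ?_)
      rw [abs_le]
      constructor <;> linarith
  have hSm : ∀ i l τ, radialMeasure D (S i l τ) ≤
      ENNReal.ofReal (2 * ((2 : ℝ) ^ (i + l + 2)) ^ D) * volume {y | b i l < X i y} := by
    intro i l τ
    refine (radialMeasure_le D inter_subset_left).trans ?_
    have hm : MeasurableSet {y | b i l < X i y} := measurableSet_lt measurable_const (hXm i)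
    have h1 : volume {y | b i l < X i (-τ + y)} = volume {y | b i l < X i y} :=
      (measurePreserving_add_left volume (-τ)).measure_preimage hm.nullMeasurableSet
    have h2 : volume {y | b i l < X i (τ - y)} = volume {y | b i l < X i y} :=
      (Measure.measurePreserving_sub_left volume τ).measure_preimage hm.nullMeasurableSet
    refine (mul_le_mul_right ((measure_mono inter_subset_right).trans (measure_union_le _ _))
      _).trans (le_of_eq ?_)
    rw [h1, h2, ← two_mul, ENNReal.ofReal_mul two_pos.le]
    norm_num
    ring
  set C : ℤ → ℝ := fun i ↦ 2 * 4 ^ D * M * 2 ^ (β * (2 * j : ℕ)) * ((2 : ℝ) ^ i) ^ D / (Λ * a i)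
    with hC
  have hil : ∀ i (l : ℕ), radialMeasure D (⋃ τ ∈ F (i + l) (l + 2 * j), S i l τ) ≤
      ENNReal.ofReal (C i) * (b i l * volume {y | b i l < X i y}) := by
    intro i l
    have hai := ha0 i
    calc _ ≤ ∑ τ ∈ F (i + l) (l + 2 * j), radialMeasure D (S i l τ) :=
          measure_biUnion_finset_le _ _
      _ ≤ ∑ τ ∈ F (i + l) (l + 2 * j), ENNReal.ofReal (2 * ((2 : ℝ) ^ (i + l + 2)) ^ D) *
          volume {y | b i l < X i y} := Finset.sum_le_sum fun τ _ ↦ hSm i l τ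
      _ = ENNReal.ofReal ((F (i + l) (l + 2 * j)).card * (2 * ((2 : ℝ) ^ (i + l + 2)) ^ D)) *
          volume {y | b i l < X i y} := by
          rw [Finset.sum_const, nsmul_eq_mul, ← ENNReal.ofReal_natCast, ← mul_assoc,
            ← ENNReal.ofReal_mul (by positivity)]
      _ ≤ ENNReal.ofReal (C i * (Λ * a i * 2 ^ ((D + β) * l))) *
          volume {y | b i l < X i y} := by
          refine mul_le_mul_left (ENNReal.ofReal_le_ofReal ?_) _
          have h1 : (2 : ℝ) ^ (i + l + 2) = 4 * 2 ^ i * 2 ^ (l : ℝ) := by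
            rw [zpow_add₀ two_ne_zero, zpow_add_natCast_eq]; norm_num; ring
          -- The number of centres times the density `r^D` grows in `l` exactly like the threshold,
          -- so `tsum_lacunary_measure_le` applies without loss.
          have h2 : (2 : ℝ) ^ (β * (l + 2 * j : ℕ)) * (2 ^ (l : ℝ)) ^ D =
              2 ^ (β * (2 * j : ℕ)) * 2 ^ ((D + β) * l) := by
            rw [← Real.rpow_natCast, ← Real.rpow_mul two_pos.le, ← Real.rpow_add two_pos,
              ← Real.rpow_add two_pos]
            congr 1
            push_cast
            ring
          calc ((F (i + l) (l + 2 * j)).card : ℝ) * (2 * ((2 : ℝ) ^ (i + l + 2)) ^ D)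
              ≤ (M * 2 ^ (β * (l + 2 * j : ℕ))) * (2 * ((2 : ℝ) ^ (i + l + 2)) ^ D) := by
                gcongr
                exact hFc _ _
            _ = 2 * 4 ^ D * M * ((2 : ℝ) ^ i) ^ D *
                (2 ^ (β * (l + 2 * j : ℕ)) * (2 ^ (l : ℝ)) ^ D) := by
                rw [h1, mul_pow, mul_pow]; ring
            _ = C i * (Λ * a i * 2 ^ ((D + β) * l)) := by
                rw [h2, hC]
                field_simp
      _ = _ := by
          rw [ENNReal.ofReal_mul (by simp only [hC]; positivity), mul_assoc]
  have hi : ∀ i, ∑' l : ℕ, radialMeasure D (⋃ τ ∈ F (i + l) (l + 2 * j), S i l τ) ≤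
      ENNReal.ofReal (88 * 4 ^ D * M * (2 ^ (β * (2 * j : ℕ)) / Λ)) *
        (ENNReal.ofReal (((2 : ℝ) ^ i) ^ D) * ∫⁻ s in window i, h s) := by
    intro i
    have hai := ha0 i
    have hκ : 1 ≤ (D : ℝ) + β := by
      have : (1 : ℝ) ≤ D := by exact_mod_cast hD
      linarith
    calc _ ≤ ∑' l : ℕ, ENNReal.ofReal (C i) * (b i l * volume {y | b i l < X i y}) :=
          ENNReal.tsum_le_tsum (hil i)
      _ ≤ ENNReal.ofReal (C i) * (2 * ∫⁻ y, X i y) := by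
          rw [ENNReal.tsum_mul_left]
          exact mul_le_mul_right (tsum_lacunary_measure_le volume
            (fun l ↦ two_mul_ofReal_le (by positivity) hκ l) (hXm i)) _
      _ = ENNReal.ofReal (C i * (2 * (2 * (11 * a i)))) * ∫⁻ s in window i, h s := by
          simp only [hX]
          have h2 : (2 : ℝ≥0∞) = ENNReal.ofReal 2 := by norm_num
          rw [lintegral_lintegral_closedBall (hwm i), lintegral_window_indicator, h2, ← mul_assoc,
            ← mul_assoc, ← ENNReal.ofReal_mul (by simp only [hC]; positivity),
            ← ENNReal.ofReal_mul (by simp only [hC]; positivity)]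
          congr 2
          ring
      _ = _ := by
          rw [← mul_assoc (ENNReal.ofReal _) (ENNReal.ofReal _),
            ← ENNReal.ofReal_mul (by positivity)]
          congr 2
          simp only [hC]
          field_simp
          ring
  calc _ ≤ radialMeasure D (⋃ i, ⋃ l : ℕ, ⋃ τ ∈ F (i + l) (l + 2 * j), S i l τ) :=
        measure_mono hcover
    _ ≤ ∑' i : ℤ, ∑' l : ℕ, radialMeasure D (⋃ τ ∈ F (i + l) (l + 2 * j), S i l τ) :=
        (measure_iUnion_le _).trans (ENNReal.tsum_le_tsum fun k ↦ measure_iUnion_le _)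
    _ ≤ _ := ENNReal.tsum_le_tsum hi
    _ ≤ ENNReal.ofReal (88 * 4 ^ D * M * (2 ^ (β * (2 * j : ℕ)) / Λ)) *
        (ENNReal.ofReal (5 * 4 ^ D) * ∫⁻ s, h s ∂(radialMeasure D)) := by
        rw [ENNReal.tsum_mul_left]
        exact mul_le_mul_right (tsum_window_le D hh) _
    _ = _ := by
        rw [← mul_assoc, ← ENNReal.ofReal_mul (by positivity)]
        congr 2
        have h16 : (16 : ℝ) ^ D = 4 ^ D * 4 ^ D := by rw [← mul_pow]; norm_num
        rw [h16]
        ring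

/-- Radii `r` close to `t` with a large mass at a scale above `|r - t|`. -/
def largeAngleSet (E : Set ℝ) (h : ℝ → ℝ≥0∞) (κ : ℝ) (j : ℕ) (Λ : ℝ) : Set ℝ :=
  {r | ∃ t ∈ E, ∃ (k : ℤ) (m : ℕ), t ∈ Ico ((2 : ℝ) ^ k) ((2 : ℝ) ^ (k + 1)) ∧
        |r - t| ≤ 2 * (2 : ℝ) ^ (k - m - j) ∧
        ENNReal.ofReal (Λ * 2 ^ (κ * m) * (2 : ℝ) ^ (k - m)) <
          ∫⁻ s in Icc ((2 : ℝ) ^ (k - m - 2)) (5 * (2 : ℝ) ^ (k - m)), h s}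

/-- The contribution, for comparable `r` and `t`, of angles above `|r - t| / t`. -/
theorem radialMeasure_large_angle_le (hE : HasCover E M β) (hM : 1 ≤ M) (hβ : 0 ≤ β) {D : ℕ}
    (hD : 1 ≤ D) {h : ℝ → ℝ≥0∞} (hh : Measurable h) (j : ℕ) {Λ : ℝ} (hΛ : 0 < Λ) :
    radialMeasure D (largeAngleSet E h (D + β) j Λ) ≤
      ENNReal.ofReal (60 * 16 ^ D * M * (2 ^ (-((1 - β) * j)) / Λ)) *
        ∫⁻ s, h s ∂(radialMeasure D) := by
  choose F hFc hFb hF using hE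
  set b : ℤ → ℕ → ℝ≥0∞ := fun i m ↦ ENNReal.ofReal (Λ * (2 : ℝ) ^ i * 2 ^ ((D + β) * m)) with hb
  set I : ℤ → ℝ≥0∞ := fun i ↦ ∫⁻ s in window i, h s with hI
  -- With `i = k - m`, the mass `I i` of the whole window does not involve `r`: either `S i m` is
  -- empty, or `r` is merely confined to a `3·2^(i-j)` neighbourhood of the centres.
  set S : ℤ → ℕ → Set ℝ := fun i m ↦ {r | b i m < I i ∧ r ≤ (2 : ℝ) ^ (i + m + 2) ∧
    ∃ τ ∈ F (i + m) (m + j), r ∈ closedBall τ (3 * (2 : ℝ) ^ (i - j))} with hS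
  have hcover : largeAngleSet E h (D + β) j Λ ⊆
      ⋃ i, ⋃ m : ℕ, S i m := by
    rintro r ⟨t, htE, k, m, hk, hrt, hlt⟩
    obtain ⟨τ, hτF, hτ⟩ := hF k (m + j) t htE ⟨hk.1, hk.2.le⟩
    simp only [mem_iUnion]
    have hkm : k - m + m = k := by ring
    have e0 : k - (m + j : ℕ) = k - m - j := by push_cast; ring
    rw [e0] at hτ
    refine ⟨k - m, m, ?_, ?_, τ, by rwa [hkm], ?_⟩
    · refine lt_of_eq_of_lt ?_ (hlt.trans_le (lintegral_mono_set (Icc_five_subset_window _)))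
      simp only [hb]
      congr 1
      ring
    · rw [hkm, zpow_add₀ two_ne_zero]
      have h1 : (2 : ℝ) ^ (k - m - j) ≤ 2 ^ k := zpow_le_zpow_right₀ one_le_two (by omega)
      have h2 := hk.2
      rw [zpow_add_one₀ two_ne_zero] at h2
      have h3 := (abs_le.1 hrt).2
      norm_num
      linarith
    · rw [mem_closedBall, Real.dist_eq]
      calc |r - τ| = |(r - t) + (t - τ)| := by ring_nf
        _ ≤ |r - t| + |t - τ| := abs_add_le _ _
        _ ≤ _ := by linarith
  set C : ℤ → ℝ := fun i ↦ 6 * 4 ^ D * M * (2 ^ (-((1 - β) * j)) / Λ) * ((2 : ℝ) ^ i) ^ D with hC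
  have him : ∀ i (m : ℕ), radialMeasure D (S i m) ≤
      ENNReal.ofReal (C i) * (if b i m < I i then b i m else 0) := by
    intro i m
    split_ifs with hlt
    · have hsub : S i m ⊆ Iic ((2 : ℝ) ^ (i + m + 2)) := fun r hr ↦ hr.2.1
      have hsub' : S i m ⊆ ⋃ τ ∈ F (i + m) (m + j), closedBall τ (3 * (2 : ℝ) ^ (i - j)) :=
        fun r hr ↦ by
          obtain ⟨τ, h1, h2⟩ := hr.2.2
          simp only [mem_iUnion]
          exact ⟨τ, h1, h2⟩
      have hv : volume (S i m) ≤
          ENNReal.ofReal (M * 2 ^ (β * (m + j : ℕ)) * (2 * (3 * (2 : ℝ) ^ (i - j)))) := by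
        calc _ ≤ ∑ τ ∈ F (i + m) (m + j), volume (closedBall τ (3 * (2 : ℝ) ^ (i - j))) :=
              (measure_mono hsub').trans (measure_biUnion_finset_le _ _)
          _ = ENNReal.ofReal ((F (i + m) (m + j)).card * (2 * (3 * (2 : ℝ) ^ (i - j)))) := by
              simp_rw [Real.volume_closedBall]
              rw [Finset.sum_const, nsmul_eq_mul, ← ENNReal.ofReal_natCast,
                ← ENNReal.ofReal_mul (by positivity)]
          _ ≤ _ := by
              refine ENNReal.ofReal_le_ofReal ?_
              gcongr
              exact hFc _ _
      refine (radialMeasure_le D hsub).trans ((mul_le_mul_right hv _).trans (le_of_eq ?_))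
      simp only [hb]
      rw [← ENNReal.ofReal_mul (by positivity), ← ENNReal.ofReal_mul (by
        simp only [hC]; positivity)]
      congr 1
      have h1 : (2 : ℝ) ^ (i + m + 2) = 4 * 2 ^ i * 2 ^ (m : ℝ) := by
        rw [zpow_add₀ two_ne_zero, zpow_add_natCast_eq]; norm_num; ring
      have h2 : (2 : ℝ) ^ (i - j) = 2 ^ i * 2 ^ (-(j : ℝ)) := by
        rw [Real.rpow_neg two_pos.le, Real.rpow_natCast, zpow_sub₀ two_ne_zero, zpow_natCast]
        rfl
      -- The growth in `m` again matches the threshold; in `j`, the length `2^{-j}` beats the count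
      -- `2^{βj}`.
      have h3 : (2 : ℝ) ^ (β * (m + j : ℕ)) * (2 ^ (m : ℝ)) ^ D * 2 ^ (-(j : ℝ)) =
          2 ^ (-((1 - β) * j)) * 2 ^ ((D + β) * m) := by
        rw [← Real.rpow_natCast, ← Real.rpow_mul two_pos.le, ← Real.rpow_add two_pos,
          ← Real.rpow_add two_pos, ← Real.rpow_add two_pos]
        congr 1
        push_cast
        ring
      calc ((2 : ℝ) ^ (i + m + 2)) ^ D *
            (M * 2 ^ (β * (m + j : ℕ)) * (2 * (3 * (2 : ℝ) ^ (i - j))))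
          = 6 * 4 ^ D * M * ((2 : ℝ) ^ i) ^ D * 2 ^ i *
            (2 ^ (β * (m + j : ℕ)) * (2 ^ (m : ℝ)) ^ D * 2 ^ (-(j : ℝ))) := by
            rw [h1, h2, mul_pow, mul_pow]; ring
        _ = _ := by
            rw [h3]
            simp only [hC]
            field_simp
    · have : S i m = ∅ := by
        ext r
        simp only [mem_empty_iff_false, iff_false]
        exact fun hr ↦ hlt hr.1
      rw [this, measure_empty]
      exact bot_le
  have hi : ∀ i, ∑' m : ℕ, radialMeasure D (S i m) ≤
      ENNReal.ofReal (12 * 4 ^ D * M * (2 ^ (-((1 - β) * j)) / Λ)) *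
        (ENNReal.ofReal (((2 : ℝ) ^ i) ^ D) * ∫⁻ s in window i, h s) := by
    intro i
    have hκ : 1 ≤ (D : ℝ) + β := by
      have : (1 : ℝ) ≤ D := by exact_mod_cast hD
      linarith
    calc _ ≤ ∑' m : ℕ, ENNReal.ofReal (C i) * (if b i m < I i then b i m else 0) :=
          ENNReal.tsum_le_tsum (him i)
      _ ≤ ENNReal.ofReal (C i) * (2 * I i) := by
          rw [ENNReal.tsum_mul_left]
          exact mul_le_mul_right (tsum_lacunary_le
            (fun l ↦ two_mul_ofReal_le (by positivity) hκ l) (I i)) _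
      _ = _ := by
          rw [← mul_assoc, ← mul_assoc, ← ENNReal.ofReal_mul (by positivity)]
          congr 1
          have : (2 : ℝ≥0∞) = ENNReal.ofReal 2 := by norm_num
          rw [this, ← ENNReal.ofReal_mul (by simp only [hC]; positivity)]
          congr 1
          simp only [hC]
          ring
  calc _ ≤ radialMeasure D (⋃ i, ⋃ m : ℕ, S i m) := measure_mono hcover
    _ ≤ ∑' i : ℤ, ∑' m : ℕ, radialMeasure D (S i m) :=
        (measure_iUnion_le _).trans (ENNReal.tsum_le_tsum fun k ↦ measure_iUnion_le _)
    _ ≤ _ := ENNReal.tsum_le_tsum hi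
    _ ≤ ENNReal.ofReal (12 * 4 ^ D * M * (2 ^ (-((1 - β) * j)) / Λ)) *
        (ENNReal.ofReal (5 * 4 ^ D) * ∫⁻ s, h s ∂(radialMeasure D)) := by
        rw [ENNReal.tsum_mul_left]
        exact mul_le_mul_right (tsum_window_le D hh) _
    _ = _ := by
        rw [← mul_assoc, ← ENNReal.ofReal_mul (by positivity)]
        congr 2
        have h16 : (16 : ℝ) ^ D = 4 ^ D * 4 ^ D := by rw [← mul_pow]; norm_num
        rw [h16]
        ring

/-- At scale `2^(k-n)` the cover has total length of order `2^{-(1-β)n} 2^k`, which tends to `0`.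
This disposes of `r = t`, where `|r - t|` has no dyadic size. -/
theorem radialMeasure_eq_zero_of_hasCover (hE : HasCover E M β) (hβ : β < 1)
    (hE0 : E ⊆ Ioi 0) (D : ℕ) : radialMeasure D E = 0 := by
  choose F hFc hFb hF using hE
  have hk : ∀ k : ℤ, volume (E ∩ Ico ((2 : ℝ) ^ k) ((2 : ℝ) ^ (k + 1))) = 0 := by
    intro k
    have h1 : ∀ n : ℕ, volume (E ∩ Ico ((2 : ℝ) ^ k) ((2 : ℝ) ^ (k + 1))) ≤
        ENNReal.ofReal (2 * M * 2 ^ k) * ENNReal.ofReal (2 ^ (-((1 - β) * n))) := by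
      intro n
      have hM : 0 ≤ M := by
        by_contra hneg
        have := hFc k n
        have h2 : (0 : ℝ) < 2 ^ (β * n) := by positivity
        have h3 : (0 : ℝ) ≤ ((F k n).card : ℝ) := by positivity
        nlinarith
      calc _ ≤ volume (⋃ τ ∈ F k n, closedBall τ ((2 : ℝ) ^ (k - n))) := by
            refine measure_mono ?_
            rintro t ⟨htE, ht⟩
            obtain ⟨τ, h1, h2⟩ := hF k n t htE ⟨ht.1, ht.2.le⟩
            simp only [mem_iUnion]
            exact ⟨τ, h1, by rwa [mem_closedBall, Real.dist_eq]⟩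
        _ ≤ ∑ τ ∈ F k n, volume (closedBall τ ((2 : ℝ) ^ (k - n))) :=
            measure_biUnion_finset_le _ _
        _ = ENNReal.ofReal ((F k n).card * (2 * (2 : ℝ) ^ (k - n))) := by
            simp_rw [Real.volume_closedBall]
            rw [Finset.sum_const, nsmul_eq_mul, ← ENNReal.ofReal_natCast,
              ← ENNReal.ofReal_mul (by positivity)]
        _ ≤ ENNReal.ofReal (M * 2 ^ (β * n) * (2 * (2 : ℝ) ^ (k - n))) := by
            refine ENNReal.ofReal_le_ofReal ?_
            gcongr
            exact hFc _ _
        _ = _ := by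
            rw [← ENNReal.ofReal_mul (by positivity)]
            congr 1
            have h2 : (2 : ℝ) ^ (k - n) = 2 ^ k * 2 ^ (-(n : ℝ)) := by
              rw [Real.rpow_neg two_pos.le, Real.rpow_natCast, zpow_sub₀ two_ne_zero, zpow_natCast]
              rfl
            have h3 : (2 : ℝ) ^ (-((1 - β) * n)) = 2 ^ (β * n) * 2 ^ (-(n : ℝ)) := by
              rw [← Real.rpow_add two_pos]
              ring_nf
            rw [h2, h3]
            ring
    have h2 := ENNReal.tendsto_atTop_zero_of_tsum_ne_top (geomSum_ne_top (sub_pos.2 hβ))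
    have h3 := ENNReal.Tendsto.const_mul h2
      (Or.inr (ENNReal.ofReal_ne_top (r := 2 * M * (2 : ℝ) ^ k)))
    rw [mul_zero] at h3
    exact le_antisymm (ge_of_tendsto' h3 h1) bot_le
  have hsub : E ⊆ ⋃ k : ℤ, E ∩ Ico ((2 : ℝ) ^ k) ((2 : ℝ) ^ (k + 1)) := by
    rw [← inter_iUnion, iUnion_Ico_two_zpow]
    exact subset_inter subset_rfl hE0
  refine measure_mono_null hsub (measure_iUnion_null fun k ↦ ?_)
  have := radialMeasure_le D (S := E ∩ Ico ((2 : ℝ) ^ k) ((2 : ℝ) ^ (k + 1)))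
    (b := (2 : ℝ) ^ (k + 1)) fun s hs ↦ hs.2.2.le
  rw [hk k, mul_zero] at this
  exact le_antisymm this bot_le

end ComparableRadii

/-! ### Location of the third side for each arc. -/

section Geometry

variable {r t : ℝ} {m : ℕ} {θ : ℝ}

theorem nearPiece_cos_bounds (hθ : θ ∈ nearPiece m) :
    (2 : ℝ) ^ (-(2 * m : ℤ)) / 4 ≤ 2 * (1 - Real.cos θ) ∧
      2 * (1 - Real.cos θ) ≤ 5 / 2 * (2 : ℝ) ^ (-(2 * m : ℤ)) := by
  have h0 := (nearPiece_mem hθ).1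
  have h1 := (nearPiece_mem hθ).2
  have hpi := Real.pi_pos
  have e0 : (2 : ℝ) ^ (-(2 * m : ℤ)) = ((1 / 2) ^ m) ^ 2 := by
    rw [zpow_neg, mul_comm, zpow_mul, zpow_natCast, one_div, inv_pow, inv_pow]
    norm_cast
  have hq : (0 : ℝ) < (1 / 2) ^ m := by positivity
  rw [e0]
  set q : ℝ := (1 / 2) ^ m with hqd
  have hθ1 : Real.pi / 2 * (q * (1 / 2)) < θ := by
    have := hθ.1; rwa [pow_succ] at this
  have hθ2 : θ ≤ Real.pi / 2 * q := hθ.2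
  constructor
  · have h2 := Real.cos_le_one_sub_mul_cos_sq (x := θ) (by rw [abs_of_pos h0]; linarith)
    have h3 : (Real.pi / 2 * (q * (1 / 2))) ^ 2 ≤ θ ^ 2 := by gcongr
    have h4 : 2 / Real.pi ^ 2 * (Real.pi / 2 * (q * (1 / 2))) ^ 2 ≤ 2 / Real.pi ^ 2 * θ ^ 2 := by
      gcongr
    have h5 : 2 / Real.pi ^ 2 * (Real.pi / 2 * (q * (1 / 2))) ^ 2 = q ^ 2 / 8 := by
      field_simp
      norm_num
    linarith
  · have h2 := Real.one_sub_sq_div_two_le_cos (x := θ)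
    have h3 : θ ^ 2 ≤ (Real.pi / 2 * q) ^ 2 := by gcongr
    have h4 : Real.pi ^ 2 ≤ 10 := by nlinarith [Real.pi_lt_d2]
    nlinarith [sq_nonneg q]

theorem farPiece_cos_bounds (hθ : θ ∈ farPiece m) :
    2 * (1 + Real.cos θ) ≤ 5 / 2 * (2 : ℝ) ^ (-(2 * m : ℤ)) ∧ Real.cos θ ≤ 0 := by
  have h := nearPiece_cos_bounds (θ := Real.pi - θ) hθ
  have h2 := nearPiece_mem (θ := Real.pi - θ) hθ
  rw [Real.cos_pi_sub] at h
  refine ⟨by linarith [h.2], ?_⟩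
  rw [← neg_nonneg, ← Real.cos_pi_sub]
  exact Real.cos_nonneg_of_neg_pi_div_two_le_of_le (by linarith) h2.2

/-- Factor `(r + t)² - s² = 2rt(1 + cos θ)`, which is of order at most `r t 4^{-m}`, and divide by
`r + t + s ≥ 2r`. -/
theorem thirdSide_far_mem (ht : 0 < t) (htr : t ≤ r) (hθ : θ ∈ farPiece m) :
    thirdSide r t θ ∈ Icc (r / 2) (2 * r) ∩
      closedBall (r + t) (3 * (t * (2 : ℝ) ^ (-(2 * m : ℤ)))) := by
  have hr : 0 < r := ht.trans_le htr
  obtain ⟨h1, h2⟩ := farPiece_cos_bounds hθ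
  have hs := thirdSide_sq hr ht θ
  have hs0 := thirdSide_nonneg r t θ
  have hv : (0 : ℝ) < 2 ^ (-(2 * m : ℤ)) := by positivity
  have hrt := mul_pos hr ht
  have hc := Real.neg_one_le_cos θ
  set s := thirdSide r t θ
  have hsr : r ≤ s := by
    refine abs_le_of_sq_le_sq' ?_ hs0 |>.2
    nlinarith
  have hsr2 : s ≤ r + t := by
    refine abs_le_of_sq_le_sq' ?_ (by linarith) |>.2
    nlinarith
  have key : (r + t - s) * (2 * r) ≤ 5 / 2 * (t * (2 : ℝ) ^ (-(2 * m : ℤ))) * r := by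
    calc (r + t - s) * (2 * r) ≤ (r + t - s) * (r + t + s) := by
          gcongr
          linarith
      _ = r * t * (2 * (1 + Real.cos θ)) := by linear_combination -hs
      _ ≤ r * t * (5 / 2 * (2 : ℝ) ^ (-(2 * m : ℤ))) := by gcongr
      _ = _ := by ring
  have key2 : r + t - s ≤ 3 * (t * (2 : ℝ) ^ (-(2 * m : ℤ))) := by
    have : (r + t - s) * 2 ≤ 5 / 2 * (t * (2 : ℝ) ^ (-(2 * m : ℤ))) :=
      le_of_mul_le_mul_right (by linarith) hr
    nlinarith [mul_pos ht hv]
  refine ⟨⟨by linarith, by linarith⟩, ?_⟩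
  rw [mem_closedBall, Real.dist_eq, abs_le]
  constructor <;> nlinarith [mul_pos ht hv]

/-- Factor `s² - (r - t)² = 2rt(1 - cos θ)`; since `2t ≤ r`, the factor `s + (r - t)` is at least
`r`. -/
theorem thirdSide_near_mem (ht : 0 < t) (htr : 2 * t ≤ r) (hθ : θ ∈ nearPiece m) :
    thirdSide r t θ ∈ Icc (r / 2) (2 * r) ∩
      closedBall (r - t) (3 * (t * (2 : ℝ) ^ (-(2 * m : ℤ)))) := by
  have hr : 0 < r := by linarith
  obtain ⟨h1, h2⟩ := nearPiece_cos_bounds hθ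
  have hs := thirdSide_sq hr ht θ
  have hs0 := thirdSide_nonneg r t θ
  have hv : (0 : ℝ) < 2 ^ (-(2 * m : ℤ)) := by positivity
  have hrt := mul_pos hr ht
  have hc := Real.neg_one_le_cos θ
  have hc1 := Real.cos_le_one θ
  set s := thirdSide r t θ
  have hsr : r - t ≤ s := by
    refine abs_le_of_sq_le_sq' ?_ hs0 |>.2
    nlinarith
  have hsr2 : s ≤ r + t := by
    refine abs_le_of_sq_le_sq' ?_ (by linarith) |>.2
    nlinarith
  have key : (s - (r - t)) * r ≤ 5 / 2 * (t * (2 : ℝ) ^ (-(2 * m : ℤ))) * r := by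
    calc (s - (r - t)) * r ≤ (s - (r - t)) * (s + (r - t)) := by
          gcongr
          linarith
      _ = r * t * (2 * (1 - Real.cos θ)) := by linear_combination hs
      _ ≤ r * t * (5 / 2 * (2 : ℝ) ^ (-(2 * m : ℤ))) := by gcongr
      _ = _ := by ring
  have key2 : s - (r - t) ≤ 5 / 2 * (t * (2 : ℝ) ^ (-(2 * m : ℤ))) :=
    le_of_mul_le_mul_right key hr
  refine ⟨⟨by linarith, by linarith⟩, ?_⟩
  rw [mem_closedBall, Real.dist_eq, abs_le]
  constructor <;> nlinarith [mul_pos ht hv]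

theorem mul_cos_bounds {k : ℤ} (hk : t ∈ Ico ((2 : ℝ) ^ k) ((2 : ℝ) ^ (k + 1))) (h1 : t < 2 * r)
    (h2 : r < 2 * t) (hθ : θ ∈ nearPiece m) :
    ((2 : ℝ) ^ (k - m)) ^ 2 / 8 ≤ 2 * r * t * (1 - Real.cos θ) ∧
      2 * r * t * (1 - Real.cos θ) ≤ 20 * ((2 : ℝ) ^ (k - m)) ^ 2 := by
  obtain ⟨h3, h4⟩ := nearPiece_cos_bounds hθ
  have hk0 : (0 : ℝ) < 2 ^ k := by positivity
  have e0 : ((2 : ℝ) ^ (k - m)) ^ 2 = (2 ^ k) ^ 2 * 2 ^ (-(2 * m : ℤ)) := by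
    rw [← zpow_natCast, ← zpow_natCast, ← zpow_mul, ← zpow_mul, ← zpow_add₀ two_ne_zero]
    congr 1
    push_cast
    ring
  have hv : (0 : ℝ) < 2 ^ (-(2 * m : ℤ)) := by positivity
  have hk1 := hk.1
  have hk2 := hk.2
  rw [zpow_add_one₀ two_ne_zero] at hk2
  have ht : 0 < t := hk0.trans_le hk1
  have hr : 0 < r := by linarith
  rw [e0]
  have a1 : (2 ^ k : ℝ) ^ 2 / 2 ≤ r * t := by nlinarith
  have a2 : r * t ≤ 8 * (2 ^ k : ℝ) ^ 2 := by nlinarith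
  have e1 : 2 * r * t * (1 - Real.cos θ) = (r * t) * (2 * (1 - Real.cos θ)) := by ring
  rw [e1]
  constructor
  · calc _ = (2 ^ k : ℝ) ^ 2 / 2 * ((2 : ℝ) ^ (-(2 * m : ℤ)) / 4) := by ring
      _ ≤ _ := by gcongr
  · calc _ ≤ 8 * (2 ^ k : ℝ) ^ 2 * (5 / 2 * (2 : ℝ) ^ (-(2 * m : ℤ))) := by
          gcongr
          linarith
      _ = _ := by ring

/-- Here `s² = |r - t|² + O(4^{k-l-j})`, so `|r - t|` dominates `s`, and dividing by `s + |r - t| ≥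
2·2^(k-l)` leaves an error of order `2^(k-l-2j)`. -/
theorem thirdSide_small_angle_mem {k : ℤ} {l j : ℕ}
    (hk : t ∈ Ico ((2 : ℝ) ^ k) ((2 : ℝ) ^ (k + 1))) (h1 : t < 2 * r) (h2 : r < 2 * t)
    (hl : |r - t| ∈ Ioc ((2 : ℝ) ^ (k - l)) ((2 : ℝ) ^ (k - l + 1)))
    (hθ : θ ∈ nearPiece (l + j)) :
    thirdSide r t θ ∈ Icc ((2 : ℝ) ^ (k - l)) (5 * (2 : ℝ) ^ (k - l)) ∩
      closedBall |r - t| (10 * (2 : ℝ) ^ (k - l - (2 * j : ℕ))) := by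
  have ht : 0 < t := lt_of_lt_of_le (by positivity) hk.1
  have hr : 0 < r := by linarith
  obtain ⟨h3, h4⟩ := mul_cos_bounds hk h1 h2 hθ
  have hs := thirdSide_sq hr ht θ
  have hs0 := thirdSide_nonneg r t θ
  set s := thirdSide r t θ
  have hx : (0 : ℝ) < 2 ^ (k - l) := by positivity
  have e0 : ((2 : ℝ) ^ (k - (l + j : ℕ))) ^ 2 = 2 ^ (k - l) * 2 ^ (k - l - (2 * j : ℕ)) := by
    rw [← zpow_natCast, ← zpow_mul, ← zpow_add₀ two_ne_zero]
    congr 1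
    push_cast
    ring
  have e1 : (2 : ℝ) ^ (k - l - (2 * j : ℕ)) ≤ 2 ^ (k - l) :=
    zpow_le_zpow_right₀ one_le_two (by omega)
  have hy : (0 : ℝ) < 2 ^ (k - l - (2 * j : ℕ)) := by positivity
  rw [e0] at h3 h4
  have hl1 := hl.1
  have hl2 := hl.2
  rw [zpow_add_one₀ two_ne_zero] at hl2
  rw [← sq_abs (r - t)] at hs
  set x := (2 : ℝ) ^ (k - l)
  set y := (2 : ℝ) ^ (k - l - (2 * j : ℕ))
  set ρ := |r - t|
  have hsρ : ρ ≤ s := by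
    refine abs_le_of_sq_le_sq' ?_ hs0 |>.2
    nlinarith
  have hs5 : s ≤ 5 * x := by
    refine abs_le_of_sq_le_sq' ?_ (by linarith) |>.2
    nlinarith
  have key : s - ρ ≤ 10 * y := by
    have : (s - ρ) * (2 * x) ≤ 10 * y * (2 * x) := by
      calc (s - ρ) * (2 * x) ≤ (s - ρ) * (s + ρ) := by
            gcongr
            linarith
        _ ≤ 10 * y * (2 * x) := by nlinarith
    exact le_of_mul_le_mul_right this (by linarith)
  refine ⟨⟨by linarith, hs5⟩, ?_⟩
  rw [mem_closedBall, Real.dist_eq, abs_le]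
  constructor <;> linarith

/-- Now the angular term of order `4^{k-m}` dominates: `1 ≤ j` gives `|r - t| ≤ 2^(k-m)`. Only the
size of `s` is retained. -/
theorem thirdSide_large_angle_mem {k : ℤ} {j : ℕ}
    (hk : t ∈ Ico ((2 : ℝ) ^ k) ((2 : ℝ) ^ (k + 1))) (h1 : t < 2 * r) (h2 : r < 2 * t)
    (hj : 1 ≤ j) (hl : |r - t| ≤ 2 * (2 : ℝ) ^ (k - m - j)) (hθ : θ ∈ nearPiece m) :
    thirdSide r t θ ∈ Icc ((2 : ℝ) ^ (k - m - 2)) (5 * (2 : ℝ) ^ (k - m)) := by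
  have ht : 0 < t := lt_of_lt_of_le (by positivity) hk.1
  have hr : 0 < r := by linarith
  obtain ⟨h3, h4⟩ := mul_cos_bounds hk h1 h2 hθ
  have hs := thirdSide_sq hr ht θ
  have hs0 := thirdSide_nonneg r t θ
  set s := thirdSide r t θ
  have hx : (0 : ℝ) < 2 ^ (k - m) := by positivity
  have e1 : (2 : ℝ) ^ (k - m - j) ≤ 2 ^ (k - m - 1) :=
    zpow_le_zpow_right₀ one_le_two (by omega)
  rw [zpow_sub_one₀ two_ne_zero] at e1
  rw [← sq_abs (r - t)] at hs
  have e2 : (2 : ℝ) ^ (k - m - 2) = 2 ^ (k - m) / 4 := by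
    rw [zpow_sub₀ two_ne_zero]; norm_num
  rw [e2]
  set x := (2 : ℝ) ^ (k - m)
  have hρ : |r - t| ≤ x := by linarith
  have hρ0 := abs_nonneg (r - t)
  constructor
  · refine abs_le_of_sq_le_sq' ?_ hs0 |>.2
    nlinarith
  · refine abs_le_of_sq_le_sq' ?_ (by linarith) |>.2
    nlinarith

end Geometry

theorem ofReal_lt_lintegral_of_mul_lt {h : ℝ → ℝ≥0∞} (hh : Measurable h) {P B : Set ℝ}
    (hPm : MeasurableSet P) (hPB : P ⊆ B) {b y : ℝ} (hb : 0 < b) (hPb : ∀ s ∈ P, s ≤ b)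
    (hlt : ENNReal.ofReal (b * y) < ∫⁻ s in P, ENNReal.ofReal s * h s) :
    ENNReal.ofReal y < ∫⁻ s in B, h s := by
  have h1 : ∫⁻ s in P, ENNReal.ofReal s * h s ≤ ENNReal.ofReal b * ∫⁻ s in B, h s := by
    calc _ ≤ ∫⁻ s in P, ENNReal.ofReal b * h s := by
          refine setLIntegral_mono' hPm fun s hs ↦ ?_
          gcongr
          exact hPb s hs
      _ = ENNReal.ofReal b * ∫⁻ s in P, h s := lintegral_const_mul _ hh
      _ ≤ _ := mul_le_mul_right (lintegral_mono_set hPB) _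
  rw [ENNReal.ofReal_mul hb.le] at hlt
  exact lt_of_mul_lt_mul_left' (hlt.trans_le h1)

/-- The series `∑ (m + 1) 2^{-ηm}`. -/
noncomputable def geomSum' (η : ℝ) : ℝ≥0∞ := ∑' m : ℕ, ENNReal.ofReal ((m + 1) * 2 ^ (-(η * m)))

theorem geomSum'_ne_top {η : ℝ} (hη : 0 < η) : geomSum' η ≠ ∞ := by
  have h1 : ∀ m : ℕ, (2 : ℝ) ^ (-(η * m)) = ((2 : ℝ) ^ (-η)) ^ m := fun m ↦ by
    rw [← Real.rpow_natCast, ← Real.rpow_mul two_pos.le]; ring_nf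
  have h2 : (2 : ℝ) ^ (-η) < 1 := Real.rpow_lt_one_of_one_lt_of_neg one_lt_two (by linarith)
  have h3 : Summable fun m : ℕ ↦ ((m : ℝ) + 1) * 2 ^ (-(η * m)) := by
    simp_rw [h1, add_mul, one_mul]
    refine Summable.add ?_ (summable_geometric_of_lt_one (by positivity) h2)
    simpa using summable_pow_mul_geometric_of_norm_lt_one 1
      (r := (2 : ℝ) ^ (-η)) (by rwa [Real.norm_of_nonneg (by positivity)])
  rw [geomSum', ← ENNReal.ofReal_tsum_of_nonneg (fun m ↦ by positivity) h3]
  exact ENNReal.ofReal_ne_top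

/-! ### Assembling the cases into a weak type bound on the half line. -/

section LargePieces

variable {E : Set ℝ} {M β : ℝ}

/-- The radii at which some dyadic angular piece is large, for weights centred anywhere. -/
def largePieceSet (E : Set ℝ) (κ ε c : ℝ) (h : ℝ → ℝ≥0∞) : Set ℝ :=
  {r | 0 < r ∧ ∃ t ∈ E, ∀ l : ℕ,
    (∃ m : ℕ, ENNReal.ofReal (c * (r * t * 2 ^ (m * (κ - 2) - ε * m))) <
      ∫⁻ s in thirdSide r t '' farPiece m, ENNReal.ofReal s * h s) ∨
    (∃ m : ℕ, ENNReal.ofReal (c * (r * t * 2 ^ (m * (κ - 2) - ε * ((m : ℤ) - l).natAbs))) <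
      ∫⁻ s in thirdSide r t '' nearPiece m, ENNReal.ofReal s * h s)}

theorem measurableSet_thirdSide_image {r t : ℝ} (hr : 0 < r) (ht : 0 < t) {P : Set ℝ}
    (hP : MeasurableSet P) (hP' : P ⊆ Ioo 0 Real.pi) : MeasurableSet (thirdSide r t '' P) :=
  hP.image_of_measurable_injOn (measurable_thirdSide r t) ((injOn_thirdSide hr ht).mono hP')

theorem two_zpow_neg_two_mul (m : ℕ) : (2 : ℝ) ^ (-(2 * m : ℤ)) = 2 ^ (-(2 * (m : ℝ))) := by
  rw [← Real.rpow_intCast]; push_cast; rfl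

theorem two_zpow_eq_rpow (k : ℤ) : (2 : ℝ) ^ k = 2 ^ (k : ℝ) := (Real.rpow_intCast 2 k).symm

/-- Dividing by `s ≤ 10r` removes the weight `s`, and `2^{m(κ-2)}` splits into the interval length
factor `4^{-m}` and the gain `2^{κm}`. -/
theorem outer_of_piece {r t κ ε c : ℝ} (hr : 0 < r) (ht : 0 < t) {h : ℝ → ℝ≥0∞}
    (hh : Measurable h) {m : ℕ} {P : Set ℝ} {z : ℝ}
    (hP : MeasurableSet P) (hP' : P ⊆ Ioo 0 Real.pi)
    (hmem : ∀ θ ∈ P, thirdSide r t θ ∈ Icc (r / 2) (2 * r) ∩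
      closedBall z (3 * (t * (2 : ℝ) ^ (-(2 * m : ℤ)))))
    (hlt : ENNReal.ofReal (c * (r * t * 2 ^ (m * (κ - 2) - ε * m))) <
      ∫⁻ s in thirdSide r t '' P, ENNReal.ofReal s * h s) :
    ENNReal.ofReal (c / 10 * 2 ^ ((κ - ε) * m) * (t * (2 : ℝ) ^ (-(2 * m : ℤ)))) <
      ∫⁻ s in Icc (r / 2) (2 * r) ∩ closedBall z (3 * (t * (2 : ℝ) ^ (-(2 * m : ℤ)))), h s := by
  refine ofReal_lt_lintegral_of_mul_lt hh (b := 10 * r)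
    (measurableSet_thirdSide_image hr ht hP hP') ?_ (by positivity) ?_ ?_
  · rintro _ ⟨θ, hθ, rfl⟩
    exact hmem θ hθ
  · rintro _ ⟨θ, hθ, rfl⟩
    linarith [(hmem θ hθ).1.2]
  · convert hlt using 2
    have : (2 : ℝ) ^ (m * (κ - 2) - ε * m) = 2 ^ ((κ - ε) * m) * 2 ^ (-(2 * (m : ℝ))) := by
      rw [← Real.rpow_add two_pos]; ring_nf
    rw [two_zpow_neg_two_mul, this]
    ring

theorem exists_dyadic_distance {r t : ℝ} {k : ℤ} (hk : t ∈ Ico ((2 : ℝ) ^ k) ((2 : ℝ) ^ (k + 1)))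
    (hr : 0 < r) (h2 : r < 2 * t) (hne : r ≠ t) :
    ∃ l : ℕ, |r - t| ∈ Ioc ((2 : ℝ) ^ (k - l)) ((2 : ℝ) ^ (k - l + 1)) := by
  obtain ⟨i, hi⟩ := exists_mem_Ioc_zpow (abs_pos.2 (sub_ne_zero.2 hne)) (one_lt_two (α := ℝ))
  have h3 : |r - t| < t := by rw [abs_lt]; constructor <;> linarith
  have h4 : i < k + 1 :=
    (zpow_lt_zpow_iff_right₀ (one_lt_two (α := ℝ))).1 (hi.1.trans (h3.trans hk.2))
  refine ⟨(k - i).toNat, ?_⟩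
  have : k - ((k - i).toNat : ℤ) = i := by omega
  rwa [this]

theorem largePieceSet_subset (hE0 : E ⊆ Ioi 0) {κ ε c : ℝ} (hc : 0 < c) {h : ℝ → ℝ≥0∞}
    (hh : Measurable h) :
    largePieceSet E κ ε c h ⊆ E ∪
      ((⋃ m : ℕ, outerSet E h m (c / 10 * 2 ^ ((κ - ε) * m))) ∪
      ((⋃ m : ℕ, innerSet E h m (c / 10 * 2 ^ ((κ - ε) * m))) ∪
      ((⋃ j : ℕ, smallAngleSet E h κ j (c / 10 * 2 ^ ((κ - ε) * j))) ∪
      ⋃ j : ℕ, largeAngleSet E h κ j (c / 10 * 2 ^ (-(ε * j)))))) := by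
  rintro r ⟨hr, t, htE, hl⟩
  have ht : 0 < t := hE0 htE
  by_cases hne : r = t
  · exact Or.inl (hne ▸ htE)
  right
  have outer : ∀ (m : ℕ) (P : Set ℝ) (z : ℝ), MeasurableSet P → P ⊆ Ioo 0 Real.pi → t ≤ r →
      (z = r + t ∨ z = r - t) →
      (∀ θ ∈ P, thirdSide r t θ ∈ Icc (r / 2) (2 * r) ∩
        closedBall z (3 * (t * (2 : ℝ) ^ (-(2 * m : ℤ))))) →
      ENNReal.ofReal (c * (r * t * 2 ^ (m * (κ - 2) - ε * m))) <
        ∫⁻ s in thirdSide r t '' P, ENNReal.ofReal s * h s →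
      r ∈ ⋃ m : ℕ, outerSet E h m (c / 10 * 2 ^ ((κ - ε) * m)) :=
    fun m P z hP hP' htr hz hmem hlt ↦
      mem_iUnion.2 ⟨m, t, htE, ht, htr, z, hz, outer_of_piece hr ht hh hP hP' hmem hlt⟩
  -- The triangle is symmetric in `r` and `t`, so the outer argument applies with the roles
  -- exchanged.
  have inner : ∀ (m : ℕ) (P : Set ℝ) (z : ℝ), MeasurableSet P → P ⊆ Ioo 0 Real.pi → r ≤ t →
      (z = t + r ∨ z = t - r) →
      (∀ θ ∈ P, thirdSide t r θ ∈ Icc (t / 2) (2 * t) ∩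
        closedBall z (3 * (r * (2 : ℝ) ^ (-(2 * m : ℤ))))) →
      ENNReal.ofReal (c * (r * t * 2 ^ (m * (κ - 2) - ε * m))) <
        ∫⁻ s in thirdSide r t '' P, ENNReal.ofReal s * h s →
      r ∈ ⋃ m : ℕ, innerSet E h m (c / 10 * 2 ^ ((κ - ε) * m)) :=
    fun m P z hP hP' hrt hz hmem hlt ↦ by
      have himg : thirdSide r t '' P = thirdSide t r '' P :=
        image_congr fun θ _ ↦ thirdSide_comm r t θ
      rw [himg, mul_comm r t] at hlt
      exact mem_iUnion.2 ⟨m, hr, t, htE, hrt, z, hz, outer_of_piece ht hr hh hP hP' hmem hlt⟩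
  have far : ∀ m : ℕ, ENNReal.ofReal (c * (r * t * 2 ^ (m * (κ - 2) - ε * m))) <
      ∫⁻ s in thirdSide r t '' farPiece m, ENNReal.ofReal s * h s →
      r ∈ (⋃ m : ℕ, outerSet E h m (c / 10 * 2 ^ ((κ - ε) * m))) ∪
        ((⋃ m : ℕ, innerSet E h m (c / 10 * 2 ^ ((κ - ε) * m))) ∪
        ((⋃ j : ℕ, smallAngleSet E h κ j (c / 10 * 2 ^ ((κ - ε) * j))) ∪
        ⋃ j : ℕ, largeAngleSet E h κ j (c / 10 * 2 ^ (-(ε * j))))) := fun m hlt ↦ by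
    rcases le_total t r with htr | hrt
    · exact Or.inl (outer m _ (r + t) (measurableSet_farPiece m) (farPiece_subset m) htr (Or.inl rfl)
        (fun θ hθ ↦ thirdSide_far_mem ht htr hθ) hlt)
    · exact Or.inr (Or.inl (inner m _ (t + r) (measurableSet_farPiece m) (farPiece_subset m) hrt (Or.inl rfl)
        (fun θ hθ ↦ thirdSide_far_mem hr hrt hθ) hlt))
  rcases le_or_gt (2 * t) r with h1 | h1
  · rcases hl 0 with ⟨m, hm⟩ | ⟨m, hm⟩
    · exact far m hm
    · simp only [CharP.cast_eq_zero, sub_zero, Int.natAbs_natCast] at hm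
      exact Or.inl (outer m _ (r - t) (measurableSet_nearPiece m) (nearPiece_subset m) (by linarith)
        (Or.inr rfl) (fun θ hθ ↦ thirdSide_near_mem ht h1 hθ) hm)
  rcases le_or_gt (2 * r) t with h2 | h2
  · rcases hl 0 with ⟨m, hm⟩ | ⟨m, hm⟩
    · exact far m hm
    · simp only [CharP.cast_eq_zero, sub_zero, Int.natAbs_natCast] at hm
      exact Or.inr (Or.inl (inner m _ (t - r) (measurableSet_nearPiece m) (nearPiece_subset m) (by linarith)
        (Or.inr rfl) (fun θ hθ ↦ thirdSide_near_mem hr h2 hθ) hm))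
  obtain ⟨k, hk⟩ := exists_mem_Ico_zpow ht (one_lt_two (α := ℝ))
  obtain ⟨l, hl'⟩ := exists_dyadic_distance hk hr h1 hne
  have hrt : (2 : ℝ) ^ (2 * (k : ℝ)) ≤ 2 * (r * t) := by
    have e : (2 : ℝ) ^ (2 * (k : ℝ)) = 2 ^ k * 2 ^ k := by
      rw [two_mul, Real.rpow_add two_pos, ← two_zpow_eq_rpow]
    rw [e]
    have hk0 : (0 : ℝ) < 2 ^ k := by positivity
    nlinarith [hk.1]
  -- The weights are centred at the critical angle `2^{-l} ≈ |r - t| / t`; the separated cases use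
  -- the centre `0`.
  rcases hl l with ⟨m, hm⟩ | ⟨m, hm⟩
  · exact far m hm
  rcases le_or_gt l m with hlm | hlm
  · obtain ⟨j, rfl⟩ := Nat.exists_eq_add_of_le hlm
    refine Or.inr (Or.inr (Or.inl (mem_iUnion.2 ⟨j, t, htE, k, l, hk, ?_, |r - t|, ?_, ?_⟩)))
    · have := hk.2
      rw [zpow_add_one₀ two_ne_zero] at this
      rw [zpow_add₀ two_ne_zero]
      norm_num
      linarith
    · rcases abs_choice (r - t) with h3 | h3
      · exact Or.inl h3
      · exact Or.inr (by rw [h3]; ring)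
    · refine ofReal_lt_lintegral_of_mul_lt hh (b := 5 * (2 : ℝ) ^ (k - l))
        (measurableSet_thirdSide_image hr ht (measurableSet_nearPiece (l + j))
          (nearPiece_subset _)) ?_ (by positivity) ?_ (lt_of_le_of_lt ?_ hm)
      · rintro _ ⟨θ, hθ, rfl⟩
        exact thirdSide_small_angle_mem hk h2 h1 hl' hθ
      · rintro _ ⟨θ, hθ, rfl⟩
        exact (thirdSide_small_angle_mem hk h2 h1 hl' hθ).1.2
      · refine ENNReal.ofReal_le_ofReal ?_
        have e1 : (((l + j : ℕ) : ℤ) - (l : ℤ)).natAbs = j := by omega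
        rw [e1, two_zpow_eq_rpow, two_zpow_eq_rpow]
        calc _ = c / 2 * (2 ^ (2 * (k : ℝ)) * 2 ^ ((l + j : ℕ) * (κ - 2) - ε * j)) := by
              have : (2 : ℝ) ^ (2 * (k : ℝ)) * 2 ^ ((l + j : ℕ) * (κ - 2) - ε * j) =
                  2 ^ (((k - l : ℤ) : ℝ)) * (2 ^ ((κ - ε) * j) * 2 ^ (κ * l) *
                    2 ^ (((k - l - (2 * j : ℕ) : ℤ) : ℝ))) := by
                simp only [← Real.rpow_add two_pos]
                congr 1
                push_cast
                ring
              rw [this]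
              ring
          _ ≤ c / 2 * (2 * (r * t) * 2 ^ ((l + j : ℕ) * (κ - 2) - ε * j)) := by gcongr
          _ = _ := by ring
  · obtain ⟨j, hj⟩ := Nat.exists_eq_add_of_le hlm.le
    have hj1 : 1 ≤ j := by omega
    have hrt' : |r - t| ≤ 2 * (2 : ℝ) ^ (k - m - j) := by
      have := hl'.2
      rw [zpow_add_one₀ two_ne_zero, hj] at this
      have e : k - (m + j : ℕ) = k - m - j := by push_cast; ring
      rw [e] at this
      linarith
    refine Or.inr (Or.inr (Or.inr (mem_iUnion.2 ⟨j, t, htE, k, m, hk, hrt', ?_⟩)))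
    refine ofReal_lt_lintegral_of_mul_lt hh (b := 5 * (2 : ℝ) ^ (k - m))
      (measurableSet_thirdSide_image hr ht (measurableSet_nearPiece m)
        (nearPiece_subset _)) ?_ (by positivity) ?_ (lt_of_le_of_lt ?_ hm)
    · rintro _ ⟨θ, hθ, rfl⟩
      exact thirdSide_large_angle_mem hk h2 h1 hj1 hrt' hθ
    · rintro _ ⟨θ, hθ, rfl⟩
      exact (thirdSide_large_angle_mem hk h2 h1 hj1 hrt' hθ).2
    · refine ENNReal.ofReal_le_ofReal ?_
      have e1 : ((m : ℤ) - (l : ℤ)).natAbs = j := by omega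
      rw [e1, two_zpow_eq_rpow]
      calc _ = c / 2 * (2 ^ (2 * (k : ℝ)) * 2 ^ (m * (κ - 2) - ε * j)) := by
            have : (2 : ℝ) ^ (2 * (k : ℝ)) * 2 ^ (m * (κ - 2) - ε * j) =
                2 ^ (((k - m : ℤ) : ℝ)) * (2 ^ (-(ε * j)) * 2 ^ (κ * m) *
                  2 ^ (((k - m : ℤ) : ℝ))) := by
              simp only [← Real.rpow_add two_pos]
              congr 1
              push_cast
              ring
            rw [this]
            ring
        _ ≤ c / 2 * (2 * (r * t) * 2 ^ (m * (κ - 2) - ε * j)) := by gcongr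
        _ = _ := by ring

/-- Weak type estimate on the radial line. -/
theorem radialMeasure_largePieceSet_le (hE : HasCover E M β) (hE0 : E ⊆ Ioi 0) (hM : 1 ≤ M)
    (hβ : 0 ≤ β) (hβ1 : β < 1) {D : ℕ} (hD : 1 ≤ D) :
    ∃ K : ℝ≥0∞, K ≠ ∞ ∧ ∀ {h : ℝ → ℝ≥0∞}, Measurable h → ∀ {c : ℝ}, 0 < c →
      radialMeasure D (largePieceSet E (D + β) ((1 - β) / 2) c h) ≤
        K * ENNReal.ofReal c⁻¹ * ∫⁻ s, h s ∂(radialMeasure D) := by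
  set η := (1 - β) / 2 with hη
  have hη0 : 0 < η := by rw [hη]; linarith
  have hD' : (1 : ℝ) ≤ D := by exact_mod_cast hD
  set Q := geomSum' η with hQ
  have hQt : Q ≠ ∞ := geomSum'_ne_top hη0
  set G := geomSum (1 - β) with hG
  have hGt : G ≠ ∞ := geomSum_ne_top (by linarith)
  refine ⟨ENNReal.ofReal (200000 * 8 ^ D * M) * Q + (ENNReal.ofReal (1600 * 8 ^ D * M) * G * Q +
    (ENNReal.ofReal (4400 * 16 ^ D * M) * Q + ENNReal.ofReal (600 * 16 ^ D * M) * Q)), ?_, ?_⟩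
  · simp only [ne_eq, ENNReal.add_eq_top, not_or]
    refine ⟨?_, ?_, ?_, ?_⟩ <;> simp [ENNReal.mul_eq_top, hQt, hGt]
  intro h hh c hc
  set N := ∫⁻ s, h s ∂(radialMeasure D) with hN
  -- With `2η = 1 - β`, the comparison of exponents `2β ≤ D + β - 2η` reduces to `1 ≤ D`.
  have pw : ∀ m : ℕ, (2 : ℝ) ^ (β * (2 * m : ℕ)) / (c / 10 * 2 ^ ((D + β - η) * m)) ≤
      10 * c⁻¹ * 2 ^ (-(η * m)) := fun m ↦ by
    have h1 : (2 : ℝ) ^ (β * (2 * m : ℕ)) ≤ 2 ^ ((D + β - η) * m) * 2 ^ (-(η * m)) := by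
      rw [← Real.rpow_add two_pos]
      refine Real.rpow_le_rpow_of_exponent_le one_le_two ?_
      have hm : (0 : ℝ) ≤ m := by positivity
      push_cast
      nlinarith
    rw [div_le_iff₀ (by positivity)]
    refine h1.trans (le_of_eq ?_)
    field_simp
  -- Half of the decay `2^{-(1-β)m}` pays for the pigeonhole weight; the other half is summed.
  have pw' : ∀ m : ℕ, (2 : ℝ) ^ (-((1 - β) * m)) / (c / 10 * 2 ^ (-(η * m))) =
      10 * c⁻¹ * 2 ^ (-(η * m)) := fun m ↦ by
    have h1 : (2 : ℝ) ^ (-((1 - β) * m)) = 2 ^ (-(η * m)) * 2 ^ (-(η * m)) := by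
      rw [← Real.rpow_add two_pos]
      congr 1
      rw [hη]
      ring
    rw [h1]
    field_simp
  have sum_le : ∀ (a : ℕ → ℝ≥0∞) (A : ℝ) (B : ℝ≥0∞), 0 ≤ A →
      (∀ m, a m ≤ ENNReal.ofReal (A * (c⁻¹ * ((m + 1) * 2 ^ (-(η * m))))) * B * N) →
      ∑' m, a m ≤ ENNReal.ofReal A * B * Q * ENNReal.ofReal c⁻¹ * N := by
    intro a A B hA ha
    refine (ENNReal.tsum_le_tsum ha).trans (le_of_eq ?_)
    rw [ENNReal.tsum_mul_right, ENNReal.tsum_mul_right]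
    have : ∀ m : ℕ, ENNReal.ofReal (A * (c⁻¹ * ((m + 1) * 2 ^ (-(η * m))))) =
        ENNReal.ofReal A * ENNReal.ofReal c⁻¹ * ENNReal.ofReal ((m + 1) * 2 ^ (-(η * m))) :=
      fun m ↦ by
        rw [← ENNReal.ofReal_mul hA, ← ENNReal.ofReal_mul (by positivity), mul_assoc]
    simp_rw [this]
    rw [ENNReal.tsum_mul_left, ← geomSum', ← hQ]
    ring
  have hm1 : ∀ m : ℕ, (2 : ℝ) ^ (-(η * m)) ≤ (m + 1) * 2 ^ (-(η * m)) := fun m ↦ by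
    have hm : (0 : ℝ) ≤ m := by positivity
    have h2 : (0 : ℝ) < 2 ^ (-(η * m)) := by positivity
    nlinarith
  refine (measure_mono (largePieceSet_subset hE0 hc hh)).trans ?_
  refine (measure_union_le _ _).trans ?_
  rw [radialMeasure_eq_zero_of_hasCover hE hβ1 hE0 D, zero_add, add_mul, add_mul, add_mul, add_mul,
    add_mul, add_mul]
  refine (measure_union_le _ _).trans (add_le_add ?_ ((measure_union_le _ _).trans (add_le_add ?_
    ((measure_union_le _ _).trans (add_le_add ?_ ?_)))))
  · refine (measure_iUnion_le _).trans ((sum_le _ (200000 * 8 ^ D * M) 1 (by positivity)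
      fun m ↦ ?_).trans (by rw [mul_one]))
    refine (radialMeasure_outer_le hE hM hβ D hh m (by positivity)).trans ?_
    rw [mul_one]
    refine mul_le_mul_left (ENNReal.ofReal_le_ofReal ?_) _
    calc _ = 20000 * 8 ^ D * M * ((m + 1) *
          (2 ^ (β * (2 * m : ℕ)) / (c / 10 * 2 ^ ((D + β - η) * m)))) := by ring
      _ ≤ 20000 * 8 ^ D * M * ((m + 1) * (10 * c⁻¹ * 2 ^ (-(η * m)))) := by
          gcongr
          exact pw m
      _ = _ := by ring
  · refine (measure_iUnion_le _).trans (sum_le _ (1600 * 8 ^ D * M) G (by positivity)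
      fun m ↦ ?_)
    refine (radialMeasure_inner_le hE hM hD hh m (by positivity)).trans ?_
    refine mul_le_mul_left (mul_le_mul_left (ENNReal.ofReal_le_ofReal ?_) _) _
    calc _ ≤ 160 * 8 ^ D * M * (10 * c⁻¹ * 2 ^ (-(η * m))) := by
          gcongr
          exact pw m
      _ = 1600 * 8 ^ D * M * (c⁻¹ * 2 ^ (-(η * m))) := by ring
      _ ≤ _ := by
          gcongr
          exact hm1 m
  · refine (measure_iUnion_le _).trans ((sum_le _ (4400 * 16 ^ D * M) 1 (by positivity)
      fun m ↦ ?_).trans (by rw [mul_one]))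
    refine (radialMeasure_small_angle_le hE hM hβ hD hh m (by positivity)).trans ?_
    rw [mul_one]
    refine mul_le_mul_left (ENNReal.ofReal_le_ofReal ?_) _
    calc _ ≤ 440 * 16 ^ D * M * (10 * c⁻¹ * 2 ^ (-(η * m))) := by
          gcongr
          exact pw m
      _ = 4400 * 16 ^ D * M * (c⁻¹ * 2 ^ (-(η * m))) := by ring
      _ ≤ _ := by
          gcongr
          exact hm1 m
  · refine (measure_iUnion_le _).trans ((sum_le _ (600 * 16 ^ D * M) 1 (by positivity)
      fun m ↦ ?_).trans (by rw [mul_one]))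
    refine (radialMeasure_large_angle_le hE hM hβ hD hh m (by positivity)).trans ?_
    rw [mul_one]
    refine mul_le_mul_left (ENNReal.ofReal_le_ofReal ?_) _
    calc _ = 60 * 16 ^ D * M * (10 * c⁻¹ * 2 ^ (-(η * m))) := by rw [pw' m]
      _ = 600 * 16 ^ D * M * (c⁻¹ * 2 ^ (-(η * m))) := by ring
      _ ≤ _ := by
          gcongr
          exact hm1 m

end LargePieces

theorem map_norm_volume (D : ℕ) :
    (volume : Measure (EuclideanSpace ℝ (Fin (D + 1)))).map norm =
      (volume : Measure (EuclideanSpace ℝ (Fin (D + 1)))).toSphere univ • radialMeasure D := by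
  ext T hT
  have hm : Measurable (T.indicator (1 : ℝ → ℝ≥0∞)) := measurable_one.indicator hT
  rw [← lintegral_indicator_one hT, lintegral_map hm measurable_norm, lintegral_norm_polar _ hm,
    finrank_euclideanSpace_fin, Nat.add_sub_cancel, ← lintegral_radialMeasure D hm,
    lintegral_indicator_one hT]
  rfl

/-- For arbitrary `S` only this inequality is at hand, and it is the direction needed for upper
bounds on level sets. -/
theorem volume_norm_mem_le (D : ℕ) (S : Set ℝ) :
    volume {x : EuclideanSpace ℝ (Fin (D + 1)) | ‖x‖ ∈ S} ≤
      (volume : Measure (EuclideanSpace ℝ (Fin (D + 1)))).toSphere univ * radialMeasure D S := by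
  have h := Measure.le_map_apply (μ := (volume : Measure (EuclideanSpace ℝ (Fin (D + 1)))))
    measurable_norm.aemeasurable S
  rw [map_norm_volume] at h
  exact h

theorem volume_norm_mem (D : ℕ) {S : Set ℝ} (hS : MeasurableSet S) :
    volume {x : EuclideanSpace ℝ (Fin (D + 1)) | ‖x‖ ∈ S} =
      (volume : Measure (EuclideanSpace ℝ (Fin (D + 1)))).toSphere univ * radialMeasure D S := by
  have h := Measure.map_apply (μ := (volume : Measure (EuclideanSpace ℝ (Fin (D + 1)))))
    measurable_norm hS
  rw [map_norm_volume] at h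
  exact h.symm

theorem toSphere_univ_ne_zero (D : ℕ) :
    (volume : Measure (EuclideanSpace ℝ (Fin (D + 1)))).toSphere univ ≠ 0 := by
  rw [Ne, Measure.measure_univ_eq_zero]
  exact Measure.toSphere_ne_zero _

theorem radialMeasure_absolutelyContinuous (D : ℕ) : radialMeasure D ≪ volume :=
  (withDensity_absolutelyContinuous _ _).trans Measure.restrict_le_self.absolutelyContinuous

/-! ### From covers to the weak type estimate. -/

section Sufficiency

variable {𝕜 : Type*} [RCLike 𝕜]

theorem lintegral_profile_eq {D : ℕ} {f : EuclideanSpace ℝ (Fin (D + 1)) → 𝕜} {f₀ g : ℝ → 𝕜}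
    (hf₀ : ∀ x, f x = f₀ ‖x‖) (hgm : StronglyMeasurable g) (hg : ∀ᵐ s : ℝ, 0 < s → f₀ s = g s)
    {p : ℝ} (hp : 0 < p) :
    (volume : Measure (EuclideanSpace ℝ (Fin (D + 1)))).toSphere univ *
      ∫⁻ s, ‖g s‖ₑ ^ p ∂(radialMeasure D) = eLpNorm f (ENNReal.ofReal p) volume ^ p := by
  have hpt : ENNReal.ofReal p ≠ ∞ := ENNReal.ofReal_ne_top
  have hp0 : ENNReal.ofReal p ≠ 0 := by simpa using hp
  have hm : Measurable fun s ↦ ‖g s‖ₑ ^ p := hgm.enorm.pow_const p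
  rw [eLpNorm_eq_lintegral_rpow_enorm_toReal hp0 hpt, ENNReal.toReal_ofReal hp.le,
    ← ENNReal.rpow_mul, one_div_mul_cancel hp.ne', ENNReal.rpow_one]
  have h1 : ∀ᵐ x : EuclideanSpace ℝ (Fin (D + 1)), f x = g ‖x‖ := by
    have h2 : radialMeasure D ({s : ℝ | ¬(0 < s → f₀ s = g s)} ∪ {0}) = 0 :=
      radialMeasure_absolutelyContinuous D
        (measure_union_null (ae_iff.1 hg) (measure_singleton _))
    have h3 := volume_norm_mem_le D ({s : ℝ | ¬(0 < s → f₀ s = g s)} ∪ {0})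
    rw [h2, mul_zero] at h3
    refine measure_mono_null (fun x hx ↦ ?_) (le_antisymm h3 bot_le)
    rcases (norm_nonneg x).eq_or_lt with h | h
    · exact Or.inr h.symm
    · refine Or.inl fun h' ↦ hx ?_
      simp only [mem_ofPred_eq]
      rw [hf₀, h' h]
  calc _ = ∫⁻ s, ‖g s‖ₑ ^ p ∂((volume : Measure (EuclideanSpace ℝ (Fin (D + 1)))).map norm) := by
        rw [map_norm_volume, lintegral_smul_measure, smul_eq_mul]
    _ = ∫⁻ x : EuclideanSpace ℝ (Fin (D + 1)), ‖g ‖x‖‖ₑ ^ p := lintegral_map hm measurable_norm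
    _ = _ := by
        refine lintegral_congr_ae ?_
        filter_upwards [h1] with x hx
        rw [hx]

/-- The weak type estimate follows from the covering condition. -/
theorem weak_type_of_hasCover {n : ℕ} {E : Set ℝ} (hE0 : E ⊆ Ioi 0) {M p : ℝ} (hM : 1 ≤ M)
    (hp : 1 ≤ p) (hp2 : ((n : ℝ) + 1) * (p - 1) < 1) (hE : HasCover E M ((n + 1) * (p - 1))) :
    ∃ C : ℝ≥0, ∀ f : EuclideanSpace ℝ (Fin (n + 2)) → 𝕜,
      IsRadial f → MemLp f (ENNReal.ofReal p) volume → ∀ α : ℝ≥0, 0 < α →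
        volume {x | (α : ℝ≥0∞) < maximalFunction E f x} ≤
          (C : ℝ≥0∞) * eLpNorm f (ENNReal.ofReal p) volume ^ p / (α : ℝ≥0∞) ^ p := by
  have hp0 : 0 < p := by linarith
  set β : ℝ := (n + 1) * (p - 1) with hβ
  have hβ0 : 0 ≤ β := mul_nonneg (by positivity) (by linarith)
  have hκ : ((n + 1 : ℕ) : ℝ) + β = (n + 1) * p := by rw [hβ]; push_cast; ring
  obtain ⟨K, hKt, hK⟩ := radialMeasure_largePieceSet_le hE hE0 hM hβ0 hp2 (D := n + 1) (by omega)
  obtain ⟨c, hc, hpiece⟩ := exists_large_piece n (p := p) (ε := (1 - β) / 2) hp (by linarith)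
  set z := (zonalConst n).toReal with hz
  have hze : zonalConst n = ENNReal.ofReal z := (ENNReal.ofReal_toReal (zonalConst_ne_top n)).symm
  have hz0 : 0 < z := ENNReal.toReal_pos (zonalConst_ne_zero n) (zonalConst_ne_top n)
  have hCt : K * ENNReal.ofReal (z ^ p / c) ≠ ∞ := ENNReal.mul_ne_top hKt ENNReal.ofReal_ne_top
  refine ⟨(K * ENNReal.ofReal (z ^ p / c)).toNNReal, ?_⟩
  rintro f ⟨f₀, hf₀⟩ hf α hα
  obtain ⟨g, hgm, hg⟩ := exists_stronglyMeasurable_profile hf₀ hf.aestronglyMeasurable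
  have hα' : (0 : ℝ) < α := hα
  set A : ℝ := α / z with hA
  have hA0 : 0 < A := by positivity
  have hφ : Measurable fun s ↦ ‖g s‖ₑ := hgm.enorm
  -- The zonal formula needs `x ≠ 0`; the origin is a null set and is split off.
  have hcover : {x : EuclideanSpace ℝ (Fin (n + 2)) | (α : ℝ≥0∞) < maximalFunction E f x} ⊆
      {0} ∪ {x | ‖x‖ ∈ largePieceSet E ((n + 1 : ℕ) + β) ((1 - β) / 2) (c * A ^ p)
        (fun s ↦ ‖g s‖ₑ ^ p)} := by
    intro x hx
    by_cases hx0 : x = 0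
    · exact Or.inl hx0
    right
    have hr : 0 < ‖x‖ := norm_pos_iff.2 hx0
    simp only [mem_ofPred_eq, maximalFunction, lt_iSup_iff] at hx
    obtain ⟨t, htE, hlt⟩ := hx
    have ht : 0 < t := hE0 htE
    refine ⟨hr, t, htE, fun l ↦ ?_⟩
    have h1 := hlt.trans_le (sphericalMeanAbs_le hf₀ hgm hg hx0 ht)
    have h2 : ENNReal.ofReal A < ∫⁻ θ in Ioo 0 Real.pi,
        ENNReal.ofReal (Real.sin θ ^ n) * ‖g (thirdSide ‖x‖ t θ)‖ₑ := by
      have h3 : (α : ℝ≥0∞) = ENNReal.ofReal z * ENNReal.ofReal A := by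
        rw [← ENNReal.ofReal_mul hz0.le, hA, mul_div_cancel₀ _ hz0.ne', ENNReal.ofReal_coe_nnreal]
      rw [h3, hze] at h1
      exact lt_of_mul_lt_mul_left' h1
    rw [hκ]
    exact hpiece hφ hr ht hA0 l h2
  have hcA : 0 < c * A ^ p := by positivity
  have hαp : ENNReal.ofReal (c * A ^ p)⁻¹ = ENNReal.ofReal (z ^ p / c) / (α : ℝ≥0∞) ^ p := by
    rw [← ENNReal.ofReal_coe_nnreal (p := α), ENNReal.ofReal_rpow_of_pos hα',
      ← ENNReal.ofReal_div_of_pos (by positivity), hA, Real.div_rpow hα'.le hz0.le]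
    congr 1
    field_simp
  calc _ ≤ volume ({0} ∪ {x : EuclideanSpace ℝ (Fin (n + 2)) | ‖x‖ ∈
        largePieceSet E ((n + 1 : ℕ) + β) ((1 - β) / 2) (c * A ^ p) (fun s ↦ ‖g s‖ₑ ^ p)}) :=
        measure_mono hcover
    _ ≤ 0 + (volume : Measure (EuclideanSpace ℝ (Fin (n + 2)))).toSphere univ *
        (K * ENNReal.ofReal (c * A ^ p)⁻¹ * ∫⁻ s, ‖g s‖ₑ ^ p ∂(radialMeasure (n + 1))) := by
        refine (measure_union_le _ _).trans (add_le_add (by simp) ?_)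
        refine (volume_norm_mem_le (n + 1) _).trans (mul_le_mul_right ?_ _)
        exact hK (hφ.pow_const p) hcA
    _ = K * ENNReal.ofReal (c * A ^ p)⁻¹ * eLpNorm f (ENNReal.ofReal p) volume ^ p := by
        rw [zero_add, mul_left_comm, lintegral_profile_eq hf₀ hgm hg hp0]
    _ = _ := by
        rw [ENNReal.coe_toNNReal hCt, hαp, ENNReal.div_eq_inv_mul, ENNReal.div_eq_inv_mul]
        ring

end Sufficiency

/-! ### From entropy numbers to covers. -/

section Cover

theorem exists_finset_of_entropyNumber_le {A : Set ℝ} {a B : ℝ} (hB : 0 ≤ B)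
    (h : ((entropyNumber A a : ℕ∞) : ℝ≥0∞) ≤ ENNReal.ofReal B) :
    ∃ s : Finset ℝ, A ⊆ ⋃ u ∈ s, Icc u (u + a) ∧ (s.card : ℝ) ≤ B := by
  have h1 : entropyNumber A a ≠ ⊤ := by
    intro h2
    rw [h2] at h
    simp at h
  have h2 : entropyNumber A a < entropyNumber A a + 1 := (ENat.lt_add_one_iff h1).2 le_rfl
  conv_lhs at h2 => unfold entropyNumber
  simp only [iInf_lt_iff] at h2
  obtain ⟨s, hs, hcard⟩ := h2
  refine ⟨s, hs, ?_⟩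
  have h3 : ((s.card : ℕ∞) : ℝ≥0∞) ≤ ENNReal.ofReal B :=
    (ENat.toENNReal_le.2 ((ENat.lt_add_one_iff h1).1 hcard)).trans h
  rw [ENat.toENNReal_coe, ← ENNReal.ofReal_natCast, ENNReal.ofReal_le_ofReal_iff hB] at h3
  exact h3

/-- Take `δ = 2^{-(n+2)}`, which is below `1/2` even for `n = 0`; the shift by 2 produces `2^{2β}`.
The summand `1` in the constant provides the normalisation `1 ≤ M` used in the weak type estimate.
-/
theorem hasCover_of_entropyNumber_le {E : Set ℝ} {C β : ℝ} (hC : 0 ≤ C)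
    (h : ∀ δ : ℝ, δ ∈ Ioo (0 : ℝ) (1 / 2) →
      (⨆ k : ℤ, ((entropyNumber (dyadicPiece E k) ((2 : ℝ) ^ k * δ) : ℕ∞) : ℝ≥0∞)) ≤
        ENNReal.ofReal (C * δ ^ (-β))) :
    HasCover E (C * 2 ^ (2 * β) + 1) β := by
  intro k n
  have hδ0 : (0 : ℝ) < 2 ^ (-((n : ℝ) + 2)) := by positivity
  have hδ : (2 : ℝ) ^ (-((n : ℝ) + 2)) < 1 / 2 := by
    calc (2 : ℝ) ^ (-((n : ℝ) + 2)) < 2 ^ (-1 : ℝ) :=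
          Real.rpow_lt_rpow_of_exponent_lt one_lt_two (by
            have : (0 : ℝ) ≤ n := by positivity
            linarith)
      _ = 1 / 2 := by rw [Real.rpow_neg_one]; norm_num
  obtain ⟨s, hs, hcard⟩ := exists_finset_of_entropyNumber_le (by positivity)
    ((le_iSup _ k).trans (h _ ⟨hδ0, hδ⟩))
  have ha : (2 : ℝ) ^ k * 2 ^ (-((n : ℝ) + 2)) ≤ 2 ^ (k - n) := by
    rw [two_zpow_eq_rpow, two_zpow_eq_rpow, ← Real.rpow_add two_pos]
    refine Real.rpow_le_rpow_of_exponent_le one_le_two ?_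
    push_cast
    linarith
  have ha2 : (2 : ℝ) ^ (k - n) ≤ 2 ^ k := zpow_le_zpow_right₀ one_le_two (by omega)
  classical
  -- Centres with `|τ| > 3·2^k` are discarded: they are too far from `[2^k, 2^(k+1)]` to be within
  -- `2^(k-n) ≤ 2^k` of any point of it.
  refine ⟨s.filter fun τ ↦ |τ| ≤ 3 * (2 : ℝ) ^ k, ?_, ?_, ?_⟩
  · calc (((s.filter fun τ ↦ |τ| ≤ 3 * (2 : ℝ) ^ k).card : ℕ) : ℝ) ≤ s.card := by
          exact_mod_cast Finset.card_filter_le _ _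
      _ ≤ C * (2 ^ (-((n : ℝ) + 2))) ^ (-β) := hcard
      _ = C * 2 ^ (2 * β) * 2 ^ (β * n) := by
          rw [← Real.rpow_mul two_pos.le, mul_assoc, ← Real.rpow_add two_pos]
          congr 2
          ring
      _ ≤ _ := by
          have : (0 : ℝ) < 2 ^ (β * n) := by positivity
          linarith
  · exact fun τ hτ ↦ (Finset.mem_filter.1 hτ).2
  · intro t htE ht
    have h1 := hs (show t ∈ dyadicPiece E k from ⟨ht, htE⟩)
    simp only [mem_iUnion] at h1
    obtain ⟨u, hu, hut⟩ := h1
    have h2 : |t - u| ≤ (2 : ℝ) ^ (k - n) := by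
      rw [abs_le]
      constructor <;> linarith [hut.1, hut.2]
    refine ⟨u, Finset.mem_filter.2 ⟨hu, ?_⟩, h2⟩
    have h3 := ht.1
    have h4 := ht.2
    rw [zpow_add_one₀ two_ne_zero] at h4
    have h5 : (0 : ℝ) < 2 ^ k := by positivity
    rw [abs_le] at h2 ⊢
    constructor <;> linarith [h2.1, h2.2]

end Cover

/-! ### Necessity: testing on balls. -/

section Necessity

theorem sphereMeasure_ne_top (d : ℕ) (S : Set (sphere (0 : EuclideanSpace ℝ (Fin d)) 1)) :
    sphereMeasure d S ≠ ∞ := by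
  refine ne_top_of_le_ne_top ENNReal.one_ne_top ((measure_mono (subset_univ S)).trans ?_)
  rw [sphereMeasure, Measure.smul_apply, smul_eq_mul]
  exact ENNReal.inv_mul_le_one _

/-- The cells of the grid `aℤ` that meet `A` yield an admissible cover, so there are at least
`entropyNumber A a` of them. They are disjoint, which turns the entropy number into a lower bound
for a measure. -/
theorem exists_cells_of_entropyNumber {A : Set ℝ} {a b c : ℝ} (ha : 0 < a) (hA : A ⊆ Icc b c) :
    ∃ J : Finset ℤ, (∀ j ∈ J, (A ∩ Ico (j • a) ((j + 1) • a)).Nonempty) ∧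
      entropyNumber A a ≤ J.card := by
  classical
  refine ⟨(Finset.Icc ⌊b / a⌋ ⌊c / a⌋).filter
    fun j ↦ (A ∩ Ico (j • a) ((j + 1) • a)).Nonempty, fun j hj ↦ (Finset.mem_filter.1 hj).2, ?_⟩
  set J := (Finset.Icc ⌊b / a⌋ ⌊c / a⌋).filter
    fun j ↦ (A ∩ Ico (j • a) ((j + 1) • a)).Nonempty
  refine (iInf₂_le (J.image fun j : ℤ ↦ j • a) ?_).trans
    (Nat.cast_le.2 Finset.card_image_le)
  intro t ht
  have h1 : t ∈ ⋃ j : ℤ, Ico (j • a) ((j + 1) • a) := by rw [iUnion_Ico_zsmul ha]; trivial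
  obtain ⟨j, hj⟩ := mem_iUnion.1 h1
  have hj' := hj
  simp only [zsmul_eq_mul, mem_Ico, Int.cast_add, Int.cast_one] at hj'
  have hfl : ⌊t / a⌋ = j := by
    rw [Int.floor_eq_iff, le_div_iff₀ ha, div_lt_iff₀ ha]
    exact hj'
  refine mem_biUnion (x := j • a) ?_ ⟨hj.1, ?_⟩
  · refine Finset.mem_coe.2 (Finset.mem_image_of_mem _ (Finset.mem_filter.2 ⟨?_, t, ht, hj⟩))
    rw [Finset.mem_Icc, ← hfl]
    exact ⟨Int.floor_le_floor (by gcongr; exact (hA ht).1),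
      Int.floor_le_floor (by gcongr; exact (hA ht).2)⟩
  · rw [zsmul_eq_mul]
    linarith [hj'.2]

theorem volume_biUnion_cells (J : Finset ℤ) (a : ℝ) :
    volume (⋃ j ∈ J, Ico (j • a) ((j + 1) • a)) = J.card * ENNReal.ofReal a := by
  rw [measure_biUnion_finset
    (fun i _ j _ hij ↦ Set.pairwise_disjoint_Ico_zsmul a hij) fun _ _ ↦ measurableSet_Ico]
  simp [add_mul]

variable {𝕜 : Type*} [RCLike 𝕜]

theorem le_sphericalMeanAbs_indicator_ball {n : ℕ} {R δ t : ℝ} (hR : 0 < R)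
    (hδ : δ ∈ Ioo (0 : ℝ) (1 / 2)) (ht0 : 0 < t) (ht : t ≤ 2 * R)
    {x : EuclideanSpace ℝ (Fin (n + 2))} (hx : x ≠ 0) (hxt : |‖x‖ - t| ≤ R * δ) :
    zonalConst n * ENNReal.ofReal ((δ / (2 * Real.pi)) ^ n * (δ / 4)) ≤
      sphericalMeanAbs t
        ((ball (0 : EuclideanSpace ℝ (Fin (n + 2))) (2 * (R * δ))).indicator
          fun _ ↦ (1 : 𝕜)) x := by
  obtain ⟨hδ0, hδ1⟩ := hδ
  set a := R * δ with ha
  have ha0 : 0 < a := mul_pos hR hδ0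
  have hr : 0 < ‖x‖ := norm_pos_iff.2 hx
  have hrR : ‖x‖ ≤ 3 * R := by
    have := (abs_le.1 hxt).2
    nlinarith
  set S : Set (sphere (0 : EuclideanSpace ℝ (Fin (n + 2))) 1) :=
    {y | ‖x - t • (y : EuclideanSpace ℝ (Fin (n + 2)))‖ < 2 * a} with hS
  have hSm : MeasurableSet S := measurableSet_lt (by fun_prop) measurable_const
  have hind : (fun y : sphere (0 : EuclideanSpace ℝ (Fin (n + 2))) 1 ↦
      (ball (0 : EuclideanSpace ℝ (Fin (n + 2))) (2 * a)).indicator (fun _ ↦ (1 : 𝕜))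
        (x - t • (y : EuclideanSpace ℝ (Fin (n + 2))))) = S.indicator fun _ ↦ (1 : 𝕜) := by
    ext y
    simp [indicator, hS]
  have hlow : sphereMeasure (n + 2) S ≤ sphericalMeanAbs t
      ((ball (0 : EuclideanSpace ℝ (Fin (n + 2))) (2 * a)).indicator fun _ ↦ (1 : 𝕜)) x := by
    rw [sphericalMeanAbs]
    split_ifs with hi
    · rw [sphericalMean, hind, integral_indicator_const _ hSm, enorm_smul, enorm_one, mul_one,
        Real.enorm_eq_ofReal measureReal_nonneg, Measure.real,
        ENNReal.ofReal_toReal (sphereMeasure_ne_top _ _)]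
    -- The convention `∞` for divergent means makes an integrability check unnecessary.
    · exact le_top
  refine le_trans ?_ hlow
  have hφ : Measurable ((Iio (2 * a)).indicator (1 : ℝ → ℝ≥0∞)) :=
    measurable_one.indicator measurableSet_Iio
  have hrad := lintegral_sphere_radial n hx t hφ
  have hSeq : sphereMeasure (n + 2) S = ∫⁻ y : sphere (0 : EuclideanSpace ℝ (Fin (n + 2))) 1,
      (Iio (2 * a)).indicator (1 : ℝ → ℝ≥0∞) ‖x - t • (y : EuclideanSpace ℝ (Fin (n + 2)))‖
        ∂(sphereMeasure (n + 2)) := by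
    rw [← lintegral_indicator_one hSm]
    rfl
  rw [hSeq, hrad]
  have hpi := Real.pi_gt_three
  gcongr
  calc ENNReal.ofReal ((δ / (2 * Real.pi)) ^ n * (δ / 4))
      = ∫⁻ _ in Ioo (δ / 4) (δ / 2), ENNReal.ofReal ((δ / (2 * Real.pi)) ^ n) := by
        rw [setLIntegral_const, Real.volume_Ioo, ENNReal.ofReal_mul (by positivity)]
        congr 2
        ring
    _ ≤ ∫⁻ θ in Ioo (δ / 4) (δ / 2), ENNReal.ofReal (Real.sin θ ^ n) *
          (Iio (2 * a)).indicator (1 : ℝ → ℝ≥0∞) (thirdSide ‖x‖ t θ) := by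
        refine setLIntegral_mono' measurableSet_Ioo fun θ hθ ↦ ?_
        have hθ0 : 0 < θ := by linarith [hθ.1]
        -- For `θ < δ/2` the angular term is at most `6R²(δ/2)² = (3/2)a²`, and `(‖x‖ - t)² ≤ a²`;
        -- the sum stays below `(2a)²`.
        have hside : thirdSide ‖x‖ t θ < 2 * a := by
          refine lt_of_pow_lt_pow_left₀ 2 (by positivity) ?_
          rw [thirdSide_sq hr ht0]
          have h1 : (‖x‖ - t) ^ 2 ≤ a ^ 2 := sq_le_sq' (abs_le.1 hxt).1 (abs_le.1 hxt).2
          have h2 : 2 * (1 - Real.cos θ) ≤ (δ / 2) ^ 2 := by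
            have := Real.one_sub_sq_div_two_le_cos (x := θ)
            nlinarith [hθ.2]
          have h3 : ‖x‖ * t ≤ 3 * R * (2 * R) := by gcongr
          have h4 : ‖x‖ * t * (2 * (1 - Real.cos θ)) ≤ 3 * R * (2 * R) * (δ / 2) ^ 2 :=
            mul_le_mul h3 h2 (by linarith [Real.cos_le_one θ]) (by positivity)
          have h5 : 0 < a ^ 2 := by positivity
          have h6 : 3 * R * (2 * R) * (δ / 2) ^ 2 = 3 / 2 * a ^ 2 := by rw [ha]; ring
          nlinarith
        rw [indicator_of_mem (mem_Iio.2 hside), Pi.one_apply, mul_one]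
        refine ENNReal.ofReal_le_ofReal (pow_le_pow_left₀ (by positivity) ?_ n)
        refine le_trans ?_ (Real.mul_le_sin hθ0.le (by linarith [hθ.2]))
        calc δ / (2 * Real.pi) = 2 / Real.pi * (δ / 4) := by field_simp; norm_num
          _ ≤ _ := by gcongr; exact hθ.1.le
    _ ≤ _ := lintegral_mono_set (Ioo_subset_Ioo (by positivity) (by linarith))

theorem eLpNorm_indicator_ball_rpow {n : ℕ} {p : ℝ} (hp : 1 ≤ p) {ρ : ℝ} (hρ : 0 ≤ ρ) :
    eLpNorm ((ball (0 : EuclideanSpace ℝ (Fin (n + 2))) ρ).indicator fun _ ↦ (1 : 𝕜))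
      (ENNReal.ofReal p) volume ^ p =
      ENNReal.ofReal (ρ ^ (n + 2)) * volume (ball (0 : EuclideanSpace ℝ (Fin (n + 2))) 1) := by
  have hp0 : 0 < p := by linarith
  rw [eLpNorm_indicator_const measurableSet_ball (by simpa using hp0) ENNReal.ofReal_ne_top,
    ENNReal.toReal_ofReal hp0.le, enorm_one, one_mul, ← ENNReal.rpow_mul,
    one_div_mul_cancel hp0.ne', ENNReal.rpow_one, Measure.addHaar_ball _ _ hρ,
    finrank_euclideanSpace_fin]

theorem entropyNumber_le_of_weak_type {n : ℕ} {E : Set ℝ} (hE0 : E ⊆ Ioi 0) {p : ℝ} (hp : 1 ≤ p)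
    {C : ℝ≥0} (h : ∀ f : EuclideanSpace ℝ (Fin (n + 2)) → 𝕜,
      IsRadial f → MemLp f (ENNReal.ofReal p) volume → ∀ α : ℝ≥0, 0 < α →
        volume {x | (α : ℝ≥0∞) < maximalFunction E f x} ≤
          (C : ℝ≥0∞) * eLpNorm f (ENNReal.ofReal p) volume ^ p / (α : ℝ≥0∞) ^ p) :
    ∃ C' : ℝ≥0, ∀ δ : ℝ, δ ∈ Ioo (0 : ℝ) (1 / 2) →
      (⨆ k : ℤ, ((entropyNumber (dyadicPiece E k) ((2 : ℝ) ^ k * δ) : ℕ∞) : ℝ≥0∞)) ≤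
        ENNReal.ofReal (C' * δ ^ (-(((n : ℝ) + 1) * (p - 1)))) := by
  have hp0 : 0 < p := by linarith
  set z := (zonalConst n).toReal
  have hze : zonalConst n = ENNReal.ofReal z := (ENNReal.ofReal_toReal (zonalConst_ne_top n)).symm
  have hz0 : 0 < z := ENNReal.toReal_pos (zonalConst_ne_zero n) (zonalConst_ne_top n)
  set V := (volume (ball (0 : EuclideanSpace ℝ (Fin (n + 2))) 1)).toReal
  have hVe : volume (ball (0 : EuclideanSpace ℝ (Fin (n + 2))) 1) = ENNReal.ofReal V :=
    (ENNReal.ofReal_toReal measure_ball_lt_top.ne).symm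
  have hV0 : 0 ≤ V := ENNReal.toReal_nonneg
  set σ := ((volume : Measure (EuclideanSpace ℝ (Fin (n + 1 + 1)))).toSphere univ).toReal
  have hσe : (volume : Measure (EuclideanSpace ℝ (Fin (n + 1 + 1)))).toSphere univ =
      ENNReal.ofReal σ := (ENNReal.ofReal_toReal (measure_ne_top _ _)).symm
  have hσ0 : 0 < σ := ENNReal.toReal_pos (toSphere_univ_ne_zero (n + 1)) (measure_ne_top _ _)
  clear_value z V σ
  have hpi := Real.pi_pos
  -- Chosen so that the mean is at least `2cδ^(n+1)`. Taking half of this as the level `α` gives the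
  -- strict inequality in the level set.
  set c : ℝ := z * ((1 / (2 * Real.pi)) ^ n / 8) with hc
  have hc0 : 0 < c := by positivity
  -- Obtained by solving `σ (R/2)^(n+1) · N · Rδ ≤ C V (2Rδ)^(n+2) / (cδ^(n+1))^p` for `N`; the
  -- powers of `R` cancel, which makes the bound uniform in `k`.
  set K : ℝ := C * V * 2 ^ (n + 2) * 2 ^ (n + 1) / (σ * c ^ p) with hK
  have hK0 : 0 ≤ K := by positivity
  refine ⟨⟨K, hK0⟩, fun δ hδ ↦ iSup_le fun k ↦ ?_⟩
  change _ ≤ ENNReal.ofReal (K * _)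
  have hδ0 := hδ.1
  set R : ℝ := (2 : ℝ) ^ k with hRdef
  have hR : 0 < R := by positivity
  set a := R * δ with ha
  have ha0 : 0 < a := mul_pos hR hδ0
  have haR : a ≤ R / 2 := by nlinarith [hδ.2]
  obtain ⟨J, hJ, hcard⟩ := exists_cells_of_entropyNumber (A := dyadicPiece E k) ha0
    inter_subset_left
  refine (ENat.toENNReal_le.2 hcard).trans ?_
  rw [ENat.toENNReal_coe, ← ENNReal.ofReal_natCast]
  refine ENNReal.ofReal_le_ofReal ?_
  set U := ⋃ j ∈ J, Ico (j • a) ((j + 1) • a) with hU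
  have hUm : MeasurableSet U := J.measurableSet_biUnion fun _ _ ↦ measurableSet_Ico
  have hnear : ∀ r ∈ U, ∃ t ∈ E, R ≤ t ∧ t ≤ 2 * R ∧ |r - t| ≤ a := by
    intro r hr
    simp only [hU, mem_iUnion] at hr
    obtain ⟨j, hj, hr⟩ := hr
    obtain ⟨t, ⟨ht, htE⟩, htj⟩ := hJ j hj
    have ht2 := ht.2
    rw [zpow_add_one₀ two_ne_zero] at ht2
    refine ⟨t, htE, ht.1, by linarith, ?_⟩
    simp only [zsmul_eq_mul, mem_Ico, Int.cast_add, Int.cast_one] at hr htj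
    rw [abs_le]
    constructor <;> linarith [hr.1, hr.2, htj.1, htj.2]
  have hUb : U ⊆ Ici (R / 2) := by
    intro r hr
    obtain ⟨t, -, ht, -, hrt⟩ := hnear r hr
    rw [mem_Ici]
    linarith [(abs_le.1 hrt).1]
  set α : ℝ := c * δ ^ (n + 1) with hα
  have hα0 : 0 < α := by positivity
  have hαlt : ENNReal.ofReal α <
      zonalConst n * ENNReal.ofReal ((δ / (2 * Real.pi)) ^ n * (δ / 4)) := by
    rw [hze, ← ENNReal.ofReal_mul hz0.le, ENNReal.ofReal_lt_ofReal_iff (by positivity)]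
    have h1 : z * ((δ / (2 * Real.pi)) ^ n * (δ / 4)) = 2 * α := by
      rw [hα, hc, div_eq_mul_one_div δ (2 * Real.pi), mul_pow]
      ring
    linarith
  set f : EuclideanSpace ℝ (Fin (n + 2)) → 𝕜 := (ball 0 (2 * a)).indicator fun _ ↦ 1 with hf
  have hfrad : IsRadial f :=
    ⟨(Iio (2 * a)).indicator fun _ ↦ 1, fun x ↦ by simp [hf, indicator]⟩
  have hfmem : MemLp f (ENNReal.ofReal p) volume :=
    memLp_indicator_const _ measurableSet_ball _ (Or.inr measure_ball_lt_top.ne)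
  have hsub : {x : EuclideanSpace ℝ (Fin (n + 1 + 1)) | ‖x‖ ∈ U} ⊆
      {x | ((α.toNNReal : ℝ≥0) : ℝ≥0∞) < maximalFunction E f x} := by
    intro x hx
    obtain ⟨t, htE, ht1, ht2, hxt⟩ := hnear _ hx
    have hx0 : x ≠ 0 := by
      rintro rfl
      have := hUb hx
      rw [mem_Ici, norm_zero] at this
      linarith
    exact (hαlt.trans_le (le_sphericalMeanAbs_indicator_ball hR hδ (hE0 htE) ht2 hx0 hxt)).trans_le
      (le_iSup₂_of_le t htE le_rfl)
  have hmain := (measure_mono hsub).trans (h f hfrad hfmem α.toNNReal (Real.toNNReal_pos.2 hα0))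
  rw [volume_norm_mem (n + 1) hUm] at hmain
  have hlow := mul_le_mul_right (le_radialMeasure (n + 1) hUm (half_pos hR) hUb)
    ((volume : Measure (EuclideanSpace ℝ (Fin (n + 1 + 1)))).toSphere univ)
  have hineq := hlow.trans hmain
  rw [volume_biUnion_cells J a, hσe, hf, eLpNorm_indicator_ball_rpow hp (by positivity), hVe,
    ← ENNReal.ofReal_natCast, ← ENNReal.ofReal_coe_nnreal, ← ENNReal.ofReal_coe_nnreal,
    Real.coe_toNNReal _ hα0.le, ENNReal.ofReal_rpow_of_pos hα0,
    ← ENNReal.ofReal_mul (by positivity), ← ENNReal.ofReal_mul (by positivity),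
    ← ENNReal.ofReal_mul (by positivity), ← ENNReal.ofReal_mul (by positivity),
    ← ENNReal.ofReal_mul (by positivity), ← ENNReal.ofReal_div_of_pos (by positivity),
    ENNReal.ofReal_le_ofReal_iff (by positivity)] at hineq
  have hδp : (δ ^ (n + 1)) ^ p = δ ^ ((n + 1) * p : ℝ) := by
    rw [← Real.rpow_natCast, ← Real.rpow_mul hδ0.le]
    push_cast
    rfl
  have hδq : δ ^ (-(((n : ℝ) + 1) * (p - 1))) * δ ^ ((n + 1) * p : ℝ) = δ ^ (n + 1) := by
    rw [← Real.rpow_add hδ0, ← Real.rpow_natCast]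
    congr 1
    push_cast
    ring
  have hαp : α ^ p = c ^ p * δ ^ ((n + 1) * p : ℝ) := by
    rw [hα, Real.mul_rpow hc0.le (by positivity), hδp]
  rw [hαp, le_div_iff₀ (by positivity)] at hineq
  have hpos : 0 < σ * c ^ p * δ ^ ((n + 1) * p : ℝ) * (R ^ (n + 2) * δ) := by positivity
  refine le_of_mul_le_mul_right ?_ hpos
  have hKe : K * (σ * c ^ p) = C * V * 2 ^ (n + 2) * 2 ^ (n + 1) := by
    rw [hK, div_mul_cancel₀ _ (by positivity)]
  calc (J.card : ℝ) * (σ * c ^ p * δ ^ ((n + 1) * p : ℝ) * (R ^ (n + 2) * δ))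
      = 2 ^ (n + 1) * (σ * ((R / 2) ^ (n + 1) * (J.card * a)) *
          (c ^ p * δ ^ ((n + 1) * p : ℝ))) := by
        rw [div_pow, ha]
        field_simp
        ring
    _ ≤ 2 ^ (n + 1) * (C * ((2 * a) ^ (n + 2) * V)) := by gcongr
    _ = K * (σ * c ^ p) * δ ^ (n + 1) * (R ^ (n + 2) * δ) := by
        rw [hKe, ha]
        ring
    _ = _ := by
        rw [← hδq]
        ring

end Necessity

end SphericalMaximal

theorem theorem1p1 {𝕜 : Type*} [RCLike 𝕜] (d : ℕ) (hd : 2 ≤ d)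
    (E : Set ℝ) (hE : E ⊆ Set.Ioi 0)
    (p : ℝ) (hp1 : 1 ≤ p) (hp2 : p < (d : ℝ) / ((d : ℝ) - 1)) :
    (∃ C : ℝ≥0, ∀ f : EuclideanSpace ℝ (Fin d) → 𝕜,
        SphericalMaximal.IsRadial f → MemLp f (ENNReal.ofReal p) volume →
        ∀ α : ℝ≥0, 0 < α →
          volume {x | (α : ℝ≥0∞) < SphericalMaximal.maximalFunction E f x} ≤
            (C : ℝ≥0∞) * eLpNorm f (ENNReal.ofReal p) volume ^ p / (α : ℝ≥0∞) ^ p) ↔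
    (∃ C' : ℝ≥0, ∀ δ : ℝ, δ ∈ Set.Ioo (0 : ℝ) (1 / 2) →
        (⨆ k : ℤ, ((SphericalMaximal.entropyNumber
            (SphericalMaximal.dyadicPiece E k) ((2 : ℝ) ^ k * δ) : ℕ∞) : ℝ≥0∞)) ≤
          ENNReal.ofReal ((C' : ℝ) * δ ^ (-(((d : ℝ) - 1) * (p - 1))))) := by
  obtain ⟨n, rfl⟩ := Nat.exists_eq_add_of_le' hd
  have hd1 : ((n + 2 : ℕ) : ℝ) - 1 = n + 1 := by push_cast; ring
  -- This is `β < 1`, the form in which the upper bound on `p` enters.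
  have hp3 : ((n : ℝ) + 1) * (p - 1) < 1 := by
    rw [hd1, lt_div_iff₀ (by positivity)] at hp2
    push_cast at hp2
    linarith
  rw [hd1]
  constructor
  · rintro ⟨C, hC⟩
    exact SphericalMaximal.entropyNumber_le_of_weak_type hE hp1 hC
  · rintro ⟨C', hC'⟩
    refine SphericalMaximal.weak_type_of_hasCover hE ?_ hp1 hp3
      (SphericalMaximal.hasCover_of_entropyNumber_le C'.2 hC')
    exact le_add_of_nonneg_left (mul_nonneg C'.2 (by positivity))
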